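/- **Setting.** Let $B:\mathbb R^3\to\mathbb R^3$ be a magnetic field, $\widetilde B(x)=B(x)\wedge x$, and let $A(x)=\int_0^1\widetilde B(tx)\,dt$ be its vector potential in the Poincaré gauge. Put $P=-i\nabla$ and let $\mathscr D(P-A)=\{\varphi\in L^2(\mathbb R^3,\mathbb C^2): (P-A)\varphi\in L^2\}$, derivatives being taken in the sense of distributions. Let $V=V^s+V^\ell$, where $V^s,V^\ell$ are functions on $\mathbb R^3$ with values in the Hermitian $2\times2$ matrices. For a Hermitian matrix $M$ let $|M|$ be the largest absolute value of its eigenvalues and $|M_+|$ the largest of the positive parts of its eigenvalues. Set $\limsup_{|x|\to\infty}f(x)=\lim_{r\to\infty}\operatorname{ess\,sup}_{|x|\ge r}f(x)$, and similarly for $\lim_{|x|\to\infty}$. **Hypotheses.** Outside of a compact set the distribution $x\cdot\nabla V^\ell$ is a function, and $|\widetilde B|$, $|V|$, $|xV^s|$, $|x\cdot\nabla V^\ell|$ are bounded outside of a compact set; $\lim_{|x|\to\infty}|V_+(x)|=0$; and $|\widetilde B|,|V^s|,|V^\ell|\in L^p_{\rm loc}(\mathbb R^3)$ for some $p>3$.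 **Proposition.** The potential $A$ is well defined a.e. and lies in $L^2_{\rm loc}$, $V$ is Hermitian, and the following hold. 1. For every $R>0$ the function $x\mapsto|x|^{-1}\log_+^2(R/|x|)\,|\widetilde B(x)|^2$ is in $L^1_{\rm loc}(\mathbb R^3)$. 2. If in addition $|B|\in L^p_{\rm loc}(\mathbb R^3)$ and $|B|$ is bounded outside of a compact set, then there is $C$ with $\||B|\varphi\|_2^2+\||\widetilde B|\varphi\|_2^2\le C(\|(P-A)\varphi\|_2^2+\|\varphi\|_2^2)$ for all $\varphi\in\mathscr D(P-A)$. 3. For every $\alpha_0>0$ there is $C$ such that $|\langle\varphi,V\varphi\rangle|\le\alpha_0\|(P-A)\varphi\|_2^2+C\|\varphi\|_2^2$ for all $\varphi\in\mathscr D(P-A)$. 4. For each $W\in\{V,V^s,V^\ell\}$ there are $R_0>0$ and positive $a_R,\gamma_R$ ($R\ge R_0$) with $a_R,\gamma_R\to0$ as $R\to\infty$ and $\langle\varphi,W\varphi\rangle_+\le a_R\|(P-A)\varphi\|_2^2+\gamma_R\|\varphi\|_2^2$ for all $\varphi\in\mathscr D(P-A)$ with $\operatorname{supp}\varphi\subset\{|x|\ge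 R\}$. 5. For each $W\in\{V,-V,V^s,-V^s\}$ there are $R_0>0$ and positive $a_R,\gamma_R$ ($R\ge R_0$) with $a_R\to0$, $\liminf_{R\to\infty}\gamma_R<\infty$, such that every $\varphi\in\mathscr D(P-A)$ with support in $\{|x|\ge R_0\}$ is in the form domain of $W$, and $\langle\varphi,W\varphi\rangle\le a_R\|(P-A)\varphi\|_2^2+\gamma_R\|\varphi\|_2^2$ if $\operatorname{supp}\varphi\subset\{|x|\ge R\}$. 6. The distribution $x\cdot\nabla V^\ell$ extends from $C_c^\infty(\mathbb R^3,\mathbb C^2)$ to a sesquilinear form on $\mathscr D(P-A)$ that is bounded in the graph norm. With this extension, there are positive sequences $\varepsilon_j\to0$, $R_j\to\infty$ and nonincreasing positive sequences $\beta_j\to\beta$, $\omega_{1,j}\to\omega_1$, $\omega_{2,j}\to\omega_2$ such that for all $j$ and all $\varphi\in\mathscr D(P-A)$ with $\operatorname{supp}\varphi\subset\{|x|\ge R_j\}$ $$\||\widetilde B|\varphi\|_2^2\le\varepsilon_j\|(P-A)\varphi\|_2^2+\beta_j^2\|\varphi\|_2^2,\qquad \|xV^s\varphi\|_2^2\le\varepsilon_j\|(P-A)\varphi\|_2^2+\omega_{1,j}^2\|\varphi\|_2^2,$$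 $$\langle\varphi,x\cdot\nabla V^\ell\varphi\rangle\le\varepsilon_j\|(P-A)\varphi\|_2^2+\omega_{2,j}\|\varphi\|_2^2,$$ and $$\beta\le\limsup_{|x|\to\infty}|\widetilde B(x)|,\qquad \omega_1\le\limsup_{|x|\to\infty}|xV^s(x)|,\qquad \omega_2\le\limsup_{|x|\to\infty}|(x\cdot\nabla V^\ell(x))_+|.$$ 7. With the same extension, for all $\alpha_1,\alpha_2,\alpha_3>0$ there is $C>0$ such that for all $\varphi\in\mathscr D(P-A)$ $$\||\widetilde B|\varphi\|_2^2+\|xV^s\varphi\|_2^2\le\tfrac{\alpha_1^2}{4}\|(P-A)\varphi\|_2^2+C\|\varphi\|_2^2,$$ $$\langle\varphi,x\cdot\nabla V^\ell\varphi\rangle\le\alpha_2\|(P-A)\varphi\|_2^2+C\|\varphi\|_2^2,\qquad |\langle\varphi,V^s\varphi\rangle|\le\alpha_3\|(P-A)\varphi\|_2^2+C\|\varphi\|_2^2.$$ -/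

import Mathlib

open MeasureTheory Filter Topology
open scoped ENNReal ContDiff ComplexConjugate Matrix.Norms.L2Operator

/-! Pauli operators on three-dimensional space: magnetic fields in the Poincare gauge, magnetic
Sobolev spaces, and the relative bounds used to exclude embedded eigenvalues. -/

namespace Pauli

noncomputable section

/-- Euclidean three-space. -/
abbrev Space : Type := EuclideanSpace ℝ (Fin 3)

/-- The spin space `ℂ²` with its Hermitian norm. -/
abbrev Spinor : Type := EuclideanSpace ℂ (Fin 2)

/-- Complex two by two matrices; their norm is the operator norm on `ℂ²`. For Hermitian matrices
this is the largest absolute value of an eigenvalue. -/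
abbrev Mat : Type := Matrix (Fin 2) (Fin 2) ℂ

/-- The action of a matrix on a spinor. -/
def act (M : Mat) (v : Spinor) : Spinor := WithLp.toLp 2 (M.mulVec v.ofLp)

/-- The size of the positive part of a Hermitian matrix: the larger one of the positive parts of
its two eigenvalues (and, by convention, zero for a matrix that is not Hermitian). -/
def posPartNorm (M : Mat) : ℝ :=
  open scoped Classical in
  if h : M.IsHermitian then max (max (h.eigenvalues 0) 0) (max (h.eigenvalues 1) 0) else 0

/-! ### Behaviour at infinity and local integrability -/

/-- `f` belongs to `L^p` on every compact set. -/
def LpLoc {F : Type*} [NormedAddCommGroup F] (p : ℝ≥0∞) (f : Space → F) : Prop :=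
  ∀ K : Set Space, IsCompact K → MemLp f p (volume.restrict K)

/-- `f` is (essentially) bounded outside of a compact set. -/
def BoundedOutsideCompact {F : Type*} [NormedAddCommGroup F] (f : Space → F) : Prop :=
  ∃ R C : ℝ, ∀ᵐ x : Space, R ≤ ‖x‖ → ‖f x‖ ≤ C

/-- The limit superior at infinity of a nonnegative function: the limit, as `r → ∞`, of the
nonincreasing function `r ↦ ess sup_{|x| ≥ r} f(x)`. -/
def essLimsup (f : Space → ℝ≥0∞) : ℝ≥0∞ :=
  ⨅ r : ℝ, essSup f (volume.restrict {x : Space | r ≤ ‖x‖})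

/-- The (essential) support of `φ` is contained in `{|x| ≥ R}`. -/
def SupportedOutside (R : ℝ) (φ : Space → Spinor) : Prop :=
  ∀ᵐ x : Space, ‖x‖ < R → φ x = 0

/-! ### The magnetic field and its Poincare gauge -/

/-- The vector product in three-space. -/
def cross (a b : Space) : Space := WithLp.toLp 2 (crossProduct a.ofLp b.ofLp)

/-- The field `x ↦ B(x) ∧ (x - w)`. -/
def tilde (w : Space) (B : Space → Space) (x : Space) : Space := cross (B x) (x - w)

/-- The vector potential in the Poincare gauge with base point zero,
`A(x) = ∫₀¹ B(tx) ∧ (tx) dt`. -/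
def poincareGauge (B : Space → Space) (x : Space) : Space :=
  ∫ t in (0 : ℝ)..1, tilde 0 B (t • x)

/-! ### The magnetic Sobolev space -/

/-- `φ` lies in the domain of `P - A`, where `P = -i∇`, and `(P - A)φ = η`: both `φ` and the
components `η₁, η₂, η₃` are square integrable, and `-i ∂ⱼφ - Aⱼφ = ηⱼ` in the sense of
distributions. -/
structure IsMagneticGradient (A : Space → Space) (φ : Space → Spinor)
    (η : Fin 3 → Space → Spinor) : Prop where
  memLp : MemLp φ 2 volume
  memLp_grad : ∀ j, MemLp (η j) 2 volume
  weak : ∀ (j : Fin 3) (f : Space → ℝ), ContDiff ℝ ∞ f → HasCompactSupport f →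
    ∫ x, ((Complex.I * ((fderiv ℝ f x (EuclideanSpace.single j 1) : ℝ) : ℂ)) • φ x
        - (A x j * f x) • φ x) = ∫ x, f x • η j x

/-- The domain of `P - A` in `L²(ℝ³, ℂ²)`. -/
def InDomain (A : Space → Space) (φ : Space → Spinor) : Prop :=
  ∃ η, IsMagneticGradient A φ η

/-- The square of the norm of `L²(ℝ³, ℂ²)`. -/
def normSq (φ : Space → Spinor) : ℝ := ∫ x, ‖φ x‖ ^ 2

/-- The square of the norm of `L²(ℝ³, ℂ²)³`. -/
def gradNormSq (η : Fin 3 → Space → Spinor) : ℝ := ∑ j, normSq (η j)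

/-! ### Quadratic forms of potentials -/

/-- The form `⟨φ, W φ⟩` of a matrix potential. -/
def potForm (W : Space → Mat) (φ : Space → Spinor) : ℂ :=
  ∫ x, inner ℂ (φ x) (act (W x) (φ x))

/-- The integral that defines `⟨φ, W φ⟩` converges absolutely, in the strong sense that
`|W| |φ|²` is integrable; in particular `φ` is in the quadratic form domain of `W`. -/
def InFormDomain (W : Space → Mat) (φ : Space → Spinor) : Prop :=
  Integrable (fun x => inner ℂ (φ x) (act (W x) (φ x))) volume ∧
    Integrable (fun x => ‖W x‖ * ‖φ x‖ ^ 2) volume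

/-- On the open set `U`, the distribution `x · ∇W` is given by the locally integrable function
`G`; here `div (x f) = 3 f + x · ∇f`. -/
structure HasWeakEulerDerivOn (W G : Space → Mat) (U : Set Space) : Prop where
  locInt : LocallyIntegrableOn W U volume
  locInt_deriv : LocallyIntegrableOn G U volume
  weak : ∀ (k l : Fin 2) (f : Space → ℝ), ContDiff ℝ ∞ f → HasCompactSupport f → tsupport f ⊆ U →
    -∫ x, ((3 * f x + fderiv ℝ f x x : ℝ) : ℂ) * W x k l = ∫ x, (f x : ℂ) * G x k l

/-- The distribution `x · ∇W` as a sesquilinear form on test spinors: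
`⟨φ, x · ∇W ψ⟩ = - ∑ₖₗ ∫ Wₖₗ div (x φ̄ₖ ψₗ)`. -/
def eulerFormOnTest (W : Space → Mat) (φ ψ : Space → Spinor) : ℂ :=
  -∫ x, ∑ k : Fin 2, ∑ l : Fin 2,
    W x k l * (3 * (conj (φ x k) * ψ x l) + fderiv ℝ (fun y => conj (φ y k) * ψ y l) x x)

/-- `q` is the extension of the distribution `x · ∇W` from test spinors to the domain of `P - A`:
a sesquilinear form which is bounded for the graph norm and agrees with the distribution on
test spinors. (If `A` is locally square integrable, test spinors are dense in the domain of
`P - A`, so that there is at most one such form on this domain.) -/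
structure IsEulerForm (A : Space → Space) (W : Space → Mat)
    (q : (Space → Spinor) → (Space → Spinor) → ℂ) : Prop where
  add_left : ∀ φ₁ φ₂ ψ, InDomain A φ₁ → InDomain A φ₂ → InDomain A ψ →
    q (φ₁ + φ₂) ψ = q φ₁ ψ + q φ₂ ψ
  add_right : ∀ φ ψ₁ ψ₂, InDomain A φ → InDomain A ψ₁ → InDomain A ψ₂ →
    q φ (ψ₁ + ψ₂) = q φ ψ₁ + q φ ψ₂
  smul_left : ∀ (c : ℂ) φ ψ, InDomain A φ → InDomain A ψ → q (c • φ) ψ = conj c * q φ ψ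
  smul_right : ∀ (c : ℂ) φ ψ, InDomain A φ → InDomain A ψ → q φ (c • ψ) = c * q φ ψ
  bounded : ∃ C : ℝ, ∀ φ η ψ ζ, IsMagneticGradient A φ η → IsMagneticGradient A ψ ζ →
    ‖q φ ψ‖ ^ 2 ≤ C * (gradNormSq η + normSq φ) * (gradNormSq ζ + normSq ψ)
  test : ∀ φ ψ : Space → Spinor, ContDiff ℝ ∞ φ → HasCompactSupport φ →
    ContDiff ℝ ∞ ψ → HasCompactSupport ψ → q φ ψ = eulerFormOnTest W φ ψ

/-! ### The hypotheses on the field and the potential -/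

/-- Mild local integrability of the field: for all `R > 0` the function
`|x - w|⁻¹ log₊²(R / |x - w|) |B(x) ∧ (x - w)|²` is locally integrable. -/
def LogIntegrableAt (w : Space) (B : Space → Space) : Prop :=
  ∀ R : ℝ, 0 < R → LocallyIntegrable
    (fun x => ‖x - w‖⁻¹ * (max (Real.log (R / ‖x - w‖)) 0) ^ 2 * ‖tilde w B x‖ ^ 2) volume

/-- `|B|²` and `|B ∧ x|²` are relatively form bounded with respect to `(P - A)²`, where `A` is the
Poincare gauge potential of `B`. -/
def FieldFormBounded (B : Space → Space) : Prop :=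
  ∃ C : ℝ, ∀ φ η, IsMagneticGradient (poincareGauge B) φ η →
    MemLp (fun x => ‖B x‖ • φ x) 2 volume ∧ MemLp (fun x => ‖tilde 0 B x‖ • φ x) 2 volume ∧
    normSq (fun x => ‖B x‖ • φ x) + normSq (fun x => ‖tilde 0 B x‖ • φ x)
      ≤ C * (gradNormSq η + normSq φ)

/-- `W` is relatively form bounded with respect to `(P - A)²`, with relative bound `α`. -/
def FormBoundedWith (A : Space → Space) (W : Space → Mat) (α : ℝ) : Prop :=
  ∃ C : ℝ, ∀ φ η, IsMagneticGradient A φ η →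
    InFormDomain W φ ∧ ‖potForm W φ‖ ≤ α * gradNormSq η + C * normSq φ

/-- `W` is bounded from above at infinity with respect to `(P - A)²`. -/
def BoundedAboveAtInfinity (A : Space → Space) (W : Space → Mat) : Prop :=
  ∃ R₀ : ℝ, 0 < R₀ ∧ (∀ φ, InDomain A φ → SupportedOutside R₀ φ → InFormDomain W φ) ∧
    ∃ α γ : ℝ → ℝ, (∀ R, R₀ ≤ R → 0 < α R ∧ 0 < γ R) ∧ Tendsto α atTop (𝓝 0) ∧
      (∃ C : ℝ, ∃ᶠ R in atTop, γ R ≤ C) ∧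
      ∀ R, R₀ ≤ R → ∀ φ η, IsMagneticGradient A φ η → SupportedOutside R φ →
        (potForm W φ).re ≤ α R * gradNormSq η + γ R * normSq φ

/-- `W` is bounded (from above and from below) at infinity with respect to `(P - A)²`. -/
def BoundedAtInfinity (A : Space → Space) (W : Space → Mat) : Prop :=
  BoundedAboveAtInfinity A W ∧ BoundedAboveAtInfinity A (-W)

/-- The positive part of `W` vanishes at infinity with respect to `(P - A)²`. -/
def PosPartVanishesAtInfinity (A : Space → Space) (W : Space → Mat) : Prop :=
  ∃ R₀ : ℝ, 0 < R₀ ∧ ∃ α γ : ℝ → ℝ, (∀ R, R₀ ≤ R → 0 < α R ∧ 0 < γ R) ∧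
    Tendsto α atTop (𝓝 0) ∧ Tendsto γ atTop (𝓝 0) ∧
    ∀ R, R₀ ≤ R → ∀ φ η, IsMagneticGradient A φ η → SupportedOutside R φ →
      InFormDomain W φ ∧ max (potForm W φ).re 0 ≤ α R * gradNormSq η + γ R * normSq φ

/-- The asymptotic bounds that define the constants `β`, `ω₁`, `ω₂`: there are positive sequences
`ε_j → 0`, `R_j → ∞` and nonincreasing positive sequences `β_j → β`, `ω_{1,j} → ω₁`,
`ω_{2,j} → ω₂` such that for every `φ` in the domain of `P - A` with support in `{|x| ≥ R_j}` the
three inequalities hold. Here `q` is the form of `x · ∇V^ℓ`. -/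
def AsymptoticBounds (B : Space → Space) (Vs : Space → Mat)
    (q : (Space → Spinor) → (Space → Spinor) → ℂ) (β ω₁ ω₂ : ℝ) : Prop :=
  ∃ ε R b w₁ w₂ : ℕ → ℝ,
    (∀ j, 0 < ε j ∧ 0 < R j ∧ 0 < b j ∧ 0 < w₁ j ∧ 0 < w₂ j) ∧
    Tendsto ε atTop (𝓝 0) ∧ Tendsto R atTop atTop ∧
    Antitone b ∧ Antitone w₁ ∧ Antitone w₂ ∧
    Tendsto b atTop (𝓝 β) ∧ Tendsto w₁ atTop (𝓝 ω₁) ∧ Tendsto w₂ atTop (𝓝 ω₂) ∧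
    ∀ j φ η, IsMagneticGradient (poincareGauge B) φ η → SupportedOutside (R j) φ →
      (MemLp (fun x => ‖tilde 0 B x‖ • φ x) 2 volume ∧
        normSq (fun x => ‖tilde 0 B x‖ • φ x) ≤ ε j * gradNormSq η + b j ^ 2 * normSq φ) ∧
      (MemLp (fun x => ‖x‖ • act (Vs x) (φ x)) 2 volume ∧
        normSq (fun x => ‖x‖ • act (Vs x) (φ x)) ≤ ε j * gradNormSq η + w₁ j ^ 2 * normSq φ) ∧
      (q φ φ).re ≤ ε j * gradNormSq η + w₂ j * normSq φ

/-- The quantitative relative bounds used for unique continuation at infinity, with constants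
`α₁, α₂, α₃`. Here `q` is the form of `x · ∇V^ℓ`. -/
def QuantitativeBounds (B : Space → Space) (Vs : Space → Mat)
    (q : (Space → Spinor) → (Space → Spinor) → ℂ) (α₁ α₂ α₃ : ℝ) : Prop :=
  ∃ C : ℝ, 0 < C ∧ ∀ φ η, IsMagneticGradient (poincareGauge B) φ η →
    (MemLp (fun x => ‖tilde 0 B x‖ • φ x) 2 volume ∧
      MemLp (fun x => ‖x‖ • act (Vs x) (φ x)) 2 volume ∧
      normSq (fun x => ‖tilde 0 B x‖ • φ x) + normSq (fun x => ‖x‖ • act (Vs x) (φ x))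
        ≤ α₁ ^ 2 / 4 * gradNormSq η + C * normSq φ) ∧
    (q φ φ).re ≤ α₂ * gradNormSq η + C * normSq φ ∧
    (InFormDomain Vs φ ∧ ‖potForm Vs φ‖ ≤ α₃ * gradNormSq η + C * normSq φ)

end

end Pauli

namespace Pauli

/-! Everything rests on one analytic fact: a field in `L³_loc` that is bounded outside of a compact
set is bounded relative to `P - A` with relative bound zero (`relative_bound_zero`). It follows from
a magnetic Sobolev inequality `‖φ‖₆ ≤ C ‖(P - A)φ‖₂` for compactly supported `φ`, with a constant
independent of `A` (`eLpNorm_six_le`): the part of the field that is large is small in `L³`, Hölder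
pairs it with `φ` in `L⁶`, and the rest is bounded.

The Sobolev inequality expresses the diamagnetic effect. Weakly `∂ⱼφ = i(ηⱼ + Aⱼφ)`, and `iAⱼφ` is
orthogonal to `φ` for the real inner product, so the derivative of any function of `|φ|` sees only
`ηⱼ`. As `Aφ` is merely locally integrable, the argument uses a bounded truncation `T` of `|φ|`: the
embedding `W^{1,1} ⊂ L^{3/2}` applied to `T⁴` gives `‖T‖₆⁴ ≤ C ‖T‖₆³ ‖η‖₂`, a finite power of `‖T‖₆`
cancels, and the truncation is removed by Fatou's lemma.

For the gauge, `p > 3` makes `|x|^{-1-δ} |B ∧ x|²` locally integrable for some `δ > 0`. This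
dominates the logarithmic weight, and a weighted Cauchy-Schwarz inequality along rays turns it into
`A ∈ L²_loc` (`lpLoc_two_poincareGauge`).

The form of `x · ∇V^ℓ` is built with a cut-off `χ`. Away from the origin it is the bounded function
`(1 - χ) G`. Near the origin the derivative is moved onto `φ̄ψ`, where ordinary derivatives may be
replaced by magnetic ones because the real potential cancels; what remains pairs `V^ℓφ`, which is in
`L²`, with `(P - A)φ` (`isEulerForm_eulerForm`, `eulerForm_relative_bound`).

The bounds at infinity need no gradient: on the support of `φ` the potentials obey pointwise bounds,
which become estimates of quadratic forms through the eigenvalues of Hermitian matrices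
(`re_inner_act_le`). -/

/-! ### Hermitian matrices acting on spinors -/

lemma act_eq_toEuclideanLin (M : Mat) (v : Spinor) : act M v = Matrix.toEuclideanLin M v := rfl

lemma act_add (M : Mat) (v w : Spinor) : act M (v + w) = act M v + act M w := by
  simp only [act_eq_toEuclideanLin, map_add]

lemma act_smul (M : Mat) (c : ℂ) (v : Spinor) : act M (c • v) = c • act M v := by
  simp only [act_eq_toEuclideanLin, map_smul]

lemma add_act (M N : Mat) (v : Spinor) : act (M + N) v = act M v + act N v := by
  simp only [act_eq_toEuclideanLin, map_add, LinearMap.add_apply]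

lemma norm_act_le (M : Mat) (v : Spinor) : ‖act M v‖ ≤ ‖M‖ * ‖v‖ :=
  Matrix.l2_opNorm_mulVec M v

lemma norm_inner_act_le (M : Mat) (v w : Spinor) : ‖inner ℂ v (act M w)‖ ≤ ‖M‖ * (‖v‖ * ‖w‖) :=
  calc _ ≤ ‖v‖ * ‖act M w‖ := norm_inner_le_norm _ _
    _ ≤ ‖v‖ * (‖M‖ * ‖w‖) := by gcongr; exact norm_act_le M w
    _ = _ := by ring

lemma inner_act_eq_sum (M : Mat) (v w : Spinor) :
    inner ℂ v (act M w) = ∑ k : Fin 2, ∑ l : Fin 2, M k l * (conj (v k) * w l) := by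
  simp [act, PiLp.inner_apply, Fin.sum_univ_two]
  ring

lemma act_eigenvectorBasis {M : Mat} (hM : M.IsHermitian) (i : Fin 2) :
    act M (hM.eigenvectorBasis i) = (hM.eigenvalues i : ℂ) • hM.eigenvectorBasis i := by
  have h := hM.mulVec_eigenvectorBasis i
  ext k
  have := congrFun h k
  simpa [act] using this

lemma eigenvalues_le_posPartNorm {M : Mat} (hM : M.IsHermitian) (i : Fin 2) :
    hM.eigenvalues i ≤ posPartNorm M := by
  rw [posPartNorm, dif_pos hM]
  fin_cases i
  · exact (le_max_left _ _).trans (le_max_left _ _)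
  · exact (le_max_left _ _).trans (le_max_right _ _)

lemma posPartNorm_le_norm (M : Mat) : posPartNorm M ≤ ‖M‖ := by
  rw [posPartNorm]
  split_ifs with hM
  · have h : ∀ i, hM.eigenvalues i ≤ ‖M‖ := fun i => by
      have h1 := norm_act_le M (hM.eigenvectorBasis i)
      rw [act_eigenvectorBasis, norm_smul, hM.eigenvectorBasis.orthonormal.1 i, mul_one,
        mul_one, Complex.norm_real] at h1
      exact (le_abs_self _).trans h1
    exact max_le (max_le (h 0) (norm_nonneg _)) (max_le (h 1) (norm_nonneg _))
  · exact norm_nonneg _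

/-- The quadratic form of a Hermitian matrix is bounded by its positive part. -/
lemma re_inner_act_le {M : Mat} (hM : M.IsHermitian) (v : Spinor) :
    (inner ℂ v (act M v)).re ≤ posPartNorm M * ‖v‖ ^ 2 := by
  have hsymm : ∀ x y : Spinor, inner ℂ (act M x) y = inner ℂ x (act M y) :=
    Matrix.isSymmetric_toEuclideanLin_iff.2 hM
  set b := hM.eigenvectorBasis
  have h1 : ∀ i, inner ℂ v (b i) * inner ℂ (b i) (act M v)
      = ((hM.eigenvalues i * ‖inner ℂ (b i) v‖ ^ 2 : ℝ) : ℂ) := fun i => by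
    rw [← hsymm, act_eigenvectorBasis, inner_smul_left, Complex.conj_ofReal,
      ← inner_conj_symm v (b i)]
    push_cast
    rw [← Complex.conj_mul']
    ring
  rw [← b.sum_inner_mul_inner v (act M v), Finset.sum_congr rfl fun i _ => h1 i,
    ← Complex.ofReal_sum, Complex.ofReal_re, ← b.sum_sq_norm_inner_right v, Finset.mul_sum]
  gcongr with i
  exact eigenvalues_le_posPartNorm hM i

/-! ### Weak partial derivatives -/

/-- `g` is the weak partial derivative `∂ⱼφ`. -/
def HasWeakPartial (j : Fin 3) (φ g : Space → Spinor) : Prop :=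
  ∀ f : Space → ℝ, ContDiff ℝ ∞ f → HasCompactSupport f →
    ∫ x, (fderiv ℝ f x (EuclideanSpace.single j 1)) • φ x = -∫ x, f x • g x

lemma continuous_partial {E : Type*} [NormedAddCommGroup E] [NormedSpace ℝ E]
    {f : Space → E} (hf : ContDiff ℝ ∞ f) (v : Space) : Continuous fun x => fderiv ℝ f x v :=
  (hf.continuous_fderiv (by simp)).clm_apply continuous_const

lemma hasCompactSupport_partial {E : Type*} [NormedAddCommGroup E] [NormedSpace ℝ E]
    {f : Space → E} (hf : HasCompactSupport f) (v : Space) :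
    HasCompactSupport fun x => fderiv ℝ f x v :=
  (hf.fderiv ℝ).comp_left (g := fun L : Space →L[ℝ] E => L v) rfl

lemma integrable_test_smul {E : Type*} [NormedAddCommGroup E] [NormedSpace ℝ E] {f : Space → ℝ}
    {g : Space → E} (hf : Continuous f) (hc : HasCompactSupport f) (hg : LocallyIntegrable g) :
    Integrable fun x => f x • g x :=
  hg.integrable_smul_left_of_hasCompactSupport hf hc

lemma HasWeakPartial.ae_eq {j : Fin 3} {φ φ' g g' : Space → Spinor} (h : HasWeakPartial j φ g)
    (h' : HasWeakPartial j φ' g') (hφ : φ =ᵐ[volume] φ') (hg : LocallyIntegrable g)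
    (hg' : LocallyIntegrable g') : g =ᵐ[volume] g' :=
  ae_eq_of_integral_contDiff_smul_eq hg hg' fun f hf hc => by
    rw [← neg_inj, ← h f hf hc, ← h' f hf hc]
    refine integral_congr_ae ?_
    filter_upwards [hφ] with x hx
    rw [hx]

lemma HasWeakPartial.add {j : Fin 3} {φ φ' g g' : Space → Spinor} (h : HasWeakPartial j φ g)
    (h' : HasWeakPartial j φ' g') (hφ : LocallyIntegrable φ) (hφ' : LocallyIntegrable φ')
    (hg : LocallyIntegrable g) (hg' : LocallyIntegrable g') :
    HasWeakPartial j (φ + φ') (g + g') := fun f hf hc => by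
  have hd := continuous_partial hf (EuclideanSpace.single j 1)
  have hdc := hasCompactSupport_partial hc (EuclideanSpace.single j 1)
  simp only [Pi.add_apply, smul_add]
  rw [integral_add (integrable_test_smul hd hdc hφ) (integrable_test_smul hd hdc hφ'),
    integral_add (integrable_test_smul hf.continuous hc hg)
      (integrable_test_smul hf.continuous hc hg'), h f hf hc, h' f hf hc, neg_add]

lemma HasWeakPartial.smul {j : Fin 3} {φ g : Space → Spinor} (h : HasWeakPartial j φ g) (c : ℂ) :
    HasWeakPartial j (c • φ) (c • g) := fun f hf hc => by
  simp only [Pi.smul_apply, smul_comm _ c, integral_smul]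
  rw [h f hf hc, smul_neg]

lemma fderiv_mul_apply {f g : Space → ℝ} (hf : ContDiff ℝ ∞ f) (hg : ContDiff ℝ ∞ g)
    (x v : Space) :
    fderiv ℝ (fun y => f y * g y) x v = f x * fderiv ℝ g x v + g x * fderiv ℝ f x v := by
  rw [fderiv_fun_mul (hf.differentiable (by simp) x) (hg.differentiable (by simp) x)]
  simp

/-- The Leibniz rule for the product with a smooth function. -/
lemma HasWeakPartial.mul_smooth {j : Fin 3} {φ g : Space → Spinor} (h : HasWeakPartial j φ g)
    (hφ : LocallyIntegrable φ) (hg : LocallyIntegrable g) {χ : Space → ℝ} (hχ : ContDiff ℝ ∞ χ) :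
    HasWeakPartial j (fun x => χ x • φ x)
      (fun x => χ x • g x + fderiv ℝ χ x (EuclideanSpace.single j 1) • φ x) := fun f hf hc => by
  have h1 := h (fun x => χ x * f x) (hχ.mul hf) hc.mul_left
  have i1 : Integrable fun x => (f x * fderiv ℝ χ x (EuclideanSpace.single j 1)) • φ x :=
    integrable_test_smul (hf.continuous.mul (continuous_partial hχ _)) hc.mul_right hφ
  have i2 : Integrable fun x => (χ x * fderiv ℝ f x (EuclideanSpace.single j 1)) • φ x :=
    integrable_test_smul (hχ.continuous.mul (continuous_partial hf _))
      (hasCompactSupport_partial hc _).mul_left hφ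
  have i3 : Integrable fun x => (χ x * f x) • g x :=
    integrable_test_smul (hχ.continuous.mul hf.continuous) hc.mul_left hg
  simp only [fderiv_mul_apply hχ hf, add_smul] at h1
  rw [integral_add i2 i1] at h1
  simp only [smul_add, smul_smul]
  simp only [mul_comm (fderiv ℝ f _ _), mul_comm (f _) (χ _)]
  rw [integral_add i3 i1, eq_sub_of_add_eq h1]
  abel

lemma hasWeakPartial_of_contDiff {φ : Space → Spinor} (hφ : ContDiff ℝ ∞ φ) (j : Fin 3) :
    HasWeakPartial j φ (fun x => fderiv ℝ φ x (EuclideanSpace.single j 1)) := fun f hf hc => by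
  have hd := continuous_partial hf (EuclideanSpace.single j 1)
  have hdc := hasCompactSupport_partial hc (EuclideanSpace.single j 1)
  have hp := continuous_partial hφ (EuclideanSpace.single j 1)
  rw [integral_smul_fderiv_eq_neg_fderiv_smul_of_integrable, neg_neg]
  · exact integrable_test_smul hd hdc hφ.continuous.locallyIntegrable
  · exact integrable_test_smul hf.continuous hc hp.locallyIntegrable
  · exact integrable_test_smul hf.continuous hc hφ.continuous.locallyIntegrable
  · exact fun x _ => hf.differentiable (by simp) x
  · exact fun x _ => hφ.differentiable (by simp) x

/-! ### Magnetic gradients -/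

lemma LpLoc.apply {A : Space → Space} {p : ℝ≥0∞} (hA : LpLoc p A) (j : Fin 3) :
    LpLoc p fun x => A x j := fun K hK => by
  refine (hA K hK).of_le ?_ (ae_of_all _ fun x => PiLp.norm_apply_le (A x) j)
  exact (EuclideanSpace.proj (𝕜 := ℝ) j).continuous.comp_aestronglyMeasurable
    (hA K hK).aestronglyMeasurable

lemma LpLoc.locallyIntegrable {F : Type*} [NormedAddCommGroup F] {p : ℝ≥0∞} (hp : 1 ≤ p)
    {f : Space → F} (hf : LpLoc p f) : LocallyIntegrable f := by
  refine (locallyIntegrable_iff).2 fun K hK => ?_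
  have : IsFiniteMeasure (volume.restrict K) := isFiniteMeasure_restrict.2 hK.measure_lt_top.ne
  exact (hf K hK).integrable hp

lemma LpLoc.mono {F : Type*} [NormedAddCommGroup F] {p q : ℝ≥0∞} (hpq : p ≤ q)
    {f : Space → F} (hf : LpLoc q f) : LpLoc p f := fun K hK => by
  have : IsFiniteMeasure (volume.restrict K) := isFiniteMeasure_restrict.2 hK.measure_lt_top.ne
  exact (hf K hK).mono_exponent hpq

lemma _root_.MeasureTheory.MemLp.lpLoc {F : Type*} [NormedAddCommGroup F] {p : ℝ≥0∞}
    {f : Space → F} (hf : MemLp f p volume) : LpLoc p f := fun K _ => hf.restrict K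

lemma locallyIntegrable_smul_of_lpLoc {a : Space → ℝ} (ha : LpLoc 2 a) {φ : Space → Spinor}
    (hφ : MemLp φ 2 volume) : LocallyIntegrable fun x => a x • φ x := by
  refine (locallyIntegrable_iff).2 fun K hK => ?_
  exact memLp_one_iff_integrable.1 ((hφ.restrict K).smul (ha K hK))

lemma memLp_two_locallyIntegrable {φ : Space → Spinor} (hφ : MemLp φ 2 volume) :
    LocallyIntegrable φ := hφ.lpLoc.locallyIntegrable (by norm_num)

/-- The function shown is the candidate for `∂ⱼφ`. The product `Aⱼφ` of two `L²_loc` functions is no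
better than `L¹_loc`, so `φ` need not have square integrable ordinary derivatives. -/
lemma locallyIntegrable_weakPartial {A : Space → Space} (hA : LpLoc 2 A) {φ η : Space → Spinor}
    (hφ : MemLp φ 2 volume) (hη : MemLp η 2 volume) (j : Fin 3) :
    LocallyIntegrable fun x => Complex.I • (η x + A x j • φ x) :=
  ((memLp_two_locallyIntegrable hη).add
    (locallyIntegrable_smul_of_lpLoc (hA.apply j) hφ)).smul Complex.I

/-- This solves `-i∂ⱼφ - Aⱼφ = ηⱼ` for `∂ⱼφ`. Local integrability of `Aφ` is what permits splitting
the integrals, and thus the use of ordinary weak derivatives from here on. -/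
lemma isMagneticGradient_iff {A : Space → Space} (hA : LpLoc 2 A) {φ : Space → Spinor}
    {η : Fin 3 → Space → Spinor} :
    IsMagneticGradient A φ η ↔ MemLp φ 2 volume ∧ (∀ j, MemLp (η j) 2 volume) ∧
      ∀ j, HasWeakPartial j φ (fun x => Complex.I • (η j x + A x j • φ x)) := by
  have key : MemLp φ 2 volume → (∀ j, MemLp (η j) 2 volume) → ∀ (j : Fin 3) (f : Space → ℝ),
      ContDiff ℝ ∞ f → HasCompactSupport f →
      ((∫ x, ((Complex.I * ((fderiv ℝ f x (EuclideanSpace.single j 1) : ℝ) : ℂ)) • φ x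
        - (A x j * f x) • φ x) = ∫ x, f x • η j x) ↔
      ∫ x, (fderiv ℝ f x (EuclideanSpace.single j 1)) • φ x
        = -∫ x, f x • (Complex.I • (η j x + A x j • φ x))) := by
    intro hφ hη j f hf hc
    have hd := continuous_partial hf (EuclideanSpace.single j 1)
    have hdc := hasCompactSupport_partial hc (EuclideanSpace.single j 1)
    have i1 := integrable_test_smul hd hdc (memLp_two_locallyIntegrable hφ)
    have i2 := integrable_test_smul hf.continuous hc
      (locallyIntegrable_smul_of_lpLoc (hA.apply j) hφ)
    have i3 := integrable_test_smul hf.continuous hc (memLp_two_locallyIntegrable (hη j))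
    have e1 : ∀ x, (Complex.I * ((fderiv ℝ f x (EuclideanSpace.single j 1) : ℝ) : ℂ)) • φ x
        = Complex.I • (fderiv ℝ f x (EuclideanSpace.single j 1) • φ x) := fun x => by
      rw [mul_smul, Complex.coe_smul]
    have e2 : ∀ x, (A x j * f x) • φ x = f x • (A x j • φ x) := fun x => by
      rw [mul_comm, mul_smul]
    have e3 : ∀ x, f x • (Complex.I • (η j x + A x j • φ x))
        = Complex.I • (f x • η j x + f x • (A x j • φ x)) := fun x => by
      rw [smul_comm, smul_add]
    simp only [e1, e2, e3, integral_smul]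
    have i1' : Integrable fun x =>
        Complex.I • (fderiv ℝ f x (EuclideanSpace.single j 1) • φ x) := i1.smul Complex.I
    rw [integral_sub i1' i2, integral_add i3 i2, integral_smul,
      sub_eq_iff_eq_add]
    generalize (∫ x, fderiv ℝ f x (EuclideanSpace.single j 1) • φ x) = a
    generalize (∫ x, f x • η j x) = b
    generalize (∫ x, f x • (A x j • φ x)) = c
    constructor
    · intro h
      rw [← h, smul_smul, Complex.I_mul_I]
      simp
    · intro h
      rw [h, smul_neg, smul_smul, Complex.I_mul_I]
      simp [add_comm]
  constructor
  · rintro ⟨h1, h2, h3⟩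
    exact ⟨h1, h2, fun j f hf hc => (key h1 h2 j f hf hc).1 (h3 j f hf hc)⟩
  · rintro ⟨h1, h2, h3⟩
    exact ⟨h1, h2, fun j f hf hc => (key h1 h2 j f hf hc).2 (h3 j f hf hc)⟩

lemma IsMagneticGradient.ae_eq {A : Space → Space} (hA : LpLoc 2 A) {φ : Space → Spinor}
    {η η' : Fin 3 → Space → Spinor} (h : IsMagneticGradient A φ η)
    (h' : IsMagneticGradient A φ η') (j : Fin 3) : η j =ᵐ[volume] η' j := by
  obtain ⟨h1, h2, h3⟩ := (isMagneticGradient_iff hA).1 h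
  obtain ⟨-, h2', h3'⟩ := (isMagneticGradient_iff hA).1 h'
  filter_upwards [(h3 j).ae_eq (h3' j) EventuallyEq.rfl
    (locallyIntegrable_weakPartial hA h1 (h2 j) j)
    (locallyIntegrable_weakPartial hA h1 (h2' j) j)] with x hx
  exact add_right_cancel (smul_right_injective _ Complex.I_ne_zero hx)

lemma IsMagneticGradient.add {A : Space → Space} (hA : LpLoc 2 A) {φ φ' : Space → Spinor}
    {η η' : Fin 3 → Space → Spinor} (h : IsMagneticGradient A φ η)
    (h' : IsMagneticGradient A φ' η') : IsMagneticGradient A (φ + φ') (fun j => η j + η' j) := by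
  obtain ⟨h1, h2, h3⟩ := (isMagneticGradient_iff hA).1 h
  obtain ⟨h1', h2', h3'⟩ := (isMagneticGradient_iff hA).1 h'
  refine (isMagneticGradient_iff hA).2 ⟨h1.add h1', fun j => (h2 j).add (h2' j), fun j => ?_⟩
  convert (h3 j).add (h3' j) (memLp_two_locallyIntegrable h1) (memLp_two_locallyIntegrable h1')
    (locallyIntegrable_weakPartial hA h1 (h2 j) j)
    (locallyIntegrable_weakPartial hA h1' (h2' j) j) using 2 with x
  simp only [Pi.add_apply, smul_add]
  abel

lemma IsMagneticGradient.smul {A : Space → Space} (hA : LpLoc 2 A) {φ : Space → Spinor}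
    {η : Fin 3 → Space → Spinor} (h : IsMagneticGradient A φ η) (c : ℂ) :
    IsMagneticGradient A (c • φ) (fun j => c • η j) := by
  obtain ⟨h1, h2, h3⟩ := (isMagneticGradient_iff hA).1 h
  refine (isMagneticGradient_iff hA).2
    ⟨h1.const_smul c, fun j => (h2 j).const_smul c, fun j => ?_⟩
  convert (h3 j).smul c using 2 with x
  simp only [Pi.smul_apply, smul_add, smul_comm c]

lemma memLp_two_smul_bounded {χ : Space → ℝ} (hχ : Continuous χ) {C : ℝ} (hC : ∀ x, |χ x| ≤ C)
    {φ : Space → Spinor} (hφ : MemLp φ 2 volume) : MemLp (fun x => χ x • φ x) 2 volume := by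
  refine hφ.of_le_mul (c := C) (hχ.aestronglyMeasurable.smul hφ.1) (ae_of_all _ fun x => ?_)
  rw [norm_smul]
  exact mul_le_mul_of_nonneg_right (hC x) (norm_nonneg _)

/-- Multiplication by a smooth function of compact support preserves the domain of `P - A`. -/
lemma IsMagneticGradient.mul_smooth {A : Space → Space} (hA : LpLoc 2 A) {φ : Space → Spinor}
    {η : Fin 3 → Space → Spinor} (h : IsMagneticGradient A φ η) {χ : Space → ℝ}
    (hχ : ContDiff ℝ ∞ χ) (hc : HasCompactSupport χ) :
    IsMagneticGradient A (fun x => χ x • φ x) (fun j x =>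
      χ x • η j x - Complex.I • (fderiv ℝ χ x (EuclideanSpace.single j 1) • φ x)) := by
  obtain ⟨h1, h2, h3⟩ := (isMagneticGradient_iff hA).1 h
  obtain ⟨C, hC⟩ := hc.exists_bound_of_continuous hχ.continuous
  refine (isMagneticGradient_iff hA).2 ⟨memLp_two_smul_bounded hχ.continuous hC h1,
    fun j => (memLp_two_smul_bounded hχ.continuous hC (h2 j)).sub ?_, fun j => ?_⟩
  · obtain ⟨C', hC'⟩ := (hasCompactSupport_partial hc
      (EuclideanSpace.single j 1)).exists_bound_of_continuous (continuous_partial hχ _)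
    exact (memLp_two_smul_bounded (continuous_partial hχ _) hC' h1).const_smul Complex.I
  · convert (h3 j).mul_smooth (memLp_two_locallyIntegrable h1)
      (locallyIntegrable_weakPartial hA h1 (h2 j) j) hχ using 2 with x
    rw [smul_add, smul_sub, smul_smul, Complex.I_mul_I, smul_comm (χ x), smul_add, smul_add,
      smul_comm (χ x) (A x j)]
    simp only [neg_smul, one_smul, sub_neg_eq_add]
    abel

/-- The magnetic gradient of a test spinor. -/
lemma isMagneticGradient_of_contDiff {A : Space → Space} (hA : LpLoc 2 A) {φ : Space → Spinor}
    (hφ : ContDiff ℝ ∞ φ) (hc : HasCompactSupport φ) :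
    IsMagneticGradient A φ (fun j x =>
      -(Complex.I • fderiv ℝ φ x (EuclideanSpace.single j 1)) - A x j • φ x) := by
  have hAφ : ∀ j, MemLp (fun x => A x j • φ x) 2 volume := fun j => by
    obtain ⟨C, hC⟩ := hc.exists_bound_of_continuous hφ.continuous
    have h1 := hA.apply j _ hc.isCompact
    have h2 : MemLp (fun x => A x j • φ x) 2 (volume.restrict (tsupport φ)) := by
      refine h1.of_le_mul (c := C) (h1.1.smul hφ.continuous.aestronglyMeasurable)
        (ae_of_all _ fun x => ?_)
      rw [norm_smul, mul_comm]
      exact mul_le_mul_of_nonneg_right (hC x) (norm_nonneg _)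
    rw [← memLp_indicator_iff_restrict (isClosed_tsupport φ).measurableSet] at h2
    have hs : Function.support (fun x => A x j • φ x) ⊆ tsupport φ := fun x hx =>
      subset_tsupport φ fun h : φ x = 0 => hx (by simp [h])
    rwa [Set.indicator_eq_self.2 hs] at h2
  refine (isMagneticGradient_iff hA).2 ⟨hφ.continuous.memLp_of_hasCompactSupport hc,
    fun j => ((((continuous_partial hφ _).memLp_of_hasCompactSupport
      (hasCompactSupport_partial hc _)).const_smul Complex.I).neg).sub (hAφ j), fun j => ?_⟩
  convert hasWeakPartial_of_contDiff hφ j using 2 with x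
  rw [sub_add_cancel, smul_neg, smul_smul, Complex.I_mul_I, neg_smul, one_smul, neg_neg]

open scoped Convolution

/-! ### Mollification -/

/-- A sequence of bump functions that shrink to the origin. -/
noncomputable def mollifier (n : ℕ) : ContDiffBump (0 : Space) where
  rIn := 1 / (n + 1)
  rOut := 2 / (n + 1)
  rIn_pos := by positivity
  rIn_lt_rOut := by gcongr; norm_num

/-- The mollification of a function on three-space. -/
noncomputable def mollify {E : Type*} [NormedAddCommGroup E] [NormedSpace ℝ E] (n : ℕ)
    (f : Space → E) : Space → E :=
  (mollifier n).normed volume ⋆[ContinuousLinearMap.lsmul ℝ ℝ, volume] f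

variable {E : Type*} [NormedAddCommGroup E] [NormedSpace ℝ E]

lemma mollifier_rOut_tendsto : Tendsto (fun n => (mollifier n).rOut) atTop (𝓝 0) := by
  have := (tendsto_one_div_add_atTop_nhds_zero_nat (𝕜 := ℝ)).const_mul 2
  simpa [mollifier, div_eq_mul_inv] using this

lemma ae_tendsto_mollify [CompleteSpace E] {f : Space → E} (hf : LocallyIntegrable f) :
    ∀ᵐ x, Tendsto (fun n => mollify n f x) atTop (𝓝 (f x)) :=
  -- The outer radius is always twice the inner one; such a fixed ratio is what Lebesgue
  -- differentiation requires for convergence almost everywhere.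
  ContDiffBump.ae_convolution_tendsto_right_of_locallyIntegrable (K := 2) mollifier_rOut_tendsto
    (Eventually.of_forall fun n => le_of_eq <| by simp only [mollifier]; ring) hf

lemma contDiff_mollify [CompleteSpace E] {f : Space → E} (hf : LocallyIntegrable f) (n : ℕ) :
    ContDiff ℝ ∞ (mollify n f) :=
  (mollifier n).hasCompactSupport_normed.contDiff_convolution_left _
    (mollifier n).contDiff_normed hf

lemma hasCompactSupport_mollify {f : Space → E} (hf : HasCompactSupport f) (n : ℕ) :
    HasCompactSupport (mollify n f) :=
  (mollifier n).hasCompactSupport_normed.convolution _ hf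

lemma integrable_mollify {f : Space → E} (hf : Integrable f) (n : ℕ) :
    Integrable (mollify n f) :=
  Integrable.integrable_convolution _ (mollifier n).integrable_normed hf

lemma norm_mollify_le (f : Space → E) (n : ℕ) (x : Space) :
    ‖mollify n f x‖ ≤ mollify n (fun y => ‖f y‖) x := by
  simp only [mollify, convolution_def, ContinuousLinearMap.lsmul_apply]
  refine (norm_integral_le_integral_norm _).trans (le_of_eq ?_)
  refine integral_congr_ae (ae_of_all _ fun y => ?_)
  simp [norm_smul, abs_of_nonneg ((mollifier n).nonneg_normed y)]

lemma integral_mollify {f : Space → ℝ} (hf : Integrable f) (n : ℕ) :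
    ∫ x, mollify n f x = ∫ x, f x := by
  simp only [mollify]
  rw [integral_convolution _ (mollifier n).integrable_normed hf, (mollifier n).integral_normed]
  simp

/-- Mollifications of an integrable function converge in `L¹`. -/
lemma tendsto_lintegral_mollify_sub [CompleteSpace E] {f : Space → E} (hf : Integrable f) :
    Tendsto (fun n => ∫⁻ x, ‖mollify n f x - f x‖ₑ) atTop (𝓝 0) := by
  -- A Scheffé type argument: `H n` majorizes `|mollify n f|`, has the same integral as `h = |f|`,
  -- and converges to `h` almost everywhere. Subtraction in `ℝ≥0∞` takes positive parts.
  set h : Space → ℝ≥0∞ := fun x => ENNReal.ofReal ‖f x‖ with hh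
  set H : ℕ → Space → ℝ≥0∞ := fun n x => ENNReal.ofReal (mollify n (fun y => ‖f y‖) x) with hH
  have hfm : AEMeasurable h := hf.1.norm.aemeasurable.ennreal_ofReal
  have hHm : ∀ n, AEMeasurable (H n) := fun n =>
    (integrable_mollify hf.norm n).1.aemeasurable.ennreal_ofReal
  have hHnn : ∀ n x, 0 ≤ mollify n (fun y => ‖f y‖) x := fun n x =>
    (norm_nonneg _).trans (norm_mollify_le f n x)
  have hint : ∫⁻ x, h x ≠ ⊤ := by
    simp only [hh, ofReal_norm]
    exact hf.2.ne
  have hHint : ∀ n, ∫⁻ x, H n x = ∫⁻ x, h x := fun n => by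
    rw [← ofReal_integral_eq_lintegral_ofReal (integrable_mollify hf.norm n)
      (ae_of_all _ (hHnn n)), integral_mollify hf.norm,
      ofReal_integral_eq_lintegral_ofReal hf.norm (ae_of_all _ fun x => norm_nonneg _)]
  have hHt : ∀ᵐ x, Tendsto (fun n => H n x) atTop (𝓝 (h x)) := by
    filter_upwards [ae_tendsto_mollify hf.norm.locallyIntegrable] with x hx
    exact (ENNReal.continuous_ofReal.tendsto _).comp hx
  have t1 : Tendsto (fun n => ∫⁻ x, (h x - H n x)) atTop (𝓝 0) := by
    have := tendsto_lintegral_of_dominated_convergence' (μ := volume)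
      (F := fun n x => h x - H n x) (f := fun _ => 0) h
      (fun n => hfm.sub (hHm n)) (fun n => ae_of_all _ fun x => tsub_le_self) hint (by
        filter_upwards [hHt] with x hx
        have := ENNReal.Tendsto.sub (tendsto_const_nhds (x := h x)) hx (Or.inl (by simp [hh]))
        simpa using this)
    simpa using this
  -- The integrals of `H n` and `h` agree, so the two positive parts of their difference have equal
  -- integrals; the one below `h` is handled by dominated convergence.
  have t2 : ∀ n, ∫⁻ x, (H n x - h x) ≤ ∫⁻ x, (h x - H n x) := fun n => by
    have e : (∫⁻ x, (H n x - h x)) + ∫⁻ x, h x = (∫⁻ x, (h x - H n x)) + ∫⁻ x, h x := by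
      conv_rhs => rw [← hHint n]
      rw [← lintegral_add_right' _ hfm, ← lintegral_add_right' _ (hHm n)]
      refine lintegral_congr fun x => ?_
      rw [tsub_add_eq_max, tsub_add_eq_max, max_comm]
    exact (ENNReal.add_left_inj hint).1 e |>.le
  have t3 : Tendsto (fun n => ∫⁻ x, (H n x - h x)) atTop (𝓝 0) :=
    tendsto_of_tendsto_of_tendsto_of_le_of_le tendsto_const_nhds t1 (fun _ => zero_le) t2
  have hsub : ∀ n x, ‖mollify n f x - f x‖ₑ ≤ 2 * h x + (H n x - h x) := fun n x =>
    calc ‖mollify n f x - f x‖ₑ ≤ ‖mollify n f x‖ₑ + ‖f x‖ₑ := enorm_sub_le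
      _ ≤ H n x + h x := by
          rw [← ofReal_norm, ← ofReal_norm]
          gcongr
          exact ENNReal.ofReal_le_ofReal (norm_mollify_le f n x)
      _ ≤ ((H n x - h x) + h x) + h x := by gcongr; exact le_tsub_add
      _ = _ := by ring
  have hdm : ∀ n, AEMeasurable fun x => ‖mollify n f x - f x‖ₑ := fun n =>
    ((integrable_mollify hf n).sub hf).1.enorm
  -- After removal of the excess `H n - h`, which is small in `L¹`, the error is dominated by the
  -- integrable function `2h`.
  have t4 : Tendsto (fun n => ∫⁻ x, (‖mollify n f x - f x‖ₑ - (H n x - h x))) atTop (𝓝 0) := by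
    have := tendsto_lintegral_of_dominated_convergence' (μ := volume)
      (F := fun n x => ‖mollify n f x - f x‖ₑ - (H n x - h x)) (f := fun _ => 0)
      (fun x => 2 * h x)
      (fun n => (hdm n).sub ((hHm n).sub hfm))
      (fun n => ae_of_all _ fun x => tsub_le_iff_right.2 (hsub n x))
      (by rw [lintegral_const_mul'' _ hfm]; exact ENNReal.mul_ne_top (by simp) hint) (by
        filter_upwards [ae_tendsto_mollify hf.locallyIntegrable] with x hx
        have h1 : Tendsto (fun n => ‖mollify n f x - f x‖ₑ) atTop (𝓝 0) := by
          have := (hx.sub_const (f x)).enorm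
          simpa using this
        exact tendsto_of_tendsto_of_tendsto_of_le_of_le tendsto_const_nhds h1
          (fun _ => zero_le) (fun _ => tsub_le_self))
    simpa using this
  have t5 := t4.add t3
  rw [add_zero] at t5
  refine tendsto_of_tendsto_of_tendsto_of_le_of_le tendsto_const_nhds t5 (fun _ => zero_le)
    fun n => ?_
  have hm : AEMeasurable fun x => H n x - h x := (hHm n).sub hfm
  rw [← lintegral_add_right' _ hm]
  exact lintegral_mono fun x => le_tsub_add

/-- Mollification commutes with weak derivatives. -/
lemma fderiv_mollify {j : Fin 3} {φ g : Space → Spinor} (h : HasWeakPartial j φ g)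
    (hφ : LocallyIntegrable φ) (n : ℕ) (x : Space) :
    fderiv ℝ (mollify n φ) x (EuclideanSpace.single j 1) = mollify n g x := by
  set ρ := (mollifier n).normed (volume : Measure Space) with hρ
  have hρs : ContDiff ℝ ∞ ρ := (mollifier n).contDiff_normed
  have hρc : HasCompactSupport ρ := (mollifier n).hasCompactSupport_normed
  have hd := hρc.hasFDerivAt_convolution_left (ContinuousLinearMap.lsmul ℝ ℝ)
    (hρs.of_le (by simp)) hφ x
  have hex := ((hρc.fderiv ℝ).convolutionExists_left
    ((ContinuousLinearMap.lsmul ℝ ℝ).precompL Space)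
    (hρs.continuous_fderiv (by simp)) hφ x).integrable_swap
  have hsub : ContDiff ℝ ∞ fun t : Space => x - t := contDiff_const.sub contDiff_id
  have hfs : ContDiff ℝ ∞ fun t => ρ (x - t) := hρs.comp hsub
  have hfc : HasCompactSupport fun t => ρ (x - t) :=
    hρc.comp_homeomorph (Homeomorph.subLeft x)
  -- The weak derivative is tested with the reflected translate of the kernel; the sign from the
  -- reflection cancels the one from integration by parts.
  have hw := h _ hfs hfc
  have hder : ∀ t, fderiv ℝ (fun t => ρ (x - t)) t (EuclideanSpace.single j 1)
      = -fderiv ℝ ρ (x - t) (EuclideanSpace.single j 1) := fun t => by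
    have h1 : HasFDerivAt (fun t : Space => x - t) (-ContinuousLinearMap.id ℝ Space) t :=
      (hasFDerivAt_id t).const_sub x
    have h2 := ((hρs.differentiable (by simp)) (x - t)).hasFDerivAt.comp t h1
    have h3 : fderiv ℝ (fun t => ρ (x - t)) t = _ := h2.fderiv
    rw [h3]
    simp
  simp only [hder, neg_smul, integral_neg, neg_inj] at hw
  rw [mollify, hd.fderiv, convolution_eq_swap, ContinuousLinearMap.integral_apply hex, mollify,
    convolution_eq_swap]
  simpa using hw

/-! ### The magnetic Sobolev inequality -/

/-- A bounded approximation of the norm. -/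
noncomputable def truncNorm (ε : ℝ) (z : Spinor) : ℝ := ‖z‖ / √(1 + ε * ‖z‖ ^ 2)

/-- Half of the gradient of the fourth power of `truncNorm`. -/
noncomputable def truncGrad (ε : ℝ) (z : Spinor) : Spinor :=
  (4 * ‖z‖ ^ 2 / (1 + ε * ‖z‖ ^ 2) ^ 3) • z

lemma truncNorm_nonneg (ε : ℝ) (z : Spinor) : 0 ≤ truncNorm ε z := by
  unfold truncNorm; positivity

lemma truncNorm_sq {ε : ℝ} (hε : 0 < ε) (z : Spinor) :
    truncNorm ε z ^ 2 = ‖z‖ ^ 2 / (1 + ε * ‖z‖ ^ 2) := by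
  rw [truncNorm, div_pow, Real.sq_sqrt (by positivity)]

lemma truncNorm_sq_le {ε : ℝ} (hε : 0 < ε) (z : Spinor) : truncNorm ε z ^ 2 ≤ 1 / ε := by
  rw [truncNorm_sq hε, div_le_div_iff₀ (by positivity) hε]
  nlinarith

lemma continuous_truncNorm {ε : ℝ} (hε : 0 < ε) : Continuous (truncNorm ε) := by
  unfold truncNorm
  exact continuous_norm.div (by fun_prop) fun z => (Real.sqrt_pos.2 (by positivity)).ne'

lemma continuous_truncGrad {ε : ℝ} (hε : 0 < ε) : Continuous (truncGrad ε) := by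
  unfold truncGrad
  have h1 : Continuous fun z : Spinor => 4 * ‖z‖ ^ 2 := by fun_prop
  have h2 : Continuous fun z : Spinor => (1 + ε * ‖z‖ ^ 2) ^ 3 := by fun_prop
  exact (h1.div h2 fun z => by positivity).smul continuous_id

/-- The cubic bound is what closes the Sobolev argument: the `L²` norm of `T³` is `‖T‖₆³`, one power
less than the left side `‖T⁴‖_{3/2} = ‖T‖₆⁴`. -/
lemma norm_truncGrad_le {ε : ℝ} (hε : 0 < ε) (z : Spinor) :
    ‖truncGrad ε z‖ ≤ 4 * truncNorm ε z ^ 3 := by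
  have h0 : 0 < 1 + ε * ‖z‖ ^ 2 := by positivity
  have h1 : (1 : ℝ) ≤ 1 + ε * ‖z‖ ^ 2 := le_add_of_nonneg_right (by positivity)
  -- Squaring avoids half-integer powers: the claim becomes a comparison of the exponents 3 and 6 of
  -- `1 + ε|z|² ≥ 1` in the denominators.
  refine (sq_le_sq₀ (norm_nonneg _)
    (mul_nonneg (by norm_num) (pow_nonneg (truncNorm_nonneg ε z) 3))).1 ?_
  have e1 : (4 * truncNorm ε z ^ 3) ^ 2 = 16 * ‖z‖ ^ 6 / (1 + ε * ‖z‖ ^ 2) ^ 3 := by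
    rw [show (4 * truncNorm ε z ^ 3) ^ 2 = 16 * (truncNorm ε z ^ 2) ^ 3 by ring,
      truncNorm_sq hε, div_pow]
    ring
  have e2 : ‖truncGrad ε z‖ ^ 2 = 16 * ‖z‖ ^ 6 / (1 + ε * ‖z‖ ^ 2) ^ 6 := by
    rw [truncGrad, norm_smul, Real.norm_of_nonneg (by positivity)]
    field_simp
    ring
  rw [e1, e2]
  gcongr
  norm_num

lemma norm_truncGrad_bound {ε : ℝ} (hε : 0 < ε) (z : Spinor) :
    ‖truncGrad ε z‖ ≤ 4 * (√(1 / ε)) ^ 3 := by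
  refine (norm_truncGrad_le hε z).trans ?_
  have : truncNorm ε z ≤ √(1 / ε) := Real.le_sqrt_of_sq_le (truncNorm_sq_le hε z)
  have h0 := truncNorm_nonneg ε z
  gcongr

lemma inner_real_eq_re (z w : Spinor) : inner ℝ z w = (inner ℂ z w).re := by
  simp [PiLp.inner_apply, Fin.sum_univ_two]

/-- As a function of `s = |z|²`, `T⁴` is `(s / (1 + εs))²`, with derivative `2s / (1 + εs)³`; since
`|z|²` has real gradient `2z`, the full gradient of `T⁴` is `truncGrad`. The even power removes the
square root. -/
lemma hasFDerivAt_truncNorm_pow {ε : ℝ} (hε : 0 < ε) {φ : Space → Spinor} {φ' : Space →L[ℝ] Spinor}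
    {x : Space} (h : HasFDerivAt φ φ' x) (v : Space) :
    DifferentiableAt ℝ (fun y => truncNorm ε (φ y) ^ 4) x ∧
    fderiv ℝ (fun y => truncNorm ε (φ y) ^ 4) x v
      = (inner ℂ (truncGrad ε (φ x)) (φ' v)).re := by
  have e : (fun y => truncNorm ε (φ y) ^ 4)
      = fun y => (‖φ y‖ ^ 2 / (1 + ε * ‖φ y‖ ^ 2)) ^ 2 := by
    funext y
    rw [← truncNorm_sq hε]
    ring
  have hs : HasDerivAt (fun s : ℝ => (s / (1 + ε * s)) ^ 2)
      (2 * (‖φ x‖ ^ 2) / (1 + ε * ‖φ x‖ ^ 2) ^ 3) (‖φ x‖ ^ 2) := by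
    have h0 : 1 + ε * ‖φ x‖ ^ 2 ≠ 0 := by positivity
    have h1 : HasDerivAt (fun s : ℝ => 1 + ε * s) ε (‖φ x‖ ^ 2) := by
      simpa using ((hasDerivAt_id (‖φ x‖ ^ 2)).const_mul ε).const_add 1
    have h2 := ((hasDerivAt_id (‖φ x‖ ^ 2)).fun_div h1 h0).fun_pow 2
    refine h2.congr_deriv ?_
    simp only [id]
    rw [show 2 - 1 = 1 from rfl, pow_one]
    field_simp
    push_cast
    ring
  have hn := h.norm_sq
  have hc := hs.comp_hasFDerivAt x hn
  rw [e]
  have hc' : HasFDerivAt (fun y => (‖φ y‖ ^ 2 / (1 + ε * ‖φ y‖ ^ 2)) ^ 2) _ x := hc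
  refine ⟨hc'.differentiableAt, ?_⟩
  rw [hc'.fderiv, truncGrad]
  simp only [smul_apply, ContinuousLinearMap.comp_apply, innerSL_apply_apply,
    inner_real_eq_re, smul_eq_mul, nsmul_eq_mul]
  rw [← Complex.coe_smul (4 * ‖φ x‖ ^ 2 / _), inner_smul_left, Complex.conj_ofReal,
    Complex.re_ofReal_mul]
  simp
  ring

lemma contDiff_truncNorm_pow {ε : ℝ} (hε : 0 < ε) {φ : Space → Spinor} (h : ContDiff ℝ ∞ φ) :
    ContDiff ℝ 1 (fun y => truncNorm ε (φ y) ^ 4) := by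
  have e : (fun y => truncNorm ε (φ y) ^ 4)
      = fun y => (‖φ y‖ ^ 2 / (1 + ε * ‖φ y‖ ^ 2)) ^ 2 := by
    funext y
    rw [← truncNorm_sq hε]
    ring
  rw [e]
  have hn : ContDiff ℝ 1 fun y => ‖φ y‖ ^ 2 := (h.norm_sq ℂ).of_le (by simp)
  exact (hn.div (contDiff_const.add (contDiff_const.mul hn)) fun y => by positivity).pow 2

/-- The constant of the Gagliardo-Nirenberg-Sobolev inequality `W^{1,1} ⊂ L^{3/2}`. -/
noncomputable def gnsConst : NNReal := eLpNormLESNormFDerivOneConst (volume : Measure Space) (3 / 2)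

lemma enorm_clm_le_sum (L : Space →L[ℝ] ℝ) :
    ‖L‖ₑ ≤ ∑ j : Fin 3, ‖L (EuclideanSpace.single j 1)‖ₑ := by
  have : ‖L‖ ≤ ∑ j : Fin 3, ‖L (EuclideanSpace.single j 1)‖ := by
    refine L.opNorm_le_bound (by positivity) fun x => ?_
    have hx : x = ∑ j : Fin 3, x j • EuclideanSpace.single j (1 : ℝ) := by
      ext i
      fin_cases i <;> simp [Fin.sum_univ_three]
    conv_lhs => rw [hx]
    rw [map_sum, Finset.sum_mul]
    refine (norm_sum_le _ _).trans (Finset.sum_le_sum fun j _ => ?_)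
    rw [map_smul, norm_smul, mul_comm]
    gcongr
    exact PiLp.norm_apply_le x j
  rw [← ofReal_norm]
  refine (ENNReal.ofReal_le_ofReal this).trans ?_
  rw [ENNReal.ofReal_sum_of_nonneg fun _ _ => norm_nonneg _]
  simp only [ofReal_norm]
  exact le_rfl

/-- The embedding `W^{1,1} ⊂ L^{3/2}` of dimension three is applied to the fourth power because `4 ·
3/2 = 6`. -/
lemma gns_truncNorm {ε : ℝ} (hε : 0 < ε) {φ : Space → Spinor} (h : ContDiff ℝ ∞ φ)
    (hc : HasCompactSupport φ) :
    eLpNorm (fun x => truncNorm ε (φ x) ^ 4) (3 / 2 : NNReal) volume ≤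
      gnsConst * ∑ j : Fin 3, ∫⁻ x, ‖(inner ℂ (truncGrad ε (φ x))
        (fderiv ℝ φ x (EuclideanSpace.single j 1))).re‖ₑ := by
  have hp : NNReal.HolderConjugate (Module.finrank ℝ Space) (3 / 2) := by
    rw [finrank_euclideanSpace_fin]
    rw [NNReal.holderConjugate_iff]
    refine ⟨by norm_num, ?_⟩
    rw [← NNReal.coe_inj]
    push_cast
    norm_num
  have hcs : HasCompactSupport (fun x => truncNorm ε (φ x) ^ 4) :=
    hc.comp_left (g := fun z => truncNorm ε z ^ 4) (by simp [truncNorm])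
  refine (eLpNorm_le_eLpNorm_fderiv_one volume (contDiff_truncNorm_pow hε h) hcs hp).trans ?_
  rw [eLpNorm_one_eq_lintegral_enorm]
  refine mul_le_mul_right ?_ _
  rw [← lintegral_finsetSum']
  · refine lintegral_mono fun x => (enorm_clm_le_sum _).trans (le_of_eq ?_)
    refine Finset.sum_congr rfl fun j _ => ?_
    rw [(hasFDerivAt_truncNorm_pow hε (h.differentiable (by simp) x).hasFDerivAt _).2]
  · intro j _
    have h1 : Continuous fun x => (inner ℂ (truncGrad ε (φ x))
        (fderiv ℝ φ x (EuclideanSpace.single j 1))).re :=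
      Complex.continuous_re.comp (((continuous_truncGrad hε).comp h.continuous).inner
        (continuous_partial h _))
    exact h1.aemeasurable.enorm

lemma integrable_of_hasCompactSupport {E : Type*} [NormedAddCommGroup E] {f : Space → E}
    (hf : LocallyIntegrable f) (hc : HasCompactSupport f) : Integrable f :=
  (integrableOn_iff_integrable_of_support_subset (subset_tsupport f)).1
    (hf.integrableOn_isCompact hc.isCompact)

/-- The real part of `⟨c φ, i(η + aφ)⟩` does not depend on the real number `a`. -/
lemma re_inner_truncGrad (ε a : ℝ) (z w : Spinor) :
    (inner ℂ (truncGrad ε z) (Complex.I • (w + a • z))).re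
      = (inner ℂ (truncGrad ε z) (Complex.I • w)).re := by
  rw [smul_add, inner_add_right, Complex.add_re, add_eq_left, truncGrad,
    ← Complex.coe_smul _ z, ← Complex.coe_smul _ z, smul_smul, inner_smul_left, inner_smul_right,
    inner_self_eq_norm_sq_to_K]
  simp [← Complex.ofReal_pow]

lemma enorm_re_inner_le (z w : Spinor) : ‖(inner ℂ z w).re‖ₑ ≤ ‖z‖ₑ * ‖w‖ₑ := by
  rw [← ofReal_norm, ← ofReal_norm, ← ofReal_norm, ← ENNReal.ofReal_mul (norm_nonneg _)]
  exact ENNReal.ofReal_le_ofReal ((Complex.abs_re_le_norm _).trans (norm_inner_le_norm z w))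

/-- The diamagnetic step. Mollification gives the inequality for smooth functions, but it does not
respect the relation between `φ` and `Aφ`. The potential is therefore discarded only in the limit,
where `truncGrad ε (φ x)` is a real multiple of `φ x`. -/
lemma eLpNorm_truncNorm_pow_le_lintegral {A : Space → Space} (hA : LpLoc 2 A)
    {φ : Space → Spinor} {η : Fin 3 → Space → Spinor} (h : IsMagneticGradient A φ η)
    (hφc : HasCompactSupport φ) (hηc : ∀ j, HasCompactSupport (η j)) {ε : ℝ} (hε : 0 < ε) :
    eLpNorm (fun x => truncNorm ε (φ x) ^ 4) (3 / 2 : NNReal) volume ≤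
      gnsConst * ∑ j : Fin 3, ∫⁻ x, ‖truncGrad ε (φ x)‖ₑ * ‖η j x‖ₑ := by
  obtain ⟨h1, h2, h3⟩ := (isMagneticGradient_iff hA).1 h
  set g : Fin 3 → Space → Spinor := fun j x => Complex.I • (η j x + A x j • φ x) with hg
  have hφl := memLp_two_locallyIntegrable h1
  have hgl : ∀ j, LocallyIntegrable (g j) := fun j => locallyIntegrable_weakPartial hA h1 (h2 j) j
  have hgi : ∀ j, Integrable (g j) := fun j => by
    have hs : HasCompactSupport fun x => A x j • φ x := by
      refine hφc.mono fun x hx => ?_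
      exact fun h0 : φ x = 0 => hx (by simp [h0])
    have hs' : HasCompactSupport (η j + fun x => A x j • φ x) := (hηc j).add hs
    have hs'' : HasCompactSupport (g j) :=
      hs'.comp_left (g := fun z : Spinor => Complex.I • z) (smul_zero _)
    exact integrable_of_hasCompactSupport (hgl j) hs''
  have hM := norm_truncGrad_bound hε
  set M := 4 * (√(1 / ε)) ^ 3 with hMdef
  have hM0 : 0 ≤ M := by positivity
  have hGc := continuous_truncGrad hε
  have hφn : ∀ n, Continuous (mollify n φ) := fun n => (contDiff_mollify hφl n).continuous
  set a : Fin 3 → ℕ → ℝ≥0∞ := fun j n =>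
    ∫⁻ x, ‖(inner ℂ (truncGrad ε (mollify n φ x)) (g j x)).re‖ₑ with ha
  set b : Fin 3 → ℕ → ℝ≥0∞ := fun j n => ∫⁻ x, ‖mollify n (g j) x - g j x‖ₑ with hb
  have hGn : ∀ n, Continuous fun x => truncGrad ε (mollify n φ x) := fun n => hGc.comp (hφn n)
  have bound : ∀ n, eLpNorm (fun x => truncNorm ε (mollify n φ x) ^ 4) (3 / 2 : NNReal) volume ≤
      gnsConst * ∑ j, (a j n + ENNReal.ofReal M * b j n) := fun n => by
    refine (gns_truncNorm hε (contDiff_mollify hφl n) (hasCompactSupport_mollify hφc n)).trans ?_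
    refine mul_le_mul_right (Finset.sum_le_sum fun j _ => ?_) _
    have hbm : AEMeasurable fun x => ‖mollify n (g j) x - g j x‖ₑ :=
      ((integrable_mollify (hgi j) n).sub (hgi j)).1.enorm
    rw [← lintegral_const_mul'' _ hbm, ← lintegral_add_right' _ (hbm.const_mul _)]
    refine lintegral_mono fun x => ?_
    rw [fderiv_mollify (h3 j) hφl n x]
    -- Replacing the mollified derivative by `g j` costs at most `M` times its `L¹` error; this is
    -- where the boundedness of `truncGrad` is needed.
    have e : mollify n (g j) x = g j x + (mollify n (g j) x - g j x) := by abel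
    change ‖(inner ℂ (truncGrad ε (mollify n φ x)) (mollify n (g j) x)).re‖ₑ ≤ _
    conv_lhs => rw [e]
    rw [inner_add_right, Complex.add_re]
    refine (enorm_add_le _ _).trans (add_le_add le_rfl ((enorm_re_inner_le _ _).trans ?_))
    refine mul_le_mul_left ?_ _
    rw [← ofReal_norm]
    exact ENNReal.ofReal_le_ofReal (hM _)
  have ta : ∀ j, Tendsto (a j) atTop
      (𝓝 (∫⁻ x, ‖(inner ℂ (truncGrad ε (φ x)) (g j x)).re‖ₑ)) := fun j => by
    refine tendsto_lintegral_of_dominated_convergence' (fun x => ENNReal.ofReal M * ‖g j x‖ₑ)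
      (fun n => ?_) (fun n => ae_of_all _ fun x => ?_) ?_ ?_
    · exact (Complex.continuous_re.comp_aestronglyMeasurable
        ((hGn n).aestronglyMeasurable.inner (hgi j).1)).enorm
    · refine (enorm_re_inner_le _ _).trans (mul_le_mul_left ?_ _)
      rw [← ofReal_norm]
      exact ENNReal.ofReal_le_ofReal (hM _)
    · rw [lintegral_const_mul'' _ (hgi j).1.enorm]
      exact ENNReal.mul_ne_top (by simp) (hgi j).2.ne
    · filter_upwards [ae_tendsto_mollify hφl] with x hx
      have h5 : Tendsto (fun n => truncGrad ε (mollify n φ x)) atTop (𝓝 (truncGrad ε (φ x))) :=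
        (hGc.tendsto _).comp hx
      exact ((Complex.continuous_re.tendsto _).comp (h5.inner tendsto_const_nhds)).enorm
  have tb : ∀ j, Tendsto (b j) atTop (𝓝 0) := fun j => tendsto_lintegral_mollify_sub (hgi j)
  have tsum : Tendsto (fun n => gnsConst * ∑ j, (a j n + ENNReal.ofReal M * b j n)) atTop
      (𝓝 (gnsConst * ∑ j, ∫⁻ x, ‖(inner ℂ (truncGrad ε (φ x)) (g j x)).re‖ₑ)) := by
    refine ENNReal.Tendsto.const_mul (tendsto_finsetSum _ fun j _ => ?_)
      (Or.inr ENNReal.coe_ne_top)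
    have := (ta j).add (ENNReal.Tendsto.const_mul (tb j) (Or.inr (ENNReal.ofReal_ne_top (r := M))))
    simpa using this
  have hT : Continuous fun z => truncNorm ε z ^ 4 := (continuous_truncNorm hε).pow 4
  have fatou := Lp.eLpNorm_lim_le_liminf_eLpNorm (μ := (volume : Measure Space))
    (p := (3 / 2 : NNReal)) (f := fun n x => truncNorm ε (mollify n φ x) ^ 4)
    (fun n => (hT.comp (hφn n)).aestronglyMeasurable) (fun x => truncNorm ε (φ x) ^ 4) (by
      filter_upwards [ae_tendsto_mollify hφl] with x hx
      exact (hT.tendsto _).comp hx)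
  refine fatou.trans ((liminf_le_liminf (Eventually.of_forall bound)).trans ?_)
  rw [tsum.liminf_eq]
  refine mul_le_mul_right (Finset.sum_le_sum fun j _ => lintegral_mono fun x => ?_) _
  simp only [hg]
  rw [re_inner_truncGrad]
  refine (enorm_re_inner_le _ _).trans (le_of_eq ?_)
  rw [enorm_smul, ← ofReal_norm Complex.I, Complex.norm_I, ENNReal.ofReal_one, one_mul]

lemma eLpNorm_truncNorm_le {A : Space → Space} (hA : LpLoc 2 A)
    {φ : Space → Spinor} {η : Fin 3 → Space → Spinor} (h : IsMagneticGradient A φ η)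
    (hφc : HasCompactSupport φ) (hηc : ∀ j, HasCompactSupport (η j)) {ε : ℝ} (hε : 0 < ε) :
    eLpNorm (fun x => truncNorm ε (φ x)) 6 volume ≤
      4 * gnsConst * ∑ j : Fin 3, eLpNorm (η j) 2 volume := by
  set u : Space → ℝ := fun x => truncNorm ε (φ x) with hu
  have hum : AEStronglyMeasurable u :=
    (continuous_truncNorm hε).comp_aestronglyMeasurable h.memLp.1
  have huc : HasCompactSupport u := hφc.comp_left (g := truncNorm ε) (by simp [truncNorm])
  have hub : ∀ x, ‖u x‖ ≤ √(1 / ε) := fun x => by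
    rw [Real.norm_of_nonneg (truncNorm_nonneg _ _)]
    exact Real.le_sqrt_of_sq_le (truncNorm_sq_le hε _)
  -- Truncation and compact support make this norm finite beforehand, so that its third power can be
  -- cancelled at the end.
  have hu6 : MemLp u 6 volume := by
    have hf : IsFiniteMeasure (volume.restrict (tsupport u)) :=
      isFiniteMeasure_restrict.2 huc.isCompact.measure_lt_top.ne
    have h2 : MemLp u 6 (volume.restrict (tsupport u)) :=
      MemLp.of_bound hum.restrict _ (ae_of_all _ hub)
    rw [← memLp_indicator_iff_restrict (isClosed_tsupport u).measurableSet] at h2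
    rwa [Set.indicator_eq_self.2 (subset_tsupport u)] at h2
  set Y := eLpNorm u 6 volume with hY
  have e1 : eLpNorm (fun x => truncNorm ε (φ x) ^ 4) (3 / 2 : NNReal) volume = Y ^ 4 := by
    have := eLpNorm_norm_rpow (p := ((3 / 2 : NNReal) : ℝ≥0∞)) (μ := (volume : Measure Space)) u
      (q := 4) (by norm_num)
    rw [show (((3 / 2 : NNReal) : ℝ≥0∞) * ENNReal.ofReal 4) = 6 by
      rw [← ENNReal.coe_ofNat, ← ENNReal.ofReal_coe_nnreal, ← ENNReal.ofReal_mul (by positivity)]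
      norm_num] at this
    rw [hY]
    rw [show (4 : ℝ) = ((4 : ℕ) : ℝ) by norm_num, ENNReal.rpow_natCast] at this
    rw [← this]
    simp only [Real.rpow_natCast, hu, Real.norm_of_nonneg (truncNorm_nonneg _ _)]
  -- Cauchy-Schwarz together with `‖T³‖₂ = ‖T‖₆³`.
  have e2 : ∀ j, ∫⁻ x, ‖truncGrad ε (φ x)‖ₑ * ‖η j x‖ₑ
      ≤ 4 * Y ^ 3 * eLpNorm (η j) 2 volume := fun j => by
    have hGm : AEStronglyMeasurable fun x => truncGrad ε (φ x) :=
      (continuous_truncGrad hε).comp_aestronglyMeasurable h.memLp.1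
    have cs := ENNReal.lintegral_mul_le_Lp_mul_Lq (volume : Measure Space)
      Real.HolderConjugate.two_two hGm.enorm (h.memLp_grad j).1.enorm
    refine cs.trans ?_
    have c1 : (∫⁻ x, ‖η j x‖ₑ ^ (2 : ℝ)) ^ (1 / (2 : ℝ)) = eLpNorm (η j) 2 volume := by
      rw [eLpNorm_eq_lintegral_rpow_enorm_toReal (by norm_num) (by norm_num)]
      simp
    have c2 : (∫⁻ x, ‖truncGrad ε (φ x)‖ₑ ^ (2 : ℝ)) ^ (1 / (2 : ℝ))
        = eLpNorm (fun x => truncGrad ε (φ x)) 2 volume := by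
      rw [eLpNorm_eq_lintegral_rpow_enorm_toReal (by norm_num) (by norm_num)]
      simp
    rw [c1, c2]
    refine mul_le_mul_left ?_ _
    have c3 := eLpNorm_norm_rpow (p := 2) (μ := (volume : Measure Space)) u
      (q := 3) (by norm_num)
    rw [show ((2 : ℝ≥0∞) * ENNReal.ofReal 3) = 6 by
      rw [ENNReal.ofReal_ofNat]; norm_num, show (3 : ℝ) = ((3 : ℕ) : ℝ) by norm_num,
      ENNReal.rpow_natCast] at c3
    have c4 := eLpNorm_le_mul_eLpNorm_of_ae_le_mul (μ := (volume : Measure Space)) (p := 2)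
      (f := fun x => truncGrad ε (φ x)) (g := fun x => ‖u x‖ ^ ((3 : ℕ) : ℝ)) (c := 4)
      (ae_of_all _ fun x => by
        rw [Real.rpow_natCast, norm_pow, norm_norm, Real.norm_of_nonneg (truncNorm_nonneg _ _)]
        exact norm_truncGrad_le hε (φ x))
    rw [c3, ENNReal.ofReal_ofNat] at c4
    exact c4
  have main := eLpNorm_truncNorm_pow_le_lintegral hA h hφc hηc hε
  rw [e1] at main
  have main2 : Y ^ 3 * Y ≤ Y ^ 3 * (4 * gnsConst * ∑ j : Fin 3, eLpNorm (η j) 2 volume) := by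
    rw [← pow_succ]
    refine main.trans ((mul_le_mul_right (Finset.sum_le_sum fun j _ => e2 j) _).trans ?_)
    rw [← Finset.mul_sum]
    exact le_of_eq (by ring)
  by_cases hY0 : Y = 0
  · rw [hY0]; exact zero_le
  · exact (ENNReal.mul_le_mul_iff_right (pow_ne_zero 3 hY0) (ENNReal.pow_ne_top hu6.2.ne)).1 main2

/-- The magnetic Sobolev inequality, a consequence of the diamagnetic inequality. -/
lemma eLpNorm_six_le {A : Space → Space} (hA : LpLoc 2 A)
    {φ : Space → Spinor} {η : Fin 3 → Space → Spinor} (h : IsMagneticGradient A φ η)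
    (hφc : HasCompactSupport φ) (hηc : ∀ j, HasCompactSupport (η j)) :
    eLpNorm φ 6 volume ≤ 4 * gnsConst * ∑ j : Fin 3, eLpNorm (η j) 2 volume := by
  have hε : ∀ n : ℕ, (0 : ℝ) < 1 / (n + 1) := fun n => by positivity
  -- The bound for the truncations does not depend on `ε`, so Fatou's lemma lets `ε → 0`.
  have fatou := Lp.eLpNorm_lim_le_liminf_eLpNorm (μ := (volume : Measure Space))
    (p := 6) (f := fun (n : ℕ) x => truncNorm (1 / (n + 1)) (φ x))
    (fun n => (continuous_truncNorm (hε n)).comp_aestronglyMeasurable h.memLp.1)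
    (fun x => ‖φ x‖) (ae_of_all _ fun x => by
      have t := tendsto_one_div_add_atTop_nhds_zero_nat (𝕜 := ℝ)
      have h1 : Tendsto (fun n : ℕ => √(1 + 1 / ((n : ℝ) + 1) * ‖φ x‖ ^ 2)) atTop
          (𝓝 (√(1 + 0 * ‖φ x‖ ^ 2))) := ((t.mul_const _).const_add 1).sqrt
      have h2 := (tendsto_const_nhds (x := ‖φ x‖)).div h1 (by simp)
      simpa [truncNorm, Pi.div_def] using h2)
  rw [eLpNorm_norm] at fatou
  refine fatou.trans ((liminf_le_liminf (Eventually.of_forall fun n =>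
    eLpNorm_truncNorm_le hA h hφc hηc (hε n))).trans ?_)
  simp

/-! ### Relative bounds -/

lemma continuous_act : Continuous fun p : Mat × Spinor => act p.1 p.2 := by
  unfold act
  fun_prop

lemma aestronglyMeasurable_act {W : Space → Mat} {φ : Space → Spinor}
    (hW : AEStronglyMeasurable W) (hφ : AEStronglyMeasurable φ) :
    AEStronglyMeasurable fun x => act (W x) (φ x) :=
  continuous_act.comp_aestronglyMeasurable (hW.prodMk hφ)

lemma normSq_nonneg (φ : Space → Spinor) : 0 ≤ normSq φ :=
  integral_nonneg fun _ => by positivity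

lemma gradNormSq_nonneg (η : Fin 3 → Space → Spinor) : 0 ≤ gradNormSq η :=
  Finset.sum_nonneg fun _ _ => normSq_nonneg _

lemma _root_.MeasureTheory.MemLp.integrable_normSq {φ : Space → Spinor} (h : MemLp φ 2 volume) :
    Integrable fun x => ‖φ x‖ ^ 2 := h.integrable_norm_pow (by norm_num)

lemma eLpNorm_two_eq {φ : Space → Spinor} (h : MemLp φ 2 volume) :
    eLpNorm φ 2 volume = ENNReal.ofReal √(normSq φ) := by
  rw [h.eLpNorm_eq_integral_rpow_norm (by norm_num) (by norm_num), Real.sqrt_eq_rpow]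
  simp [normSq]

lemma normSq_le_of_ae {φ : Space → Spinor} (hφ : MemLp φ 2 volume) {ψ : Space → Spinor} {C : ℝ}
    (hC : ∀ᵐ x, ‖ψ x‖ ^ 2 ≤ C * ‖φ x‖ ^ 2) : normSq ψ ≤ C * normSq φ := by
  rw [normSq, normSq, ← integral_const_mul]
  exact integral_mono_of_nonneg (ae_of_all _ fun x => by positivity)
    (hφ.integrable_normSq.const_mul C) hC

lemma eLpNorm_smul_bounded_le {E : Type*} [NormedAddCommGroup E] [NormedSpace ℝ E]
    {χ : Space → ℝ} {C : ℝ} (hC : ∀ x, ‖χ x‖ ≤ C) (φ : Space → E) (p : ℝ≥0∞) :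
    eLpNorm (fun x => χ x • φ x) p volume ≤ ENNReal.ofReal C * eLpNorm φ p volume :=
  eLpNorm_le_mul_eLpNorm_of_ae_le_mul (ae_of_all _ fun x => by
    rw [norm_smul]
    exact mul_le_mul_of_nonneg_right (hC x) (norm_nonneg _)) p

/-- A local Sobolev inequality on a ball for the magnetic gradient. -/
lemma exists_eLpNorm_six_indicator_le {A : Space → Space} (hA : LpLoc 2 A) (R : ℝ) :
    ∃ C : NNReal, ∀ (φ : Space → Spinor) (η : Fin 3 → Space → Spinor), IsMagneticGradient A φ η →
      eLpNorm ((Metric.closedBall (0 : Space) R).indicator φ) 6 volume ≤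
        C * (∑ j, eLpNorm (η j) 2 volume + eLpNorm φ 2 volume) := by
  let χ : ContDiffBump (0 : Space) := ⟨|R| + 1, |R| + 2, by positivity, by linarith⟩
  have hχs : ContDiff ℝ ∞ χ := χ.contDiff
  have hχc : HasCompactSupport χ := χ.hasCompactSupport
  have hD : ∃ D : NNReal, ∀ (j : Fin 3) x,
      ‖fderiv ℝ χ x (EuclideanSpace.single j 1)‖ ≤ (D : ℝ) := by
    obtain ⟨D, hD⟩ := (hχc.fderiv ℝ).exists_bound_of_continuous
      (hχs.continuous_fderiv (by simp))
    refine ⟨⟨|D|, abs_nonneg D⟩, fun j x => ?_⟩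
    refine ((fderiv ℝ χ x).le_opNorm _).trans ?_
    rw [PiLp.norm_single, norm_one, mul_one]
    exact (hD x).trans (le_abs_self D)
  obtain ⟨D, hD⟩ := hD
  -- Each of the three components of the magnetic gradient of `χφ` gains at most `D ‖φ‖₂` from the
  -- derivative of the cut-off.
  refine ⟨4 * gnsConst * (1 + 3 * D), fun φ η h => ?_⟩
  have h' := h.mul_smooth hA hχs hχc
  have hs := eLpNorm_six_le hA h' (hχc.mono fun x hx hx0 => hx (by
      change χ x • φ x = 0
      rw [show χ x = 0 from hx0, zero_smul])) (fun j => by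
    refine hχc.mono' fun x hx => by_contra fun hxn => hx ?_
    have e1 : χ x = 0 := image_eq_zero_of_notMem_tsupport hxn
    have e2 : fderiv ℝ χ x = 0 :=
      image_eq_zero_of_notMem_tsupport fun hm => hxn (tsupport_fderiv_subset ℝ hm)
    simp [e1, e2])
  have h1 : eLpNorm ((Metric.closedBall (0 : Space) R).indicator φ) 6 volume
      ≤ eLpNorm (fun x => χ x • φ x) 6 volume := by
    refine eLpNorm_mono fun x => ?_
    by_cases hx : x ∈ Metric.closedBall (0 : Space) R
    · rw [Set.indicator_of_mem hx, χ.one_of_mem_closedBall, one_smul]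
      refine Metric.closedBall_subset_closedBall ?_ hx
      exact (le_abs_self R).trans (by linarith)
    · simp [Set.indicator_of_notMem hx]
  have h2 : ∀ j, eLpNorm (fun x => χ x • η j x
      - Complex.I • (fderiv ℝ χ x (EuclideanSpace.single j 1) • φ x)) 2 volume
      ≤ eLpNorm (η j) 2 volume + D * eLpNorm φ 2 volume := fun j => by
    have m1 : AEStronglyMeasurable fun x => χ x • η j x :=
      hχs.continuous.aestronglyMeasurable.smul (h.memLp_grad j).1
    have m2 : AEStronglyMeasurable fun x => fderiv ℝ χ x (EuclideanSpace.single j 1) • φ x :=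
      (continuous_partial hχs _).aestronglyMeasurable.smul h.memLp.1
    refine (eLpNorm_sub_le m1 (m2.const_smul Complex.I) (by norm_num)).trans (add_le_add ?_ ?_)
    · refine (eLpNorm_smul_bounded_le (C := 1) (fun x => ?_) _ _).trans ?_
      · rw [Real.norm_of_nonneg χ.nonneg]
        exact χ.le_one
      · simp
    · have e := eLpNorm_const_smul Complex.I
        (fun x => fderiv ℝ χ x (EuclideanSpace.single j 1) • φ x) 2 (volume : Measure Space)
      rw [← ofReal_norm Complex.I, Complex.norm_I, ENNReal.ofReal_one, one_mul] at e
      refine e.le.trans ((eLpNorm_smul_bounded_le (hD j) _ _).trans ?_)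
      simp
  refine h1.trans (hs.trans ?_)
  refine (mul_le_mul_right (Finset.sum_le_sum fun j _ => h2 j) _).trans ?_
  rw [Finset.sum_add_distrib]
  simp only [Finset.sum_const, Finset.card_univ, Fintype.card_fin, nsmul_eq_mul]
  push_cast
  set S := ∑ j, eLpNorm (η j) 2 volume
  set f := eLpNorm φ 2 volume
  rw [mul_assoc (4 * (gnsConst : ℝ≥0∞))]
  refine mul_le_mul_right ?_ _
  calc S + 3 * (D * f) ≤ S + 3 * (D * f) + (f + 3 * D * S) := le_self_add
    _ = _ := by ring

lemma holderTriple_three_six_two : ENNReal.HolderTriple 3 6 2 := ⟨by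
  have h : ((3 : ℝ≥0∞)⁻¹ + 6⁻¹).toReal = (2 : ℝ≥0∞)⁻¹.toReal := by
    rw [ENNReal.toReal_add (by simp) (by simp)]
    simp only [ENNReal.toReal_inv, ENNReal.toReal_ofNat]
    norm_num
  exact (ENNReal.toReal_eq_toReal_iff' (by simp) (by simp)).1 h⟩

/-- A field in `L³_loc` that is bounded outside of a compact set is bounded relative to `P - A`,
with relative bound zero. -/
lemma relative_bound_zero {A : Space → Space} (hA : LpLoc 2 A) {F : Type*}
    [NormedAddCommGroup F] {W : Space → F} (hW : LpLoc 3 W) (hb : BoundedOutsideCompact W)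
    {ε : ℝ} (hε : 0 < ε) :
    ∃ C : ℝ, 0 ≤ C ∧ ∀ (φ : Space → Spinor) (η : Fin 3 → Space → Spinor),
      IsMagneticGradient A φ η →
      MemLp (fun x => ‖W x‖ • φ x) 2 volume ∧
      normSq (fun x => ‖W x‖ • φ x) ≤ ε * gradNormSq η + C * normSq φ := by
  obtain ⟨R, C₀, hR⟩ := hb
  set K := Metric.closedBall (0 : Space) R with hK
  have hKm : MeasurableSet K := measurableSet_closedBall
  obtain ⟨S, hS⟩ := exists_eLpNorm_six_indicator_le hA R
  have hWm : AEStronglyMeasurable W := (hW.locallyIntegrable (by norm_num)).aestronglyMeasurable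
  have hw : MemLp (K.indicator fun x => ‖W x‖) 3 volume :=
    (memLp_indicator_iff_restrict hKm).2 (hW K (isCompact_closedBall _ _)).norm
  -- A strongly measurable representative makes the level set `T` below measurable.
  set w := hw.1.mk _ with hwdef
  have hww : K.indicator (fun x => ‖W x‖) =ᵐ[volume] w := hw.1.ae_eq_mk
  have hws : StronglyMeasurable w := hw.1.stronglyMeasurable_mk
  -- The target for the `L³` norm of the large part of `W`: times the Sobolev constant `S` it is at
  -- most `√(ε / 6)`. The `+ 1` allows `S = 0`.
  set δ : ℝ := √(ε / 6) / (S + 1) with hδ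
  have hδ0 : 0 < δ := by positivity
  have hδS : δ * S ≤ √(ε / 6) := by
    rw [hδ, div_mul_eq_mul_div, div_le_iff₀ (by positivity)]
    nlinarith [Real.sqrt_nonneg (ε / 6)]
  obtain ⟨N, hN⟩ := ((memLp_congr_ae hww).1 hw).eLpNorm_indicator_norm_ge_le hws hδ0
  set T : Set Space := {x | N ≤ ‖w x‖₊} with hT
  set M : ℝ := |N| + |C₀| with hM
  have hM0 : 0 ≤ M := by positivity
  refine ⟨2 * (√(ε / 6) + M) ^ 2, by positivity, fun φ η h => ?_⟩
  have hφ := h.memLp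
  have hTm : MeasurableSet T := measurableSet_le measurable_const
    (measurable_subtype_coe.comp hws.measurable.nnnorm)
  -- Inside the ball, `W` is large on `T` and at most `N` elsewhere; outside the ball it is at most
  -- `C₀`. Thus `M` bounds everything except the part on `T`.
  have hptw : ∀ᵐ x, ‖‖W x‖ • φ x‖ ≤ ‖‖T.indicator w x • K.indicator φ x‖ + M * ‖φ x‖‖ := by
    filter_upwards [hR, hww] with x hx1 hx2
    rw [Real.norm_of_nonneg (by positivity), norm_smul, norm_norm, norm_smul]
    by_cases hxK : x ∈ K
    · rw [Set.indicator_of_mem hxK] at hx2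
      rw [Set.indicator_of_mem hxK, hx2]
      by_cases hxT : x ∈ T
      · rw [Set.indicator_of_mem hxT]
        have := mul_le_mul_of_nonneg_right (le_abs_self (w x)) (norm_nonneg (φ x))
        rw [Real.norm_eq_abs]
        nlinarith [mul_nonneg hM0 (norm_nonneg (φ x))]
      · rw [Set.indicator_of_notMem hxT, norm_zero, zero_mul, zero_add]
        refine mul_le_mul_of_nonneg_right ?_ (norm_nonneg _)
        have h3 : ‖w x‖ < N := not_le.1 hxT
        calc w x ≤ ‖w x‖ := le_abs_self _
          _ ≤ |N| := h3.le.trans (le_abs_self N)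
          _ ≤ M := le_add_of_nonneg_right (abs_nonneg _)
    · have h3 : R ≤ ‖x‖ := by
        rw [hK, mem_closedBall_zero_iff, not_le] at hxK
        exact hxK.le
      have h4 : ‖W x‖ ≤ M := (hx1 h3).trans
        ((le_abs_self C₀).trans (le_add_of_nonneg_left (abs_nonneg _)))
      have := mul_le_mul_of_nonneg_right h4 (norm_nonneg (φ x))
      have h5 : 0 ≤ ‖T.indicator w x‖ * ‖K.indicator φ x‖ := by positivity
      linarith
  have hTw : AEStronglyMeasurable (T.indicator w) := (hws.indicator hTm).aestronglyMeasurable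
  have hKφ : AEStronglyMeasurable (K.indicator φ) := hφ.1.indicator hKm
  have hη2 := fun j => eLpNorm_two_eq (h.memLp_grad j)
  have hφ2 := eLpNorm_two_eq hφ
  set e : Fin 3 → ℝ := fun j => √(normSq (η j)) with he
  set f : ℝ := √(normSq φ) with hf
  have he0 : ∀ j, 0 ≤ e j := fun j => Real.sqrt_nonneg _
  have hf0 : 0 ≤ f := Real.sqrt_nonneg _
  have hsum0 := Finset.sum_nonneg fun j (_ : j ∈ Finset.univ) => he0 j
  have hs0 := Real.sqrt_nonneg (ε / 6)
  have hfin : eLpNorm (fun x => ‖W x‖ • φ x) 2 volume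
      ≤ ENNReal.ofReal (√(ε / 6) * (∑ j, e j + f) + M * f) := by
    refine (eLpNorm_mono_ae hptw).trans ?_
    refine (eLpNorm_add_le ((hTw.smul hKφ).norm) (hφ.1.norm.const_mul M) (by norm_num)).trans ?_
    rw [ENNReal.ofReal_add (mul_nonneg hs0 (add_nonneg hsum0 hf0)) (mul_nonneg hM0 hf0)]
    refine add_le_add ?_ ?_
    · have := holderTriple_three_six_two
      have hsm := eLpNorm_smul_le_mul_eLpNorm (p := 3) (q := 6) (r := 2) hKφ hTw
      have e3 : eLpNorm (fun x => ‖(T.indicator w • K.indicator φ) x‖) 2 volume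
          = eLpNorm (T.indicator w • K.indicator φ) 2 volume := eLpNorm_norm _
      rw [e3]
      refine hsm.trans ?_
      have h8 := hS φ η h
      have h9 : eLpNorm (T.indicator w) 3 volume
          * eLpNorm (K.indicator φ) 6 volume ≤ ENNReal.ofReal δ *
            (S * (∑ j, eLpNorm (η j) 2 volume + eLpNorm φ 2 volume)) := by gcongr
      refine h9.trans ?_
      simp only [hη2, hφ2]
      rw [← ENNReal.ofReal_sum_of_nonneg fun j _ => Real.sqrt_nonneg _,
        ← ENNReal.ofReal_add (Finset.sum_nonneg fun j _ => he0 j) hf0,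
        ← ENNReal.ofReal_coe_nnreal, ← mul_assoc, ← ENNReal.ofReal_mul hδ0.le,
        ← ENNReal.ofReal_mul (by positivity)]
      exact ENNReal.ofReal_le_ofReal (mul_le_mul_of_nonneg_right hδS (add_nonneg hsum0 hf0))
    · have e4 := eLpNorm_const_smul M (fun x => ‖φ x‖) 2 (volume : Measure Space)
      rw [eLpNorm_norm, hφ2, ← ofReal_norm, Real.norm_of_nonneg hM0, ← ENNReal.ofReal_mul hM0] at e4
      exact e4.le
  have hmem : MemLp (fun x => ‖W x‖ • φ x) 2 volume :=
    ⟨hWm.norm.smul hφ.1, hfin.trans_lt ENNReal.ofReal_lt_top⟩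
  refine ⟨hmem, ?_⟩
  rw [eLpNorm_two_eq hmem] at hfin
  rw [ENNReal.ofReal_le_ofReal_iff (add_nonneg (mul_nonneg hs0 (add_nonneg hsum0 hf0))
    (mul_nonneg hM0 hf0)), Real.sqrt_le_iff] at hfin
  refine hfin.2.trans ?_
  have q1 : (∑ j, e j) ^ 2 ≤ 3 * gradNormSq η := by
    have h6 := sq_sum_le_card_mul_sum_sq (s := Finset.univ) (f := e)
    simp only [Finset.card_univ, Fintype.card_fin, he, Real.sq_sqrt (normSq_nonneg _)] at h6
    exact_mod_cast h6
  have q2 : f ^ 2 = normSq φ := Real.sq_sqrt (normSq_nonneg _)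
  have q3 : √(ε / 6) ^ 2 = ε / 6 := Real.sq_sqrt (by positivity)
  set s := √(ε / 6)
  set Se := ∑ j, e j
  -- The six in `ε / 6` is used up here: a factor 2 from squaring a sum and a factor 3 from the
  -- three components of the gradient.
  calc (s * (Se + f) + M * f) ^ 2 ≤ 2 * (s ^ 2 * Se ^ 2) + 2 * ((s + M) ^ 2 * f ^ 2) := by
        nlinarith [sq_nonneg (s * Se - (s + M) * f)]
    _ ≤ 2 * (ε / 6 * (3 * gradNormSq η)) + 2 * ((s + M) ^ 2 * normSq φ) := by
        rw [q2, q3]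
        gcongr
    _ = _ := by ring

lemma inFormDomain_of_integrable {W : Space → Mat} {φ : Space → Spinor}
    (hW : AEStronglyMeasurable W) (hφ : AEStronglyMeasurable φ)
    (h : Integrable fun x => ‖W x‖ * ‖φ x‖ ^ 2) : InFormDomain W φ :=
  ⟨h.mono' (hφ.inner (aestronglyMeasurable_act hW hφ)) (ae_of_all _ fun x => by
    rw [sq]; exact norm_inner_act_le _ _ _), h⟩

lemma norm_potForm_le {W : Space → Mat} {φ : Space → Spinor} (h : InFormDomain W φ) :
    ‖potForm W φ‖ ≤ ∫ x, ‖W x‖ * ‖φ x‖ ^ 2 :=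
  norm_integral_le_of_norm_le h.2 (ae_of_all _ fun x => by
    rw [sq]; exact norm_inner_act_le _ _ _)

/-- The form version of `relative_bound_zero`. -/
lemma relative_form_bound_zero {A : Space → Space} (hA : LpLoc 2 A) {W : Space → Mat}
    (hW : LpLoc 3 W) (hb : BoundedOutsideCompact W) {ε : ℝ} (hε : 0 < ε) :
    ∃ C : ℝ, 0 ≤ C ∧ ∀ (φ : Space → Spinor) (η : Fin 3 → Space → Spinor),
      IsMagneticGradient A φ η → InFormDomain W φ ∧
      ∫ x, ‖W x‖ * ‖φ x‖ ^ 2 ≤ ε * gradNormSq η + C * normSq φ := by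
  obtain ⟨C, hC0, hC⟩ := relative_bound_zero hA hW hb hε
  refine ⟨C + 1, by positivity, fun φ η h => ?_⟩
  obtain ⟨hm, hle⟩ := hC φ η h
  have hWm : AEStronglyMeasurable W := (hW.locallyIntegrable (by norm_num)).aestronglyMeasurable
  have hptw : ∀ x, ‖W x‖ * ‖φ x‖ ^ 2 ≤ ‖‖W x‖ • φ x‖ ^ 2 + ‖φ x‖ ^ 2 := fun x => by
    rw [norm_smul, norm_norm]
    nlinarith [sq_nonneg (‖W x‖ * ‖φ x‖ - ‖φ x‖ / 2), sq_nonneg (‖φ x‖)]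
  have hi := hm.integrable_normSq.add h.memLp.integrable_normSq
  have hint : Integrable fun x => ‖W x‖ * ‖φ x‖ ^ 2 := by
    refine hi.mono' (hWm.norm.mul (h.memLp.1.norm.pow 2)) (ae_of_all _ fun x => ?_)
    rw [Real.norm_of_nonneg (by positivity)]
    exact hptw x
  refine ⟨inFormDomain_of_integrable hWm h.memLp.1 hint, (integral_mono hint hi hptw).trans ?_⟩
  simp only [Pi.add_apply]
  rw [integral_add hm.integrable_normSq h.memLp.integrable_normSq]
  have : normSq (fun x => ‖W x‖ • φ x) + normSq φ ≤ ε * gradNormSq η + (C + 1) * normSq φ := by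
    linarith
  exact this

/-! ### The Poincare gauge -/

lemma integrableOn_norm_rpow_neg {q : ℝ} (hq : q < 3) (R : ℝ) :
    IntegrableOn (fun x : Space => ‖x‖ ^ (-q)) (Metric.ball 0 R) volume := by
  rw [integrableOn_fun_norm_addHaar (μ := (volume : Measure Space)) (f := fun y => y ^ (-q))]
  rw [finrank_euclideanSpace_fin]
  have h : IntervalIntegrable (fun x : ℝ => x ^ (2 - q)) volume 0 (max R 0) :=
    intervalIntegral.intervalIntegrable_rpow' (by linarith)
  rw [intervalIntegrable_iff_integrableOn_Ioo_of_le (le_max_right _ _)] at h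
  refine (h.mono_set (Set.Ioo_subset_Ioo_right (le_max_left _ _))).congr_fun (fun y hy => ?_)
    measurableSet_Ioo
  simp only [smul_eq_mul]
  rw [← Real.rpow_natCast y (3 - 1), ← Real.rpow_add hy.1]
  norm_num
  ring_nf

/-- A field in `L^p_loc` with `p > 3` has a finite singular integral at the origin. -/
lemma exists_integrableOn_rpow_mul_norm_sq {p : ℝ≥0∞} (hp : 3 < p) {b : Space → Space}
    (hb : LpLoc p b) :
    ∃ δ : ℝ, 0 < δ ∧ δ < 1 ∧ ∀ R : ℝ,
      IntegrableOn (fun x => ‖x‖ ^ (-(1 + δ)) * ‖b x‖ ^ 2) (Metric.ball 0 R) volume := by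
  -- A finite exponent strictly above 3 is chosen, since `p` may be infinite.
  obtain ⟨s, hs3, hsp⟩ := ENNReal.lt_iff_exists_nnreal_btwn.1 hp
  have hs : (3 : ℝ) < s := by
    have : (3 : NNReal) < s := by exact_mod_cast hs3
    exact_mod_cast this
  have hs0 : (0 : ℝ) < s := by linarith
  have hs2 : (0 : ℝ) < s - 2 := by linarith
  have hbm : AEStronglyMeasurable b := by
    refine (hb.locallyIntegrable (le_trans ?_ hp.le)).aestronglyMeasurable
    norm_num
  -- Young's inequality with exponents `s/2` and `s/(s-2)` turns the weight `|x|^{-(1+δ)}` into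
  -- `|x|^{-(2s-3)/(s-2)}`. This power is locally integrable in dimension three exactly because `s >
  -- 3`.
  refine ⟨1 - 3 / s, ?_, ?_, fun R => ?_⟩
  · rw [sub_pos, div_lt_one hs0]; exact hs
  · have : (0 : ℝ) < 3 / s := by positivity
    linarith
  have hbs : IntegrableOn (fun x => ‖b x‖ ^ (s : ℝ)) (Metric.ball 0 R) volume := by
    have h1 := (hb.mono hsp.le) (Metric.closedBall 0 R) (isCompact_closedBall _ _)
    have h2 : IntegrableOn (fun x => ‖b x‖ ^ (s : ℝ)) (Metric.closedBall 0 R) volume := by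
      have := h1.integrable_norm_rpow (by
        simp only [ne_eq, ENNReal.coe_eq_zero]; rintro rfl; simp at hs0) (by simp)
      simpa [IntegrableOn] using this
    exact h2.mono_set Metric.ball_subset_closedBall
  have hxq := integrableOn_norm_rpow_neg (q := (2 * s - 3) / (s - 2))
    (by rw [div_lt_iff₀ hs2]; linarith) R
  refine (hbs.add hxq).mono' ?_ (ae_of_all _ fun x => ?_)
  · exact ((measurable_norm.pow_const _).aestronglyMeasurable.mul (hbm.norm.pow 2)).restrict
  · rw [Real.norm_of_nonneg (by positivity)]
    have hconj : (s / 2 : ℝ).HolderConjugate (s / (s - 2)) := by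
      rw [Real.holderConjugate_iff]
      refine ⟨by linarith, ?_⟩
      field_simp
      ring
    have hy := Real.young_inequality_of_nonneg (a := ‖b x‖ ^ 2) (b := ‖x‖ ^ (-(1 + (1 - 3 / (s : ℝ)))))
      (by positivity) (by positivity) hconj
    have e1 : (‖b x‖ ^ 2) ^ (s / 2 : ℝ) = ‖b x‖ ^ (s : ℝ) := by
      rw [← Real.rpow_natCast, ← Real.rpow_mul (norm_nonneg _)]
      congr 1
      push_cast
      ring
    have e2 : (‖x‖ ^ (-(1 + (1 - 3 / (s : ℝ))))) ^ (s / (s - 2) : ℝ)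
        = ‖x‖ ^ (-((2 * s - 3) / (s - 2)) : ℝ) := by
      rw [← Real.rpow_mul (norm_nonneg _)]
      congr 1
      field_simp
      ring
    rw [e1, e2] at hy
    rw [mul_comm]
    refine hy.trans (add_le_add ?_ ?_)
    · exact div_le_self (by positivity) (by linarith)
    · exact div_le_self (by positivity) (by rw [le_div_iff₀ hs2]; linarith)

/-- The logarithm is bounded by the power `δ/2` divided by `δ/2`, so its square costs only `r^{-δ}`.
At `r = 0` the left side vanishes because `0⁻¹ = 0`. -/
lemma sq_max_log_le {δ : ℝ} (hδ : 0 < δ) {R r : ℝ} (hR : 0 < R) (hr : 0 ≤ r) :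
    r⁻¹ * (max (Real.log (R / r)) 0) ^ 2 ≤ (2 / δ) ^ 2 * R ^ δ * r ^ (-(1 + δ)) := by
  rcases hr.eq_or_lt with rfl | hr
  · simp only [inv_zero, zero_mul]
    positivity
  have h0 : 0 < R / r := by positivity
  have h1 : max (Real.log (R / r)) 0 ≤ (R / r) ^ (δ / 2) / (δ / 2) :=
    max_le (Real.log_le_rpow_div h0.le (by positivity)) (by positivity)
  have h2 : (max (Real.log (R / r)) 0) ^ 2 ≤ ((R / r) ^ (δ / 2) / (δ / 2)) ^ 2 :=
    pow_le_pow_left₀ (le_max_right _ _) h1 2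
  have e1 : ((R / r) ^ (δ / 2)) ^ 2 = R ^ δ * r ^ (-δ) := by
    rw [← Real.rpow_natCast, ← Real.rpow_mul h0.le, Real.div_rpow hR.le hr.le,
      Real.rpow_neg hr.le]
    push_cast
    rw [div_mul_cancel₀ _ (by norm_num), div_eq_mul_inv]
  have e2 : r ^ (-(1 + δ)) = r⁻¹ * r ^ (-δ) := by
    rw [neg_add, Real.rpow_add hr, Real.rpow_neg_one]
  calc r⁻¹ * (max (Real.log (R / r)) 0) ^ 2
      ≤ r⁻¹ * ((R / r) ^ (δ / 2) / (δ / 2)) ^ 2 := by gcongr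
    _ = _ := by
      rw [div_pow, e1, e2]
      field_simp

lemma logIntegrableAt_zero {p : ℝ≥0∞} (hp : 3 < p) {B : Space → Space}
    (hB : LpLoc p (tilde 0 B)) : LogIntegrableAt 0 B := by
  obtain ⟨δ, hδ, -, hint⟩ := exists_integrableOn_rpow_mul_norm_sq hp hB
  have hbm : AEStronglyMeasurable (tilde 0 B) :=
    (hB.locallyIntegrable (le_trans (by norm_num) hp.le)).aestronglyMeasurable
  intro R hR
  rw [locallyIntegrable_iff]
  intro K hK
  obtain ⟨r, hr⟩ := hK.isBounded.subset_ball (0 : Space)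
  refine IntegrableOn.mono_set ?_ hr
  refine ((hint r).const_mul ((2 / δ) ^ 2 * R ^ δ)).mono' ?_ (ae_of_all _ fun x => ?_)
  · simp only [sub_zero]
    have h1 : Measurable fun x : Space => ‖x‖⁻¹ * (max (Real.log (R / ‖x‖)) 0) ^ 2 := by
      fun_prop
    exact (h1.aestronglyMeasurable.mul (hbm.norm.pow 2)).restrict
  · simp only [sub_zero]
    rw [Real.norm_of_nonneg (by positivity), ← mul_assoc]
    exact mul_le_mul_of_nonneg_right (sq_max_log_le hδ hR (norm_nonneg x)) (by positivity)

/-! ### Dilations and square integrability of the Poincaré potential -/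

lemma lintegral_comp_smul_space {t : ℝ} (ht : 0 < t) (f : Space → ℝ≥0∞) :
    ∫⁻ x, f (t • x) = ENNReal.ofReal (t ^ (-3 : ℝ)) * ∫⁻ x, f x := by
  have h1 := (Homeomorph.smulOfNeZero t ht.ne' (α := Space)).measurableEmbedding.lintegral_map
    (μ := volume) f
  have h2 : Measure.map (Homeomorph.smulOfNeZero t ht.ne' (α := Space)) volume
      = ENNReal.ofReal (abs (t ^ Module.finrank ℝ Space)⁻¹) • (volume : Measure Space) :=
    Measure.map_addHaar_smul volume ht.ne'
  rw [h2, lintegral_smul_measure, finrank_euclideanSpace_fin,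
    abs_of_nonneg (by positivity)] at h1
  have e : t ^ (-3 : ℝ) = (t ^ 3)⁻¹ := by
    rw [Real.rpow_neg ht.le, ← Real.rpow_natCast t 3]
    norm_num
  rw [e]
  exact h1.symm

/-- Each dilation with `t > 0` preserves null sets, and Fubini's theorem does the rest. This yields
joint measurability of `b (t • x)` for a field that is only almost everywhere strongly measurable.
-/
lemma quasiMeasurePreserving_smul_unitInterval :
    Measure.QuasiMeasurePreserving (fun q : ℝ × Space => q.1 • q.2)
      ((volume.restrict (Set.Ioc (0 : ℝ) 1)).prod volume) volume := by
  have hm : Measurable fun q : ℝ × Space => q.1 • q.2 := measurable_fst.smul measurable_snd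
  refine ⟨hm, Measure.AbsolutelyContinuous.mk fun s hs h0 => ?_⟩
  rw [Measure.map_apply hm hs, Measure.measure_prod_null (hm hs)]
  filter_upwards [ae_restrict_mem measurableSet_Ioc] with t ht
  have : Prod.mk t ⁻¹' ((fun q : ℝ × Space => q.1 • q.2) ⁻¹' s) = (fun x => t • x) ⁻¹' s := rfl
  rw [this]
  exact (Measure.addHaar_preimage_smul volume ht.1.ne' s).trans (by rw [h0, mul_zero]; rfl)

lemma aestronglyMeasurable_dilations {b : Space → Space} (hb : AEStronglyMeasurable b) :
    AEStronglyMeasurable (fun q : Space × ℝ => b (q.2 • q.1))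
      (volume.prod (volume.restrict (Set.Ioc (0 : ℝ) 1))) :=
  (hb.comp_quasiMeasurePreserving quasiMeasurePreserving_smul_unitInterval).prod_swap

/-- For `|x| < R` the weight `(tR)^{1+δ} |tx|^{-(1+δ)}` is at least one, so it may be inserted. The
substitution `y = tx` contributes `t^{-3}`, which leaves `t^{-2+δ}`. -/
lemma lintegral_ball_norm_sq_le {δ : ℝ} (hδ : 0 < δ) (b : Space → Space) {R t : ℝ}
    (hR : 0 < R) (ht : t ∈ Set.Ioc (0 : ℝ) 1) :
    ∫⁻ x in Metric.ball 0 R, ENNReal.ofReal (‖b (t • x)‖ ^ 2) ≤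
      ENNReal.ofReal (t ^ (-2 + δ)) * (ENNReal.ofReal (R ^ (1 + δ)) *
        ∫⁻ y in Metric.ball 0 R, ENNReal.ofReal (‖y‖ ^ (-(1 + δ)) * ‖b y‖ ^ 2)) := by
  rw [← lintegral_indicator measurableSet_ball, ← lintegral_indicator measurableSet_ball]
  have h1 : ∀ᵐ x : Space, (Metric.ball 0 R).indicator (fun x => ENNReal.ofReal (‖b (t • x)‖ ^ 2)) x
      ≤ ENNReal.ofReal ((t * R) ^ (1 + δ)) * (Metric.ball 0 R).indicator
        (fun y => ENNReal.ofReal (‖y‖ ^ (-(1 + δ)) * ‖b y‖ ^ 2)) (t • x) := by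
    have h0 : ∀ᵐ x : Space, x ≠ 0 := by
      simp [ae_iff]
    filter_upwards [h0] with x hx0
    by_cases hx : x ∈ Metric.ball (0 : Space) R
    · have hxR : ‖x‖ < R := mem_ball_zero_iff.1 hx
      have htx : ‖t • x‖ < t * R := by
        rw [norm_smul, Real.norm_of_nonneg ht.1.le]
        exact mul_lt_mul_of_pos_left hxR ht.1
      have htx' : t • x ∈ Metric.ball (0 : Space) R := mem_ball_zero_iff.2
        (htx.trans_le (mul_le_of_le_one_left hR.le ht.2))
      have hpos : 0 < ‖t • x‖ := norm_pos_iff.2 (smul_ne_zero ht.1.ne' hx0)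
      rw [Set.indicator_of_mem hx, Set.indicator_of_mem htx',
        ← ENNReal.ofReal_mul (Real.rpow_nonneg (mul_nonneg ht.1.le hR.le) _), ← mul_assoc]
      refine ENNReal.ofReal_le_ofReal (le_mul_of_one_le_left (by positivity) ?_)
      rw [Real.rpow_neg hpos.le, ← div_eq_mul_inv, one_le_div (by positivity)]
      gcongr
    · rw [Set.indicator_of_notMem hx]
      exact zero_le
  refine (lintegral_mono_ae h1).trans ?_
  rw [lintegral_const_mul' _ _ ENNReal.ofReal_ne_top,
    lintegral_comp_smul_space ht.1 ((Metric.ball 0 R).indicator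
        (fun y => ENNReal.ofReal (‖y‖ ^ (-(1 + δ)) * ‖b y‖ ^ 2))), ← mul_assoc, ← mul_assoc]
  refine mul_le_mul_left (le_of_eq ?_) _
  rw [← ENNReal.ofReal_mul (Real.rpow_nonneg (mul_nonneg ht.1.le hR.le) _),
    ← ENNReal.ofReal_mul (Real.rpow_nonneg ht.1.le _), Real.mul_rpow ht.1.le hR.le]
  congr 1
  rw [mul_right_comm, ← Real.rpow_add ht.1]
  ring_nf

lemma lintegral_Ioc_rpow_lt_top {r : ℝ} (hr : -1 < r) :
    ∫⁻ t in Set.Ioc (0 : ℝ) 1, ENNReal.ofReal (t ^ r) < ⊤ := by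
  have h : IntervalIntegrable (fun x : ℝ => x ^ r) volume 0 1 :=
    intervalIntegral.intervalIntegrable_rpow' hr
  rw [intervalIntegrable_iff_integrableOn_Ioc_of_le zero_le_one] at h
  exact (lintegral_ofReal_le_lintegral_enorm _).trans_lt h.2

/-- The integral over rays of a field in `L^p_loc`, `p > 3`, is in `L²_loc`. -/
lemma lintegral_ball_rayIntegral_lt_top {p : ℝ≥0∞} (hp : 3 < p) {b : Space → Space}
    (hb : LpLoc p b) {R : ℝ} (hR : 0 < R) :
    ∫⁻ x in Metric.ball 0 R, (∫⁻ t in Set.Ioc (0 : ℝ) 1, ‖b (t • x)‖ₑ) ^ 2 < ⊤ := by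
  obtain ⟨δ, hδ, hδ1, hint⟩ := exists_integrableOn_rpow_mul_norm_sq hp hb
  have hbm : AEStronglyMeasurable b :=
    (hb.locallyIntegrable (le_trans (by norm_num) hp.le)).aestronglyMeasurable
  -- Cauchy-Schwarz along the ray with the weights `t^{-c/2}` and `t^{c/2}` needs both `t^{-c}` and
  -- `t^{c-2+δ}` to be integrable on `(0, 1]`; with this `c` each exponent equals `-1 + δ/2`.
  set c : ℝ := 1 - δ / 2 with hc
  set I₁ := ∫⁻ t in Set.Ioc (0 : ℝ) 1, ENNReal.ofReal (t ^ (-c)) with hI₁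
  have hI₁t : I₁ < ⊤ := lintegral_Ioc_rpow_lt_top (by rw [hc]; linarith)
  have hjm := aestronglyMeasurable_dilations hbm
  have cs : ∀ᵐ x : Space, (∫⁻ t in Set.Ioc (0 : ℝ) 1, ‖b (t • x)‖ₑ) ^ 2 ≤
      I₁ * ∫⁻ t in Set.Ioc (0 : ℝ) 1, ENNReal.ofReal (t ^ c) * ENNReal.ofReal (‖b (t • x)‖ ^ 2) := by
    filter_upwards [hjm.prodMk_left] with x hx
    have hm1 : AEMeasurable (fun t : ℝ => ENNReal.ofReal (t ^ (-c / 2)))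
        (volume.restrict (Set.Ioc (0 : ℝ) 1)) :=
      ((measurable_id.pow_const (-c / 2)).ennreal_ofReal).aemeasurable
    have hm2 : AEMeasurable (fun t : ℝ => ENNReal.ofReal (t ^ (c / 2)) * ‖b (t • x)‖ₑ)
        (volume.restrict (Set.Ioc (0 : ℝ) 1)) :=
      ((measurable_id.pow_const (c / 2)).ennreal_ofReal).aemeasurable.mul hx.enorm
    have h1 := ENNReal.lintegral_mul_le_Lp_mul_Lq _ Real.HolderConjugate.two_two hm1 hm2
    have e0 : ∫⁻ t in Set.Ioc (0 : ℝ) 1, ‖b (t • x)‖ₑ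
        = ∫⁻ t in Set.Ioc (0 : ℝ) 1, ((fun t : ℝ => ENNReal.ofReal (t ^ (-c / 2))) *
          fun t => ENNReal.ofReal (t ^ (c / 2)) * ‖b (t • x)‖ₑ) t := by
      refine setLIntegral_congr_fun measurableSet_Ioc fun t ht => ?_
      simp only [Pi.mul_apply]
      rw [← mul_assoc, ← ENNReal.ofReal_mul (Real.rpow_nonneg ht.1.le _), ← Real.rpow_add ht.1]
      ring_nf
      simp
    have e1 : ∫⁻ t in Set.Ioc (0 : ℝ) 1, ENNReal.ofReal (t ^ (-c / 2)) ^ (2 : ℝ) = I₁ := by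
      refine setLIntegral_congr_fun measurableSet_Ioc fun t ht => ?_
      rw [ENNReal.ofReal_rpow_of_nonneg (Real.rpow_nonneg ht.1.le _) (by norm_num),
        ← Real.rpow_mul ht.1.le]
      ring_nf
    have e2 : ∫⁻ t in Set.Ioc (0 : ℝ) 1, (ENNReal.ofReal (t ^ (c / 2)) * ‖b (t • x)‖ₑ) ^ (2 : ℝ)
        = ∫⁻ t in Set.Ioc (0 : ℝ) 1,
          ENNReal.ofReal (t ^ c) * ENNReal.ofReal (‖b (t • x)‖ ^ 2) := by
      refine setLIntegral_congr_fun measurableSet_Ioc fun t ht => ?_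
      rw [ENNReal.mul_rpow_of_nonneg _ _ (by norm_num),
        ENNReal.ofReal_rpow_of_nonneg (Real.rpow_nonneg ht.1.le _) (by norm_num),
        ← Real.rpow_mul ht.1.le, ← ofReal_norm,
        ENNReal.ofReal_rpow_of_nonneg (norm_nonneg _) (by norm_num), Real.rpow_two]
      ring_nf
    rw [← e0, e1, e2] at h1
    refine (pow_le_pow_left₀ zero_le h1 2).trans (le_of_eq ?_)
    rw [mul_pow, ← ENNReal.rpow_two, ← ENNReal.rpow_two, ← ENNReal.rpow_mul, ← ENNReal.rpow_mul]
    norm_num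
  refine (lintegral_mono_ae (ae_restrict_of_ae cs)).trans_lt ?_
  rw [lintegral_const_mul' _ _ hI₁t.ne]
  refine ENNReal.mul_lt_top hI₁t ?_
  have hmeas : AEMeasurable (Function.uncurry fun (x : Space) (t : ℝ) =>
      ENNReal.ofReal (t ^ c) * ENNReal.ofReal (‖b (t • x)‖ ^ 2))
      ((volume.restrict (Metric.ball 0 R)).prod (volume.restrict (Set.Ioc (0 : ℝ) 1))) := by
    have h1 : AEStronglyMeasurable (fun q : Space × ℝ => b (q.2 • q.1))
        ((volume.restrict (Metric.ball 0 R)).prod (volume.restrict (Set.Ioc (0 : ℝ) 1))) := by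
      refine hjm.mono_ac (Measure.AbsolutelyContinuous.prod ?_ ?_)
      · exact Measure.absolutelyContinuous_of_le Measure.restrict_le_self
      · exact Measure.AbsolutelyContinuous.rfl
    exact (measurable_snd.pow_const c).ennreal_ofReal.aemeasurable.mul
      (h1.norm.aemeasurable.pow_const 2).ennreal_ofReal
  rw [lintegral_lintegral_swap hmeas]
  set J := ∫⁻ y in Metric.ball 0 R, ENNReal.ofReal (‖y‖ ^ (-(1 + δ)) * ‖b y‖ ^ 2) with hJ
  have hJt : J < ⊤ := (lintegral_ofReal_le_lintegral_enorm _).trans_lt (hint R).2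
  have h2 : ∀ t ∈ Set.Ioc (0 : ℝ) 1, ∫⁻ x in Metric.ball 0 R,
      ENNReal.ofReal (t ^ c) * ENNReal.ofReal (‖b (t • x)‖ ^ 2)
      ≤ ENNReal.ofReal (t ^ (-1 + δ / 2)) * (ENNReal.ofReal (R ^ (1 + δ)) * J) := fun t ht => by
    rw [lintegral_const_mul' _ _ ENNReal.ofReal_ne_top]
    refine (mul_le_mul_right (lintegral_ball_norm_sq_le hδ b hR ht) _).trans (le_of_eq ?_)
    rw [← mul_assoc, ← ENNReal.ofReal_mul (Real.rpow_nonneg ht.1.le _), ← Real.rpow_add ht.1,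
      show c + (-2 + δ) = -1 + δ / 2 by rw [hc]; ring]
  refine (setLIntegral_mono' measurableSet_Ioc h2).trans_lt ?_
  rw [lintegral_mul_const' _ _ (ENNReal.mul_lt_top ENNReal.ofReal_lt_top hJt).ne]
  exact ENNReal.mul_lt_top (lintegral_Ioc_rpow_lt_top (by linarith))
    (ENNReal.mul_lt_top ENNReal.ofReal_lt_top hJt)

lemma ae_intervalIntegrable_tilde {p : ℝ≥0∞} (hp : 3 < p) {B : Space → Space}
    (hB : LpLoc p (tilde 0 B)) :
    ∀ᵐ x : Space, IntervalIntegrable (fun t : ℝ => tilde 0 B (t • x)) volume 0 1 := by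
  have hbm : AEStronglyMeasurable (tilde 0 B) :=
    (hB.locallyIntegrable (le_trans (by norm_num) hp.le)).aestronglyMeasurable
  have hjm := aestronglyMeasurable_dilations hbm
  have hfin : ∀ n : ℕ, ∀ᵐ x : Space, x ∈ Metric.ball (0 : Space) (n + 1) →
      (∫⁻ t in Set.Ioc (0 : ℝ) 1, ‖tilde 0 B (t • x)‖ₑ) ^ 2 < ⊤ := fun n => by
    rw [← ae_restrict_iff' measurableSet_ball]
    refine ae_lt_top' ?_ (lintegral_ball_rayIntegral_lt_top hp hB (by positivity)).ne
    exact (AEMeasurable.lintegral_prod_right' hjm.enorm).restrict.pow_const 2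
  filter_upwards [ae_all_iff.2 hfin, hjm.prodMk_left] with x hx1 hx2
  rw [intervalIntegrable_iff_integrableOn_Ioc_of_le zero_le_one]
  refine ⟨hx2, ?_⟩
  obtain ⟨n, hn⟩ := exists_nat_gt ‖x‖
  have := hx1 n (mem_ball_zero_iff.2 (hn.trans (by linarith)))
  exact lt_top_iff_ne_top.2 fun h => by
    simp [h] at this

lemma lpLoc_two_poincareGauge {p : ℝ≥0∞} (hp : 3 < p) {B : Space → Space}
    (hB : LpLoc p (tilde 0 B)) : LpLoc 2 (poincareGauge B) := by
  have hbm : AEStronglyMeasurable (tilde 0 B) :=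
    (hB.locallyIntegrable (le_trans (by norm_num) hp.le)).aestronglyMeasurable
  have hjm := aestronglyMeasurable_dilations hbm
  have hA : poincareGauge B = fun x => ∫ t in Set.Ioc (0 : ℝ) 1, tilde 0 B (t • x) := by
    funext x
    rw [poincareGauge, intervalIntegral.integral_of_le zero_le_one]
  have hAm : AEStronglyMeasurable (poincareGauge B) := by
    rw [hA]
    exact hjm.integral_prod_right'
  intro K hK
  obtain ⟨r, hr⟩ := hK.isBounded.subset_ball (0 : Space)
  have hr' : K ⊆ Metric.ball 0 (max r 1) :=
    hr.trans (Metric.ball_subset_ball (le_max_left _ _))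
  refine MemLp.mono_measure (Measure.restrict_mono_set _ hr') ⟨hAm.restrict, ?_⟩
  rw [eLpNorm_lt_top_iff_lintegral_rpow_enorm_lt_top (by norm_num) (by norm_num)]
  refine lt_of_le_of_lt (lintegral_mono fun x => ?_)
    (lintegral_ball_rayIntegral_lt_top hp hB (R := max r 1) (by positivity))
  rw [ENNReal.toReal_ofNat, ENNReal.rpow_two, hA]
  exact pow_le_pow_left₀ zero_le (enorm_integral_le_lintegral_enorm _) 2

/-! ### Behaviour at infinity -/

lemma ae_le_essSup_outside (f : Space → ℝ≥0∞) (r : ℝ) :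
    ∀ᵐ x : Space, r ≤ ‖x‖ → f x ≤ essSup f (volume.restrict {x : Space | r ≤ ‖x‖}) := by
  have hm : MeasurableSet {x : Space | r ≤ ‖x‖} := measurableSet_le measurable_const measurable_norm
  exact (ae_restrict_iff' hm).1 (ENNReal.ae_le_essSup f)

lemma essSup_outside_le {f : Space → ℝ≥0∞} {r : ℝ} {c : ℝ≥0∞}
    (h : ∀ᵐ x : Space, r ≤ ‖x‖ → f x ≤ c) :
    essSup f (volume.restrict {x : Space | r ≤ ‖x‖}) ≤ c := by
  have hm : MeasurableSet {x : Space | r ≤ ‖x‖} := measurableSet_le measurable_const measurable_norm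
  exact essSup_le_of_ae_le _ ((ae_restrict_iff' hm).2 h)

lemma antitone_essSup_outside (f : Space → ℝ≥0∞) :
    Antitone fun r : ℝ => essSup f (volume.restrict {x : Space | r ≤ ‖x‖}) := fun r s hrs =>
  essSup_outside_le <| by
    filter_upwards [ae_le_essSup_outside f r] with x hx hs
    exact hx (hrs.trans hs)

lemma tendsto_essSup_outside (f : Space → ℝ≥0∞) :
    Tendsto (fun r : ℝ => essSup f (volume.restrict {x : Space | r ≤ ‖x‖})) atTop
      (𝓝 (essLimsup f)) :=
  tendsto_atTop_iInf (antitone_essSup_outside f)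

/-- Positive nonincreasing upper bounds at infinity that converge to the limit superior. -/
lemma exists_antitone_bounds {f : Space → ℝ≥0∞} {r C : ℝ}
    (h : ∀ᵐ x : Space, r ≤ ‖x‖ → f x ≤ ENNReal.ofReal C) :
    ∃ w : ℕ → ℝ, (∀ j, 0 < w j) ∧ Antitone w ∧ Tendsto w atTop (𝓝 (essLimsup f).toReal) ∧
      ∀ j : ℕ, ∀ᵐ x : Space, r + j ≤ ‖x‖ → f x ≤ ENNReal.ofReal (w j) := by
  set S : ℝ → ℝ≥0∞ := fun s => essSup f (volume.restrict {x : Space | s ≤ ‖x‖}) with hS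
  have hSt : ∀ s, r ≤ s → S s ≠ ⊤ := fun s hs =>
    ((antitone_essSup_outside f hs).trans (essSup_outside_le h)).trans_lt
      ENNReal.ofReal_lt_top |>.ne
  have hj : ∀ j : ℕ, r ≤ r + j := fun j => by simp
  have hlim : essLimsup f ≠ ⊤ := ((iInf_le _ r).trans_lt (hSt r le_rfl).lt_top).ne
  -- The added `1 / (j + 1)` makes the bounds strictly positive and affects neither monotonicity nor
  -- the limit.
  refine ⟨fun j => (S (r + j)).toReal + 1 / (j + 1), fun j => by positivity, fun i j hij => ?_, ?_,
    fun j => ?_⟩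
  · have h1 : (S (r + j)).toReal ≤ (S (r + i)).toReal :=
      ENNReal.toReal_mono (hSt _ (hj i)) (antitone_essSup_outside f (by gcongr))
    have h2 : 1 / ((j : ℝ) + 1) ≤ 1 / ((i : ℝ) + 1) := by gcongr
    exact add_le_add h1 h2
  · have h1 : Tendsto (fun j : ℕ => S (r + j)) atTop (𝓝 (essLimsup f)) :=
      (tendsto_essSup_outside f).comp (tendsto_atTop_add_const_left _ _ tendsto_natCast_atTop_atTop)
    have := ((ENNReal.tendsto_toReal hlim).comp h1).add
      (tendsto_one_div_add_atTop_nhds_zero_nat (𝕜 := ℝ))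
    simpa using this
  · filter_upwards [ae_le_essSup_outside f (r + j)] with x hx hxj
    refine (hx hxj).trans ?_
    rw [ENNReal.ofReal_add ENNReal.toReal_nonneg (by positivity), ENNReal.ofReal_toReal (hSt _ (hj j))]
    exact le_self_add

/-! ### Potentials acting on spinors supported outside large balls -/

lemma inFormDomain_of_bounded {W : Space → Mat} (hW : AEStronglyMeasurable W) {R C : ℝ}
    (hb : ∀ᵐ x : Space, R ≤ ‖x‖ → ‖W x‖ ≤ C) {φ : Space → Spinor} (hφ : MemLp φ 2 volume)
    (hs : SupportedOutside R φ) : InFormDomain W φ := by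
  refine inFormDomain_of_integrable hW hφ.1 ((hφ.integrable_normSq.const_mul C).mono'
    (hW.norm.mul (hφ.1.norm.pow 2)) ?_)
  filter_upwards [hb, hs] with x hx1 hx2
  rw [Real.norm_of_nonneg (by positivity)]
  rcases le_or_gt R ‖x‖ with h | h
  · exact mul_le_mul_of_nonneg_right (hx1 h) (by positivity)
  · simp [hx2 h]

lemma re_potForm_le {W : Space → Mat} {φ : Space → Spinor} (h : InFormDomain W φ)
    (hφ : MemLp φ 2 volume) {R γ : ℝ} (hs : SupportedOutside R φ)
    (hb : ∀ᵐ x : Space, R ≤ ‖x‖ → ∀ v, (inner ℂ v (act (W x) v)).re ≤ γ * ‖v‖ ^ 2) :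
    (potForm W φ).re ≤ γ * normSq φ := by
  have e : (potForm W φ).re = ∫ x, (inner ℂ (φ x) (act (W x) (φ x))).re :=
    (Complex.reCLM.integral_comp_comm h.1).symm
  rw [e, normSq, ← integral_const_mul]
  refine integral_mono_ae (Complex.reCLM.integrable_comp h.1) (hφ.integrable_normSq.const_mul γ) ?_
  filter_upwards [hb, hs] with x hx1 hx2
  rcases le_or_gt R ‖x‖ with h | h
  · exact hx1 h _
  · simp [hx2 h]

lemma SupportedOutside.mono {R R' : ℝ} (h : R ≤ R') {φ : Space → Spinor}
    (hs : SupportedOutside R' φ) : SupportedOutside R φ := by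
  filter_upwards [hs] with x hx hxR
  exact hx (hxR.trans_le h)

lemma re_inner_act_le_norm (M : Mat) (v : Spinor) :
    (inner ℂ v (act M v)).re ≤ ‖M‖ * ‖v‖ ^ 2 := by
  rw [sq]
  exact (Complex.re_le_norm _).trans (norm_inner_act_le M v v)

/-- A pointwise bound on the support of `φ` makes the gradient term superfluous; its coefficient
`R⁻¹` is merely a positive function that tends to zero. -/
lemma posPartVanishesAtInfinity_of_le {A : Space → Space} {W : Space → Mat}
    (hW : AEStronglyMeasurable W) {R₀ C : ℝ} (hR₀ : 0 < R₀)
    (hC : ∀ᵐ x : Space, R₀ ≤ ‖x‖ → ‖W x‖ ≤ C) {γ : ℝ → ℝ} (hγ : ∀ R, R₀ ≤ R → 0 < γ R)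
    (hγt : Tendsto γ atTop (𝓝 0))
    (hb : ∀ R, R₀ ≤ R → ∀ᵐ x : Space, R ≤ ‖x‖ →
      ∀ v, (inner ℂ v (act (W x) v)).re ≤ γ R * ‖v‖ ^ 2) : PosPartVanishesAtInfinity A W := by
  refine ⟨R₀, hR₀, fun R => R⁻¹, γ, fun R hR => ⟨inv_pos.2 (hR₀.trans_le hR), hγ R hR⟩,
    tendsto_inv_atTop_zero, hγt, fun R hR φ η h hs => ?_⟩
  have hdom := inFormDomain_of_bounded hW hC h.memLp (hs.mono hR)
  have h1 : 0 ≤ R⁻¹ * gradNormSq η :=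
    mul_nonneg (inv_nonneg.2 (hR₀.trans_le hR).le) (gradNormSq_nonneg η)
  have h2 := mul_nonneg (hγ R hR).le (normSq_nonneg φ)
  exact ⟨hdom, max_le ((re_potForm_le hdom h.memLp hs (hb R hR)).trans (by linarith))
    (by linarith)⟩

lemma boundedAboveAtInfinity_of_bounded {A : Space → Space} {W : Space → Mat}
    (hW : AEStronglyMeasurable W) (hb : BoundedOutsideCompact W) : BoundedAboveAtInfinity A W := by
  obtain ⟨R, C, hC⟩ := hb
  have hC' : ∀ᵐ x : Space, max R 1 ≤ ‖x‖ → ‖W x‖ ≤ C := by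
    filter_upwards [hC] with x hx h
    exact hx ((le_max_left _ _).trans h)
  have hR₀ : 0 < max R 1 := by positivity
  refine ⟨max R 1, hR₀, fun φ ⟨η, h⟩ hs => inFormDomain_of_bounded hW hC' h.memLp hs,
    fun R => R⁻¹, fun _ => |C| + 1, fun S hS => ⟨inv_pos.2 (hR₀.trans_le hS), by positivity⟩,
    tendsto_inv_atTop_zero, ⟨|C| + 1, Frequently.of_forall fun _ => le_rfl⟩,
    fun S hS φ η h hs => ?_⟩
  have hdom := inFormDomain_of_bounded hW hC' h.memLp (hs.mono hS)
  refine (re_potForm_le (γ := |C| + 1) hdom h.memLp hs ?_).trans (le_add_of_nonneg_left ?_)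
  · filter_upwards [hC'] with x hx hxS v
    refine (re_inner_act_le_norm _ _).trans (mul_le_mul_of_nonneg_right ?_ (by positivity))
    exact (hx (hS.trans hxS)).trans ((le_abs_self C).trans (by linarith))
  · exact mul_nonneg (inv_nonneg.2 (hR₀.trans_le hS).le) (gradNormSq_nonneg η)

lemma BoundedOutsideCompact.neg {F : Type*} [NormedAddCommGroup F] {f : Space → F}
    (h : BoundedOutsideCompact f) : BoundedOutsideCompact (-f) := by
  obtain ⟨R, C, hC⟩ := h
  exact ⟨R, C, by simpa using hC⟩

lemma BoundedOutsideCompact.sub {F : Type*} [NormedAddCommGroup F] {f g : Space → F}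
    (hf : BoundedOutsideCompact f) (hg : BoundedOutsideCompact g) :
    BoundedOutsideCompact (f - g) := by
  obtain ⟨R, C, hC⟩ := hf
  obtain ⟨R', C', hC'⟩ := hg
  refine ⟨max R R', C + C', ?_⟩
  filter_upwards [hC, hC'] with x h1 h2 hx
  exact (norm_sub_le _ _).trans
    (add_le_add (h1 ((le_max_left _ _).trans hx)) (h2 ((le_max_right _ _).trans hx)))

/-- A function `W` such that `|x| |W|` is bounded outside of a compact set decays. -/
lemma exists_norm_le_div {W : Space → Mat} (h : BoundedOutsideCompact fun x => ‖x‖ • W x) :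
    ∃ R C : ℝ, 0 < R ∧ 0 < C ∧ ∀ S, R ≤ S → ∀ᵐ x : Space, S ≤ ‖x‖ → ‖W x‖ ≤ C / S := by
  obtain ⟨R, C, hC⟩ := h
  have hR : 0 < max R 1 := by positivity
  refine ⟨max R 1, |C| + 1, hR, by positivity, fun S hS => ?_⟩
  filter_upwards [hC] with x hx hxS
  have h1 := hx ((le_max_left _ _).trans (hS.trans hxS))
  rw [norm_smul, norm_norm] at h1
  rw [le_div_iff₀ (hR.trans_le hS)]
  have h2 : ‖W x‖ * S ≤ ‖x‖ * ‖W x‖ := by rw [mul_comm]; gcongr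
  exact h2.trans (h1.trans ((le_abs_self C).trans (by linarith)))

lemma boundedOutsideCompact_of_norm_smul {W : Space → Mat}
    (h : BoundedOutsideCompact fun x => ‖x‖ • W x) : BoundedOutsideCompact W := by
  obtain ⟨R, C, -, -, hC⟩ := exists_norm_le_div h
  exact ⟨R, C / R, hC R le_rfl⟩

/-- The form of `V` is bounded by the essential supremum of `|V₊|` outside the ball, that of `V^s`
by the decay `C₁ / R`, and that of `V^ℓ = V - V^s` by the sum of both. For `V` itself, `R⁻¹` is
added to keep the coefficient positive. -/
lemma posPartVanishesAtInfinity_components {A : Space → Space} {Vs Vl : Space → Mat}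
    (hVs_herm : ∀ x, (Vs x).IsHermitian) (hVl_herm : ∀ x, (Vl x).IsHermitian)
    (hVsm : AEStronglyMeasurable Vs) (hVlm : AEStronglyMeasurable Vl)
    (hV_bdd : BoundedOutsideCompact (Vs + Vl))
    (hVs_bdd : BoundedOutsideCompact fun x => ‖x‖ • Vs x)
    (hV_pos : essLimsup (fun x => ENNReal.ofReal (posPartNorm ((Vs + Vl) x))) = 0) :
    PosPartVanishesAtInfinity A (Vs + Vl) ∧ PosPartVanishesAtInfinity A Vs ∧
      PosPartVanishesAtInfinity A Vl := by
  obtain ⟨R₁, C₁, hR₁, hC₁, hVs⟩ := exists_norm_le_div hVs_bdd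
  obtain ⟨R₂, C₂, hV⟩ := hV_bdd
  set R₀ := max R₁ R₂ with hR₀
  have hR₀p : 0 < R₀ := hR₁.trans_le (le_max_left _ _)
  have hVs0 : ∀ᵐ x : Space, R₀ ≤ ‖x‖ → ‖Vs x‖ ≤ C₁ / R₀ := hVs R₀ (le_max_left _ _)
  have hV0 : ∀ᵐ x : Space, R₀ ≤ ‖x‖ → ‖(Vs + Vl) x‖ ≤ C₂ := by
    filter_upwards [hV] with x hx h
    exact hx ((le_max_right _ _).trans h)
  have hVl0 : ∀ᵐ x : Space, R₀ ≤ ‖x‖ → ‖Vl x‖ ≤ C₂ + C₁ / R₀ := by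
    filter_upwards [hVs0, hV0] with x h1 h2 hx
    have : Vl x = (Vs + Vl) x - Vs x := by simp
    rw [this]
    exact (norm_sub_le _ _).trans (add_le_add (h2 hx) (h1 hx))
  set f : Space → ℝ≥0∞ := fun x => ENNReal.ofReal (posPartNorm ((Vs + Vl) x)) with hf
  set S : ℝ → ℝ≥0∞ := fun s => essSup f (volume.restrict {x : Space | s ≤ ‖x‖}) with hS
  have hSt : ∀ s, R₀ ≤ s → S s ≠ ⊤ := fun s hs => by
    refine ((antitone_essSup_outside f hs).trans
      (essSup_outside_le (c := ENNReal.ofReal C₂) ?_)).trans_lt ENNReal.ofReal_lt_top |>.ne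
    filter_upwards [hV0] with x hx hxR
    exact ENNReal.ofReal_le_ofReal ((posPartNorm_le_norm _).trans (hx hxR))
  have tS : Tendsto (fun R => (S R).toReal) atTop (𝓝 0) := by
    have h1 := tendsto_essSup_outside f
    rw [hV_pos] at h1
    exact (ENNReal.tendsto_toReal ENNReal.zero_ne_top).comp h1
  have tinv : Tendsto (fun R : ℝ => R⁻¹) atTop (𝓝 0) := tendsto_inv_atTop_zero
  have tC : Tendsto (fun R : ℝ => C₁ / R) atTop (𝓝 0) := tendsto_const_nhds.div_atTop tendsto_id
  have bV : ∀ R, R₀ ≤ R → ∀ᵐ x : Space, R ≤ ‖x‖ →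
      ∀ v, (inner ℂ v (act ((Vs + Vl) x) v)).re ≤ (S R).toReal * ‖v‖ ^ 2 := fun R hR => by
    filter_upwards [ae_le_essSup_outside f R] with x hx hxR v
    refine (re_inner_act_le ((hVs_herm x).add (hVl_herm x)) v).trans
      (mul_le_mul_of_nonneg_right ?_ (by positivity))
    rw [← ENNReal.ofReal_le_iff_le_toReal (hSt R hR)]
    exact hx hxR
  have bVs : ∀ R, R₀ ≤ R → ∀ᵐ x : Space, R ≤ ‖x‖ → ‖Vs x‖ ≤ C₁ / R := fun R hR =>
    hVs R ((le_max_left _ _).trans hR)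
  refine ⟨posPartVanishesAtInfinity_of_le (hVsm.add hVlm) hR₀p hV0
      (γ := fun R => (S R).toReal + R⁻¹) (fun R hR => ?_) (by simpa using tS.add tinv)
      fun R hR => ?_,
    posPartVanishesAtInfinity_of_le hVsm hR₀p hVs0 (γ := fun R => C₁ / R) (fun R hR => ?_) tC
      fun R hR => ?_,
    posPartVanishesAtInfinity_of_le hVlm hR₀p hVl0 (γ := fun R => (S R).toReal + C₁ / R)
      (fun R hR => ?_) (by simpa using tS.add tC) fun R hR => ?_⟩
  · exact add_pos_of_nonneg_of_pos ENNReal.toReal_nonneg (inv_pos.2 (hR₀p.trans_le hR))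
  · filter_upwards [bV R hR] with x hx hxR v
    refine (hx hxR v).trans (mul_le_mul_of_nonneg_right (le_add_of_nonneg_right ?_) (by positivity))
    exact inv_nonneg.2 (hR₀p.trans_le hR).le
  · exact div_pos hC₁ (hR₀p.trans_le hR)
  · filter_upwards [bVs R hR] with x hx hxR v
    exact (re_inner_act_le_norm _ v).trans (mul_le_mul_of_nonneg_right (hx hxR) (by positivity))
  · exact add_pos_of_nonneg_of_pos ENNReal.toReal_nonneg (div_pos hC₁ (hR₀p.trans_le hR))
  · filter_upwards [bV R hR, bVs R hR] with x hx1 hx2 hxR v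
    have e : act (Vl x) v = act ((Vs + Vl) x) v + act (-Vs x) v := by
      rw [← add_act]
      congr 1
      simp
    have h3 := (re_inner_act_le_norm (-Vs x) v).trans
      (mul_le_mul_of_nonneg_right ((norm_neg (Vs x)).le.trans (hx2 hxR)) (by positivity))
    rw [e, inner_add_right, Complex.add_re, add_mul]
    exact add_le_add (hx1 hxR v) h3

/-! ### The distribution `x · ∇W` -/

lemma integrable_test_smul_on {E : Type*} [NormedAddCommGroup E] [NormedSpace ℝ E] {U : Set Space}
    {f : Space → ℝ} {g : Space → E} (hf : Continuous f) (hc : HasCompactSupport f)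
    (hU : tsupport f ⊆ U) (hg : LocallyIntegrableOn g U volume) :
    Integrable fun x => f x • g x := by
  have h1 : IntegrableOn (fun x => f x • g x) (tsupport f) :=
    (hg.integrableOn_compact_subset hU hc.isCompact).continuousOn_smul hf.continuousOn hc.isCompact
  refine (integrableOn_iff_integrable_of_support_subset fun x hx => subset_tsupport f ?_).1 h1
  exact fun h0 : f x = 0 => hx (by simp [h0])

/-- The entry of a matrix as a continuous linear map. -/
noncomputable def entryCLM (k l : Fin 2) : Mat →L[ℂ] ℂ :=
  LinearMap.toContinuousLinearMap (Matrix.entryLinearMap ℂ ℂ k l)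

lemma locallyIntegrableOn_entry {G : Space → Mat} {U : Set Space}
    (hG : LocallyIntegrableOn G U volume) (k l : Fin 2) :
    LocallyIntegrableOn (fun x => G x k l) U volume := fun x hx => by
  obtain ⟨s, hs, h⟩ := hG x hx
  exact ⟨s, hs, (entryCLM k l).integrable_comp h⟩

/-- The radial derivative `div (x f) = 3 f + x · ∇f`. -/
noncomputable def radialDiv {E : Type*} [NormedAddCommGroup E] [NormedSpace ℝ E] (f : Space → E)
    (x : Space) : E := (3 : ℝ) • f x + fderiv ℝ f x x

lemma continuous_radialDiv {E : Type*} [NormedAddCommGroup E] [NormedSpace ℝ E] {f : Space → E}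
    (hf : ContDiff ℝ ∞ f) : Continuous (radialDiv f) :=
  (hf.continuous.const_smul (3 : ℝ)).add
    ((hf.continuous_fderiv (by simp)).clm_apply continuous_id)

lemma support_radialDiv_subset {E : Type*} [NormedAddCommGroup E] [NormedSpace ℝ E]
    (f : Space → E) : Function.support (radialDiv f) ⊆ tsupport f := fun x hx => by
  by_contra hxn
  have e1 : f x = 0 := image_eq_zero_of_notMem_tsupport hxn
  have e2 : fderiv ℝ f x = 0 :=
    image_eq_zero_of_notMem_tsupport fun hm => hxn (tsupport_fderiv_subset ℝ hm)
  exact hx (by simp [radialDiv, e1, e2])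

lemma hasCompactSupport_radialDiv {E : Type*} [NormedAddCommGroup E] [NormedSpace ℝ E]
    {f : Space → E} (hc : HasCompactSupport f) : HasCompactSupport (radialDiv f) :=
  hc.mono' (support_radialDiv_subset f)

lemma tsupport_radialDiv_subset {E : Type*} [NormedAddCommGroup E] [NormedSpace ℝ E]
    (f : Space → E) : tsupport (radialDiv f) ⊆ tsupport f :=
  closure_minimal (support_radialDiv_subset f) (isClosed_tsupport f)

lemma HasWeakEulerDerivOn.weak_radialDiv {W G : Space → Mat} {U : Set Space}
    (h : HasWeakEulerDerivOn W G U) (k l : Fin 2) {f : Space → ℝ} (hf : ContDiff ℝ ∞ f)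
    (hc : HasCompactSupport f) (hU : tsupport f ⊆ U) :
    -∫ x, radialDiv f x • W x k l = ∫ x, f x • G x k l := by
  simpa [radialDiv, Complex.real_smul] using h.weak k l f hf hc hU

/-- The weak radial derivative tested with complex functions. -/
lemma HasWeakEulerDerivOn.weak_complex {W G : Space → Mat} {U : Set Space}
    (h : HasWeakEulerDerivOn W G U) (k l : Fin 2) {g : Space → ℂ} (hg : ContDiff ℝ ∞ g)
    (hc : HasCompactSupport g) (hU : tsupport g ⊆ U) :
    -∫ x, radialDiv g x * W x k l = ∫ x, g x * G x k l := by
  -- Real linear functionals commute with `radialDiv`, so the real and imaginary parts of `g` are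
  -- themselves admissible test functions.
  have key : ∀ L : ℂ →L[ℝ] ℝ,
      (∀ x, radialDiv (fun y => L (g y)) x = L (radialDiv g x)) ∧
      ContDiff ℝ ∞ (fun y => L (g y)) ∧ HasCompactSupport (fun y => L (g y)) ∧
      tsupport (fun y => L (g y)) ⊆ U := fun L => by
    refine ⟨fun x => ?_, L.contDiff.comp hg, hc.comp_left (map_zero L),
      (tsupport_comp_subset (map_zero L) g).trans hU⟩
    have h1 : HasFDerivAt (fun y => L (g y)) (L.comp (fderiv ℝ g x)) x :=
      L.hasFDerivAt.comp x (hg.differentiable (by simp) x).hasFDerivAt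
    simp only [radialDiv, h1.fderiv, map_add, map_smul, ContinuousLinearMap.comp_apply]
  obtain ⟨a1, a2, a3, a4⟩ := key Complex.reCLM
  obtain ⟨b1, b2, b3, b4⟩ := key Complex.imCLM
  have hW := locallyIntegrableOn_entry h.locInt k l
  have hG := locallyIntegrableOn_entry h.locInt_deriv k l
  have i1 := integrable_test_smul_on (continuous_radialDiv a2) (hasCompactSupport_radialDiv a3)
    ((tsupport_radialDiv_subset _).trans a4) hW
  have i2 := integrable_test_smul_on (continuous_radialDiv b2) (hasCompactSupport_radialDiv b3)
    ((tsupport_radialDiv_subset _).trans b4) hW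
  have i3 := integrable_test_smul_on a2.continuous a3 a4 hG
  have i4 := integrable_test_smul_on b2.continuous b3 b4 hG
  have w1 := h.weak_radialDiv k l a2 a3 a4
  have w2 := h.weak_radialDiv k l b2 b3 b4
  have split : ∀ z w : ℂ, z * w = z.re • w + Complex.I * (z.im • w) := fun z w => by
    conv_lhs => rw [← Complex.re_add_im z]
    rw [Complex.real_smul, Complex.real_smul]
    ring
  have e1 : ∀ x, radialDiv g x * W x k l = radialDiv (fun y => Complex.reCLM (g y)) x • W x k l
      + Complex.I * (radialDiv (fun y => Complex.imCLM (g y)) x • W x k l) := fun x => by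
    rw [a1, b1, split]
    rfl
  have e2 : ∀ x, g x * G x k l = Complex.reCLM (g x) • G x k l
      + Complex.I * (Complex.imCLM (g x) • G x k l) := fun x => split _ _
  simp only [e1, e2]
  rw [integral_add i1 (i2.const_mul _), integral_add i3 (i4.const_mul _), integral_const_mul,
    integral_const_mul, ← w1, ← w2]
  ring

/-- The radial derivative of a Hermitian field is Hermitian. -/
lemma HasWeakEulerDerivOn.ae_isHermitian {W G : Space → Mat} {U : Set Space}
    (h : HasWeakEulerDerivOn W G U) (hU : IsOpen U) (hW : ∀ x, (W x).IsHermitian) :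
    ∀ᵐ x, x ∈ U → (G x).IsHermitian := by
  -- Tested with real functions, the distributional identity passes to complex conjugates. Hence `G`
  -- and its adjoint both represent the derivative of the Hermitian `W`, and they agree by
  -- uniqueness.
  have hkl : ∀ k l, ∀ᵐ x, x ∈ U → conj (G x l k) - G x k l = 0 := fun k l => by
    have hG1 := locallyIntegrableOn_entry h.locInt_deriv k l
    have hG2 : LocallyIntegrableOn (fun x => conj (G x l k)) U volume := fun x hx => by
      obtain ⟨s, hs, hi⟩ := locallyIntegrableOn_entry h.locInt_deriv l k x hx
      exact ⟨s, hs, Complex.conjCLE.toContinuousLinearMap.integrable_comp hi⟩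
    refine hU.ae_eq_zero_of_integral_contDiff_smul_eq_zero (hG2.sub hG1) fun f hf hc hs => ?_
    simp only [smul_sub]
    rw [integral_sub (integrable_test_smul_on hf.continuous hc hs hG2)
      (integrable_test_smul_on hf.continuous hc hs hG1), sub_eq_zero,
      ← h.weak_radialDiv k l hf hc hs]
    have e1 : ∀ x, f x • conj (G x l k) = conj (f x • G x l k) := fun x => by
      simp [Complex.real_smul]
    have e2 : ∀ x, radialDiv f x • W x k l = conj (radialDiv f x • W x l k) := fun x => by
      rw [Complex.real_smul, Complex.real_smul, map_mul, Complex.conj_ofReal]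
      congr 1
      exact ((hW x).apply k l).symm
    simp only [e1, e2]
    rw [integral_conj, integral_conj, ← map_neg, h.weak_radialDiv l k hf hc hs]
  filter_upwards [hkl 0 0, hkl 0 1, hkl 1 0, hkl 1 1] with x h1 h2 h3 h4 hx
  ext k l
  rw [Matrix.conjTranspose_apply]
  fin_cases k <;> fin_cases l
  · exact sub_eq_zero.1 (h1 hx)
  · exact sub_eq_zero.1 (h2 hx)
  · exact sub_eq_zero.1 (h3 hx)
  · exact sub_eq_zero.1 (h4 hx)

/-- A splitting of the distribution `x · ∇W` into a compactly supported part and a bounded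
function `H`. -/
structure IsEulerSplitting (W : Space → Mat) (χ : Space → ℝ) (H : Space → Mat) (D : ℝ) : Prop where
  smooth : ContDiff ℝ ∞ χ
  compact : HasCompactSupport χ
  nonneg : 0 ≤ D
  bound_div : ∀ x, |radialDiv χ x| ≤ D
  bound_coord : ∀ x (j : Fin 3), |χ x * x j| ≤ D
  meas : AEStronglyMeasurable H
  bound : ∀ᵐ x, ‖H x‖ ≤ D
  split : ∀ (k l : Fin 2) (g : Space → ℂ), ContDiff ℝ ∞ g → HasCompactSupport g →
    -∫ x, radialDiv g x * W x k l
      = (∫ x, g x * H x k l) - ∫ x, radialDiv (fun y => χ y • g y) x * W x k l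

/-- The integrand of the form of `x · ∇W` on the domain of `P - A`. -/
noncomputable def eulerDensity (W : Space → Mat) (χ : Space → ℝ) (H : Space → Mat)
    (φ : Space → Spinor) (η : Fin 3 → Space → Spinor) (ψ : Space → Spinor)
    (ζ : Fin 3 → Space → Spinor) (x : Space) : ℂ :=
  -- The bracket is `div (xχφ̄ψ)` contracted with `W`. The gradient of `φ̄ψ` is expressed by `∂ⱼψ =
  -- i(ζⱼ + Aⱼψ)` and its conjugate for `φ`; the two terms with `Aⱼ` cancel.
  inner ℂ (φ x) (act (H x) (ψ x)) - (((radialDiv χ x : ℝ) : ℂ) * inner ℂ (φ x) (act (W x) (ψ x))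
    + Complex.I * ∑ j : Fin 3, ((χ x * x j : ℝ) : ℂ) *
      (inner ℂ (φ x) (act (W x) (ζ j x)) - inner ℂ (η j x) (act (W x) (ψ x))))

lemma norm_eulerDensity_le {W : Space → Mat} {χ : Space → ℝ} {H : Space → Mat} {D : ℝ}
    (hS : IsEulerSplitting W χ H D) (φ : Space → Spinor) (η : Fin 3 → Space → Spinor)
    (ψ : Space → Spinor) (ζ : Fin 3 → Space → Spinor) :
    ∀ᵐ x, ‖eulerDensity W χ H φ η ψ ζ x‖ ≤ D * (‖φ x‖ * ‖ψ x‖ + ‖W x‖ * (‖φ x‖ * ‖ψ x‖)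
      + ∑ j, ‖W x‖ * (‖φ x‖ * ‖ζ j x‖ + ‖η j x‖ * ‖ψ x‖)) := by
  filter_upwards [hS.bound] with x hx
  have hD := hS.nonneg
  have h1 : ‖inner ℂ (φ x) (act (H x) (ψ x))‖ ≤ D * (‖φ x‖ * ‖ψ x‖) :=
    (norm_inner_act_le _ _ _).trans (mul_le_mul_of_nonneg_right hx (by positivity))
  have h2 : ‖((radialDiv χ x : ℝ) : ℂ) * inner ℂ (φ x) (act (W x) (ψ x))‖
      ≤ D * (‖W x‖ * (‖φ x‖ * ‖ψ x‖)) := by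
    rw [norm_mul, Complex.norm_real]
    exact mul_le_mul (hS.bound_div x) (norm_inner_act_le _ _ _) (norm_nonneg _) hD
  have h3 : ‖Complex.I * ∑ j : Fin 3, ((χ x * x j : ℝ) : ℂ) *
      (inner ℂ (φ x) (act (W x) (ζ j x)) - inner ℂ (η j x) (act (W x) (ψ x)))‖
      ≤ D * ∑ j, ‖W x‖ * (‖φ x‖ * ‖ζ j x‖ + ‖η j x‖ * ‖ψ x‖) := by
    rw [norm_mul, Complex.norm_I, one_mul, Finset.mul_sum]
    refine (norm_sum_le _ _).trans (Finset.sum_le_sum fun j _ => ?_)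
    rw [norm_mul, Complex.norm_real]
    refine mul_le_mul (hS.bound_coord x j) ((norm_sub_le _ _).trans ?_) (norm_nonneg _) hD
    rw [mul_add]
    exact add_le_add (norm_inner_act_le _ _ _) (norm_inner_act_le _ _ _)
  refine (norm_sub_le _ _).trans ?_
  refine (add_le_add h1 ((norm_add_le _ _).trans (add_le_add h2 h3))).trans (le_of_eq ?_)
  ring

/-- A square integrable function that controls the density of the form. -/
noncomputable def eulerEnvelope (W : Space → Mat) (φ : Space → Spinor)
    (η : Fin 3 → Space → Spinor) (x : Space) : ℝ :=
  ‖φ x‖ + ‖‖W x‖ • φ x‖ + ∑ j, ‖η j x‖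

lemma eulerEnvelope_nonneg (W : Space → Mat) (φ : Space → Spinor) (η : Fin 3 → Space → Spinor)
    (x : Space) : 0 ≤ eulerEnvelope W φ η x := by
  unfold eulerEnvelope; positivity

/-- Every product in the estimate of the density can be grouped as a factor depending on `φ` times
one depending on `ψ`, with `|W|` attached to an undifferentiated spinor. The envelopes collect these
factors, so Cauchy-Schwarz yields a bound in the graph norm. -/
lemma norm_eulerDensity_le_envelope {W : Space → Mat} {χ : Space → ℝ} {H : Space → Mat} {D : ℝ}
    (hS : IsEulerSplitting W χ H D) (φ : Space → Spinor) (η : Fin 3 → Space → Spinor)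
    (ψ : Space → Spinor) (ζ : Fin 3 → Space → Spinor) :
    ∀ᵐ x, ‖eulerDensity W χ H φ η ψ ζ x‖ ≤ D * (eulerEnvelope W φ η x * eulerEnvelope W ψ ζ x) := by
  filter_upwards [norm_eulerDensity_le hS φ η ψ ζ] with x hx
  refine hx.trans (mul_le_mul_of_nonneg_left ?_ hS.nonneg)
  simp only [eulerEnvelope, norm_smul, norm_norm, Fin.sum_univ_three]
  have a0 := norm_nonneg (φ x)
  have b0 := norm_nonneg (ψ x)
  have w0 := norm_nonneg (W x)
  have p0 := norm_nonneg (η 0 x)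
  have p1 := norm_nonneg (η 1 x)
  have p2 := norm_nonneg (η 2 x)
  have q0 := norm_nonneg (ζ 0 x)
  have q1 := norm_nonneg (ζ 1 x)
  have q2 := norm_nonneg (ζ 2 x)
  generalize ‖φ x‖ = a at *
  generalize ‖ψ x‖ = b at *
  generalize ‖W x‖ = w at *
  generalize ‖η 0 x‖ = y0 at *
  generalize ‖η 1 x‖ = y1 at *
  generalize ‖η 2 x‖ = y2 at *
  generalize ‖ζ 0 x‖ = z0 at *
  generalize ‖ζ 1 x‖ = z1 at *
  generalize ‖ζ 2 x‖ = z2 at *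
  rw [← sub_nonneg]
  have e : (a + w * a + (y0 + y1 + y2)) * (b + w * b + (z0 + z1 + z2))
      - (a * b + w * (a * b) + (w * (a * z0 + y0 * b) + w * (a * z1 + y1 * b)
        + w * (a * z2 + y2 * b)))
      = a * (w * b) + w * a * (w * b) + a * (z0 + z1 + z2)
        + (y0 + y1 + y2) * b + (y0 + y1 + y2) * (z0 + z1 + z2) := by ring
  rw [e]
  positivity

lemma exists_eulerEnvelope_bound {A : Space → Space} (hA : LpLoc 2 A) {W : Space → Mat}
    (hW : LpLoc 3 W) (hb : BoundedOutsideCompact W) :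
    ∃ C : ℝ, 0 ≤ C ∧ ∀ (φ : Space → Spinor) (η : Fin 3 → Space → Spinor),
      IsMagneticGradient A φ η → MemLp (eulerEnvelope W φ η) 2 volume ∧
      ∫ x, eulerEnvelope W φ η x ^ 2 ≤ C * (gradNormSq η + normSq φ) := by
  obtain ⟨C, hC0, hC⟩ := relative_bound_zero hA hW hb one_pos
  -- The five counts the summands of the envelope, squared by Cauchy-Schwarz; `2 + C` absorbs the
  -- relative bound of `Wφ` with `ε = 1`.
  refine ⟨5 * (2 + C), by positivity, fun φ η h => ?_⟩
  obtain ⟨hm, hle⟩ := hC φ η h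
  have hmem : MemLp (eulerEnvelope W φ η) 2 volume :=
    (h.memLp.norm.add hm.norm).add (memLp_finsetSum _ fun j _ => (h.memLp_grad j).norm)
  refine ⟨hmem, ?_⟩
  have hg : ∀ j, Integrable fun x => ‖η j x‖ ^ 2 := fun j => (h.memLp_grad j).integrable_normSq
  have i1 := h.memLp.integrable_normSq
  have i2 := hm.integrable_normSq
  have i3 : Integrable fun x => ∑ j, ‖η j x‖ ^ 2 := integrable_finsetSum _ fun j _ => hg j
  have hptw : ∀ x, eulerEnvelope W φ η x ^ 2
      ≤ 5 * (‖φ x‖ ^ 2 + ‖‖W x‖ • φ x‖ ^ 2 + ∑ j, ‖η j x‖ ^ 2) := fun x => by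
    simp only [eulerEnvelope, Fin.sum_univ_three]
    generalize ‖φ x‖ = a
    generalize ‖‖W x‖ • φ x‖ = b
    generalize ‖η 0 x‖ = y0
    generalize ‖η 1 x‖ = y1
    generalize ‖η 2 x‖ = y2
    have h5 := sq_sum_le_card_mul_sum_sq (s := (Finset.univ : Finset (Fin 5)))
      (f := ![a, b, y0, y1, y2])
    simp [Fin.sum_univ_five] at h5
    linarith
  refine (integral_mono hmem.integrable_sq (((i1.add i2).add i3).const_mul 5) hptw).trans ?_
  have e : ∫ x, 5 * (((fun x => ‖φ x‖ ^ 2) + fun x => ‖‖W x‖ • φ x‖ ^ 2) x + ∑ j, ‖η j x‖ ^ 2)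
      = 5 * (normSq φ + normSq (fun x => ‖W x‖ • φ x) + gradNormSq η) := by
    rw [integral_const_mul, integral_add (i1.add i2) i3, integral_add' i1 i2,
      integral_finsetSum _ fun j _ => hg j]
    rfl
  refine e.le.trans ?_
  have := gradNormSq_nonneg η
  have := normSq_nonneg φ
  nlinarith

lemma aestronglyMeasurable_eulerDensity {W : Space → Mat} {χ : Space → ℝ} {H : Space → Mat} {D : ℝ}
    (hS : IsEulerSplitting W χ H D) (hW : AEStronglyMeasurable W) {φ ψ : Space → Spinor}
    {η ζ : Fin 3 → Space → Spinor} (hφ : AEStronglyMeasurable φ) (hψ : AEStronglyMeasurable ψ)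
    (hη : ∀ j, AEStronglyMeasurable (η j)) (hζ : ∀ j, AEStronglyMeasurable (ζ j)) :
    AEStronglyMeasurable (eulerDensity W χ H φ η ψ ζ) := by
  have h1 := hφ.inner (𝕜 := ℂ) (aestronglyMeasurable_act hS.meas hψ)
  have h2 := hφ.inner (𝕜 := ℂ) (aestronglyMeasurable_act hW hψ)
  have h3 : AEStronglyMeasurable fun x => ((radialDiv χ x : ℝ) : ℂ) :=
    (Complex.continuous_ofReal.comp (continuous_radialDiv hS.smooth)).aestronglyMeasurable
  have h4 : ∀ j : Fin 3, AEStronglyMeasurable fun x : Space => ((χ x * x j : ℝ) : ℂ) := fun j =>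
    (Complex.continuous_ofReal.comp (hS.smooth.continuous.mul
      (EuclideanSpace.proj (𝕜 := ℝ) j).continuous)).aestronglyMeasurable
  have h5 : AEStronglyMeasurable fun x => ∑ j : Fin 3, ((χ x * x j : ℝ) : ℂ) *
      (inner ℂ (φ x) (act (W x) (ζ j x)) - inner ℂ (η j x) (act (W x) (ψ x))) :=
    Finset.aestronglyMeasurable_fun_sum _ fun j _ => (h4 j).mul
      ((hφ.inner (aestronglyMeasurable_act hW (hζ j))).sub
        ((hη j).inner (aestronglyMeasurable_act hW hψ)))
  exact h1.sub ((h3.mul h2).add (h5.const_mul Complex.I))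

lemma integrable_eulerDensity {A : Space → Space} (hA : LpLoc 2 A) {W : Space → Mat}
    (hW : LpLoc 3 W) (hb : BoundedOutsideCompact W) {χ : Space → ℝ} {H : Space → Mat} {D : ℝ}
    (hS : IsEulerSplitting W χ H D) {φ ψ : Space → Spinor} {η ζ : Fin 3 → Space → Spinor}
    (h : IsMagneticGradient A φ η) (h' : IsMagneticGradient A ψ ζ) :
    Integrable (eulerDensity W χ H φ η ψ ζ) := by
  obtain ⟨C, -, hC⟩ := exists_eulerEnvelope_bound hA hW hb
  have hWm : AEStronglyMeasurable W := (hW.locallyIntegrable (by norm_num)).aestronglyMeasurable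
  have hi : Integrable fun x => eulerEnvelope W φ η x * eulerEnvelope W ψ ζ x :=
    (hC φ η h).1.integrable_mul (hC ψ ζ h').1
  exact (hi.const_mul D).mono' (aestronglyMeasurable_eulerDensity hS hWm h.memLp.1 h'.memLp.1
    (fun j => (h.memLp_grad j).1) (fun j => (h'.memLp_grad j).1))
    (norm_eulerDensity_le_envelope hS φ η ψ ζ)

open scoped Classical in
/-- The extension of the distribution `x · ∇W` to the domain of `P - A`. -/
noncomputable def eulerForm (A : Space → Space) (W : Space → Mat) (χ : Space → ℝ)
    (H : Space → Mat) (φ ψ : Space → Spinor) : ℂ :=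
  if h : InDomain A φ ∧ InDomain A ψ then
    ∫ x, eulerDensity W χ H φ h.1.choose ψ h.2.choose x
  else 0

/-- Magnetic gradients are unique almost everywhere, so the gradients picked by choice in
`eulerForm` can be exchanged for any others. -/
lemma eulerForm_eq {A : Space → Space} (hA : LpLoc 2 A) (W : Space → Mat) (χ : Space → ℝ)
    (H : Space → Mat) {φ ψ : Space → Spinor} {η ζ : Fin 3 → Space → Spinor}
    (h : IsMagneticGradient A φ η) (h' : IsMagneticGradient A ψ ζ) :
    eulerForm A W χ H φ ψ = ∫ x, eulerDensity W χ H φ η ψ ζ x := by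
  have hd : InDomain A φ ∧ InDomain A ψ := ⟨⟨η, h⟩, ⟨ζ, h'⟩⟩
  rw [eulerForm, dif_pos hd]
  refine integral_congr_ae ?_
  have e1 := ae_all_iff.2 fun j => hd.1.choose_spec.ae_eq hA h j
  have e2 := ae_all_iff.2 fun j => hd.2.choose_spec.ae_eq hA h' j
  filter_upwards [e1, e2] with x h1 h2
  simp only [eulerDensity, h1, h2]

/-- The bound of the form of `x · ∇W` in the graph norm. -/
lemma exists_norm_eulerForm_sq_le {A : Space → Space} (hA : LpLoc 2 A) {W : Space → Mat}
    (hW : LpLoc 3 W) (hb : BoundedOutsideCompact W) {χ : Space → ℝ} {H : Space → Mat} {D : ℝ}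
    (hS : IsEulerSplitting W χ H D) :
    ∃ C : ℝ, ∀ φ η ψ ζ, IsMagneticGradient A φ η → IsMagneticGradient A ψ ζ →
      ‖eulerForm A W χ H φ ψ‖ ^ 2
        ≤ C * (gradNormSq η + normSq φ) * (gradNormSq ζ + normSq ψ) := by
  obtain ⟨C, hC0, hC⟩ := exists_eulerEnvelope_bound hA hW hb
  refine ⟨D ^ 2 * C ^ 2, fun φ η ψ ζ h h' => ?_⟩
  obtain ⟨m1, b1⟩ := hC φ η h
  obtain ⟨m2, b2⟩ := hC ψ ζ h'
  set a := ∫ x, eulerEnvelope W φ η x ^ 2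
  set b := ∫ x, eulerEnvelope W ψ ζ x ^ 2
  have ha : 0 ≤ a := integral_nonneg fun x => by positivity
  have hb0 : 0 ≤ b := integral_nonneg fun x => by positivity
  have hi : Integrable fun x => eulerEnvelope W φ η x * eulerEnvelope W ψ ζ x :=
    m1.integrable_mul m2
  have cs := integral_mul_le_Lp_mul_Lq_of_nonneg (μ := volume) Real.HolderConjugate.two_two
    (ae_of_all _ (eulerEnvelope_nonneg W φ η)) (ae_of_all _ (eulerEnvelope_nonneg W ψ ζ))
    (by simpa using m1) (by simpa using m2)
  simp only [Real.rpow_two, ← Real.sqrt_eq_rpow] at cs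
  have h1 : ‖eulerForm A W χ H φ ψ‖ ≤ D * (√a * √b) := by
    rw [eulerForm_eq hA W χ H h h']
    refine (norm_integral_le_of_norm_le (hi.const_mul D)
      (norm_eulerDensity_le_envelope hS φ η ψ ζ)).trans ?_
    rw [integral_const_mul]
    exact mul_le_mul_of_nonneg_left cs hS.nonneg
  calc ‖eulerForm A W χ H φ ψ‖ ^ 2 ≤ (D * (√a * √b)) ^ 2 := by gcongr
    _ = D ^ 2 * (a * b) := by
      rw [mul_pow, mul_pow, Real.sq_sqrt ha, Real.sq_sqrt hb0]
    _ ≤ D ^ 2 * ((C * (gradNormSq η + normSq φ)) * (C * (gradNormSq ζ + normSq ψ))) := by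
      have := gradNormSq_nonneg η
      have := normSq_nonneg φ
      gcongr
    _ = _ := by ring

/-- The form of `x · ∇W` has relative bound zero. -/
lemma eulerForm_relative_bound {A : Space → Space} (hA : LpLoc 2 A) {W : Space → Mat}
    (hW : LpLoc 3 W) (hb : BoundedOutsideCompact W) {χ : Space → ℝ} {H : Space → Mat} {D : ℝ}
    (hS : IsEulerSplitting W χ H D) {ε : ℝ} (hε : 0 < ε) :
    ∃ C : ℝ, 0 ≤ C ∧ ∀ φ η, IsMagneticGradient A φ η →
      (eulerForm A W χ H φ φ).re ≤ ε * gradNormSq η + C * normSq φ := by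
  have hD := hS.nonneg
  -- The coefficient of `|Wφ|²`: `D` from the term without derivatives, `2D²/ε` from each of three
  -- cross terms by Young's inequality, and `1` for positivity. Taking `ε / (2M)` below costs `ε/2`
  -- of the gradient term; the cross terms use the other half.
  set M : ℝ := D + 6 * D ^ 2 / ε + 1 with hM
  have hM0 : 0 < M := by positivity
  obtain ⟨C, hC0, hC⟩ := relative_bound_zero hA hW hb (ε := ε / (2 * M)) (by positivity)
  refine ⟨2 * D + M * C, by positivity, fun φ η h => ?_⟩
  obtain ⟨hm, hle⟩ := hC φ η h
  have hg : ∀ j, Integrable fun x => ‖η j x‖ ^ 2 := fun j => (h.memLp_grad j).integrable_normSq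
  have i1 := h.memLp.integrable_normSq
  have i2 := hm.integrable_normSq
  have i3 : Integrable fun x => ∑ j, ‖η j x‖ ^ 2 := integrable_finsetSum _ fun j _ => hg j
  have hptw : ∀ᵐ x, ‖eulerDensity W χ H φ η φ η x‖ ≤
      (2 * D * ‖φ x‖ ^ 2 + M * ‖‖W x‖ • φ x‖ ^ 2) + ε / 2 * ∑ j, ‖η j x‖ ^ 2 := by
    filter_upwards [norm_eulerDensity_le hS φ η φ η] with x hx
    refine hx.trans ?_
    rw [norm_smul, norm_norm]
    set a := ‖φ x‖
    set w := ‖W x‖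
    have t1 : D * (w * (a * a)) ≤ D * (w * a) ^ 2 + D * a ^ 2 := by
      have : w * (a * a) ≤ (w * a) ^ 2 + a ^ 2 := by
        nlinarith [sq_nonneg (w * a - a / 2), sq_nonneg a]
      nlinarith
    have t2 : ∀ y : ℝ, D * (w * (a * y + y * a)) ≤ 2 * D ^ 2 / ε * (w * a) ^ 2 + ε / 2 * y ^ 2 := by
      intro y
      have : 0 ≤ (2 * D * (w * a) - ε * y) ^ 2 / (2 * ε) := by positivity
      have e : (2 * D * (w * a) - ε * y) ^ 2 / (2 * ε)
          = 2 * D ^ 2 / ε * (w * a) ^ 2 + ε / 2 * y ^ 2 - D * (w * (a * y + y * a)) := by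
        field_simp
        ring
      linarith
    simp only [Fin.sum_univ_three]
    have u0 := t2 ‖η 0 x‖
    have u1 := t2 ‖η 1 x‖
    have u2 := t2 ‖η 2 x‖
    have e : M * (w * a) ^ 2 = D * (w * a) ^ 2 + 3 * (2 * D ^ 2 / ε * (w * a) ^ 2)
        + (w * a) ^ 2 := by
      rw [hM]
      ring
    rw [e]
    nlinarith [sq_nonneg (w * a)]
  refine (Complex.re_le_norm _).trans ?_
  rw [eulerForm_eq hA W χ H h h]
  refine (norm_integral_le_of_norm_le
    (((i1.const_mul (2 * D)).add (i2.const_mul M)).add (i3.const_mul (ε / 2))) hptw).trans ?_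
  have e : ∫ x, (((fun x => 2 * D * ‖φ x‖ ^ 2) + (fun x => M * ‖‖W x‖ • φ x‖ ^ 2) : Space → ℝ) x
      + ε / 2 * ∑ j, ‖η j x‖ ^ 2)
      = 2 * D * normSq φ + M * normSq (fun x => ‖W x‖ • φ x) + ε / 2 * gradNormSq η := by
    rw [integral_add ((i1.const_mul _).add (i2.const_mul _)) (i3.const_mul _),
      integral_add' (i1.const_mul _) (i2.const_mul _), integral_const_mul, integral_const_mul,
      integral_const_mul, integral_finsetSum _ fun j _ => hg j]
    rfl
  refine e.le.trans ?_
  have h6 : M * normSq (fun x => ‖W x‖ • φ x)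
      ≤ M * (ε / (2 * M) * gradNormSq η + C * normSq φ) :=
    mul_le_mul_of_nonneg_left hle hM0.le
  have h7 : M * (ε / (2 * M) * gradNormSq η + C * normSq φ)
      = ε / 2 * gradNormSq η + M * C * normSq φ := by
    field_simp
  linarith

lemma locallyIntegrable_entry {W : Space → Mat} (hW : LocallyIntegrable W) (k l : Fin 2) :
    LocallyIntegrable fun x => W x k l :=
  locallyIntegrableOn_univ.1 (locallyIntegrableOn_entry (locallyIntegrableOn_univ.2 hW) k l)

lemma integrable_test_mul {f g : Space → ℂ} (hf : Continuous f) (hc : HasCompactSupport f)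
    (hg : LocallyIntegrable g) : Integrable fun x => f x * g x := by
  have h := ((hg.integrableOn_isCompact hc.isCompact).continuousOn_mul hf.continuousOn hc.isCompact)
  refine (integrableOn_iff_integrable_of_support_subset fun x hx => subset_tsupport f ?_).1 h
  exact fun h0 : f x = 0 => hx (by simp [h0])

lemma hasCompactSupport_real_smul (χ : Space → ℝ) {g : Space → ℂ} (hc : HasCompactSupport g) :
    HasCompactSupport fun y => χ y • g y :=
  hc.mono fun x hx h0 => hx (show χ x • g x = 0 by rw [h0, smul_zero])

lemma radialDiv_add {f g : Space → ℂ} (hf : ContDiff ℝ ∞ f) (hg : ContDiff ℝ ∞ g) (x : Space) :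
    radialDiv (fun y => f y + g y) x = radialDiv f x + radialDiv g x := by
  rw [radialDiv, fderiv_fun_add (hf.differentiable (by simp) x) (hg.differentiable (by simp) x)]
  simp only [radialDiv, add_apply, smul_add]
  ring

lemma radialDiv_smul {χ : Space → ℝ} {f : Space → ℂ} (hχ : ContDiff ℝ ∞ χ) (hf : ContDiff ℝ ∞ f)
    (x : Space) : radialDiv (fun y => χ y • f y) x
      = (radialDiv χ x : ℝ) • f x + χ x • fderiv ℝ f x x := by
  rw [radialDiv, fderiv_fun_smul (hχ.differentiable (by simp) x) (hf.differentiable (by simp) x)]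
  simp only [radialDiv, add_apply, smul_apply, ContinuousLinearMap.smulRight_apply,
    Complex.real_smul, smul_eq_mul]
  push_cast
  ring

/-- A field whose distribution `x · ∇W` is bounded outside of a compact set has a splitting. -/
lemma exists_isEulerSplitting {W G : Space → Mat} (hW : LocallyIntegrable W) {R : ℝ}
    (hG : HasWeakEulerDerivOn W G {x | R < ‖x‖}) (hb : BoundedOutsideCompact G) :
    ∃ (χ : Space → ℝ) (H : Space → Mat) (D ρ : ℝ), IsEulerSplitting W χ H D ∧ 0 < ρ ∧
      R < ρ ∧ ∀ x : Space, ρ ≤ ‖x‖ → χ x = 0 ∧ radialDiv χ x = 0 ∧ H x = G x := by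
  obtain ⟨R', C, hC⟩ := hb
  set r : ℝ := max |R| |R'| + 1 with hr
  have hr0 : 0 < r := by positivity
  have hrR : R < r := by
    have := (le_abs_self R).trans (le_max_left _ |R'|); linarith
  have hrR' : R' ≤ r := by
    have := (le_abs_self R').trans (le_max_right |R| _); linarith
  let b : ContDiffBump (0 : Space) := ⟨r, r + 1, hr0, by linarith⟩
  have hbs : ContDiff ℝ ∞ b := b.contDiff
  have hbc : HasCompactSupport b := b.hasCompactSupport
  have hb1 : ∀ x : Space, ‖x‖ ≤ r → b x = 1 := fun x hx =>
    b.one_of_mem_closedBall (mem_closedBall_zero_iff.2 hx)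
  have hb0 : ∀ x : Space, r + 1 < ‖x‖ → x ∉ tsupport b := fun x hx => by
    rw [b.tsupport_eq, mem_closedBall_zero_iff, not_le]
    exact hx
  obtain ⟨D₁, hD₁⟩ := (hasCompactSupport_radialDiv hbc).exists_bound_of_continuous
    (continuous_radialDiv hbs)
  have hU : IsOpen {x : Space | R < ‖x‖} := isOpen_lt continuous_const continuous_norm
  have hone : ∀ x : Space, ‖x‖ ≤ r → (1 - b x) = 0 := fun x hx => by rw [hb1 x hx, sub_self]
  -- The factor `1 - b` vanishes for `|x| ≤ r`, where nothing is known of `G`. The constant `D`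
  -- collects the three required bounds, and the radius `r + 2` lies beyond the support of `b`, a
  -- ball of radius `r + 1`.
  refine ⟨b, fun x => (1 - b x) • G x, |D₁| + (r + 1) + |C|, r + 2,
    ⟨hbs, hbc, by positivity, fun x => ?_, fun x j => ?_, ?_, ?_, fun k l g hg hc => ?_⟩,
    by positivity, by linarith, fun x hx => ?_⟩
  · have := (hD₁ x).trans (le_abs_self D₁)
    rw [Real.norm_eq_abs] at this
    linarith [abs_nonneg C]
  · rw [abs_mul, abs_of_nonneg b.nonneg]
    have h2 : |x j| ≤ ‖x‖ := PiLp.norm_apply_le x j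
    rcases le_or_gt ‖x‖ (r + 1) with h | h
    · have : b x * |x j| ≤ 1 * ‖x‖ := mul_le_mul b.le_one h2 (abs_nonneg _) zero_le_one
      linarith [abs_nonneg C, abs_nonneg D₁]
    · rw [image_eq_zero_of_notMem_tsupport (hb0 x h), zero_mul]
      positivity
  · have h1 : AEStronglyMeasurable G (volume.restrict {x : Space | R < ‖x‖}) :=
      hG.locInt_deriv.aestronglyMeasurable
    have h2 : AEStronglyMeasurable ({x : Space | R < ‖x‖}.indicator fun x => (1 - b x) • G x) :=
      (aestronglyMeasurable_indicator_iff hU.measurableSet).2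
        ((continuous_const.sub hbs.continuous).aestronglyMeasurable.smul h1)
    rwa [Set.indicator_eq_self.2] at h2
    intro x hx
    by_contra hxn
    have : ‖x‖ ≤ r := (not_lt.1 hxn).trans hrR.le
    exact hx (by simp [hone x this])
  · filter_upwards [hC] with x hx
    rw [norm_smul, Real.norm_of_nonneg (sub_nonneg.2 b.le_one)]
    rcases le_or_gt ‖x‖ r with h | h
    · rw [hone x h, zero_mul]
      positivity
    · have h3 := hx (hrR'.trans h.le)
      have h4 : (1 - b x) * ‖G x‖ ≤ 1 * ‖G x‖ :=
        mul_le_mul_of_nonneg_right (by linarith [b.nonneg (x := x)]) (norm_nonneg _)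
      linarith [le_abs_self C, abs_nonneg D₁]
  · have s1 : ContDiff ℝ ∞ fun y => b y • g y := hbs.smul hg
    have s2 : ContDiff ℝ ∞ fun y => (1 - b y) • g y := (contDiff_const.sub hbs).smul hg
    have c1 : HasCompactSupport fun y => b y • g y := hasCompactSupport_real_smul b hc
    have c2 : HasCompactSupport fun y => (1 - b y) • g y :=
      hasCompactSupport_real_smul (fun y => 1 - b y) hc
    have e0 : g = fun y => b y • g y + (1 - b y) • g y := by
      funext y
      rw [← add_smul, add_sub_cancel, one_smul]
    have hWkl := locallyIntegrable_entry hW k l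
    have i1 := integrable_test_mul (continuous_radialDiv s1) (hasCompactSupport_radialDiv c1) hWkl
    have i2 := integrable_test_mul (continuous_radialDiv s2) (hasCompactSupport_radialDiv c2) hWkl
    -- The outer piece is supported in `{r ≤ |x|}`, inside the open set where the distribution is
    -- the function `G`, so there the weak identity applies.
    have hsub : tsupport (fun y => (1 - b y) • g y) ⊆ {x | R < ‖x‖} := by
      refine (closure_minimal (t := {x : Space | r ≤ ‖x‖}) (fun x hx => ?_)
        (isClosed_le continuous_const continuous_norm)).trans fun x hx => hrR.trans_le hx
      by_contra hxn
      exact hx (by simp [hone x (not_le.1 hxn).le])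
    have w := hG.weak_complex k l s2 c2 hsub
    have e1 : ∀ x, radialDiv g x * W x k l = radialDiv (fun y => b y • g y) x * W x k l
        + radialDiv (fun y => (1 - b y) • g y) x * W x k l := fun x => by
      conv_lhs => rw [e0]
      rw [radialDiv_add s1 s2, add_mul]
    have e2 : ∀ x, g x * ((1 - b x) • G x) k l = (1 - b x) • g x * G x k l := fun x => by
      rw [Matrix.smul_apply, smul_mul_assoc, mul_smul_comm]
    simp only [e1, e2]
    rw [integral_add i1 i2, neg_add, w]
    ring
  · have hx' : x ∉ tsupport b := hb0 x (by linarith)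
    have h0 : b x = 0 := image_eq_zero_of_notMem_tsupport hx'
    refine ⟨h0, ?_, by simp [h0]⟩
    exact by_contra fun hn => hx' (support_radialDiv_subset _ hn)

/-! ### Agreement with the distribution on test spinors, and the resulting form -/

lemma sum_coord_smul_single (x : Space) :
    ∑ j : Fin 3, x j • EuclideanSpace.single j (1 : ℝ) = x := by
  ext i
  fin_cases i <;> simp [Fin.sum_univ_three]

lemma fderiv_conj_mul {φ ψ : Space → Spinor} (hφ : ContDiff ℝ ∞ φ) (hψ : ContDiff ℝ ∞ ψ)
    (k l : Fin 2) :
    ContDiff ℝ ∞ (fun y => conj (φ y k) * ψ y l) ∧ ∀ x v : Space,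
      fderiv ℝ (fun y => conj (φ y k) * ψ y l) x v
        = conj (fderiv ℝ φ x v k) * ψ x l + conj (φ x k) * fderiv ℝ ψ x v l := by
  set P : ∀ i : Fin 2, Spinor →L[ℝ] ℂ := fun i =>
    (EuclideanSpace.proj (𝕜 := ℂ) i).restrictScalars ℝ with hP
  set Q : Spinor →L[ℝ] ℂ := Complex.conjCLE.toContinuousLinearMap.comp (P k) with hQ
  refine ⟨(Q.contDiff.comp hφ).mul ((P l).contDiff.comp hψ), fun x v => ?_⟩
  have h1 : HasFDerivAt (fun y => conj (φ y k)) (Q.comp (fderiv ℝ φ x)) x :=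
    Q.hasFDerivAt.comp x (hφ.differentiable (by simp) x).hasFDerivAt
  have h2 : HasFDerivAt (fun y => ψ y l) ((P l).comp (fderiv ℝ ψ x)) x :=
    (P l).hasFDerivAt.comp x (hψ.differentiable (by simp) x).hasFDerivAt
  rw [(h1.fun_mul h2).fderiv]
  simp [hQ, hP]
  ring

/-- The density of the form for test spinors. -/
lemma eulerDensity_of_contDiff (A : Space → Space) (W : Space → Mat) {χ : Space → ℝ}
    (H : Space → Mat) (hχ : ContDiff ℝ ∞ χ) {φ ψ : Space → Spinor} (hφ : ContDiff ℝ ∞ φ)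
    (hψ : ContDiff ℝ ∞ ψ) (x : Space) :
    eulerDensity W χ H φ
      (fun j x => -(Complex.I • fderiv ℝ φ x (EuclideanSpace.single j 1)) - A x j • φ x) ψ
      (fun j x => -(Complex.I • fderiv ℝ ψ x (EuclideanSpace.single j 1)) - A x j • ψ x) x
    = ∑ k : Fin 2, ∑ l : Fin 2, ((conj (φ x k) * ψ x l) * H x k l
        - radialDiv (fun y => χ y • (conj (φ y k) * ψ y l)) x * W x k l) := by
  -- Gauge invariance: `Aⱼ` is real, so its contributions to the two inner products cancel, and the
  -- factors `-i` combine with the prefactor `i` to leave the ordinary product rule.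
  have hj : ∀ j : Fin 3, Complex.I * (inner ℂ (φ x) (act (W x)
        (-(Complex.I • fderiv ℝ ψ x (EuclideanSpace.single j 1)) - A x j • ψ x))
      - inner ℂ (-(Complex.I • fderiv ℝ φ x (EuclideanSpace.single j 1)) - A x j • φ x)
        (act (W x) (ψ x)))
      = inner ℂ (φ x) (act (W x) (fderiv ℝ ψ x (EuclideanSpace.single j 1)))
        + inner ℂ (fderiv ℝ φ x (EuclideanSpace.single j 1)) (act (W x) (ψ x)) := fun j => by
    have e1 : -(Complex.I • fderiv ℝ ψ x (EuclideanSpace.single j 1)) - A x j • ψ x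
        = (-Complex.I) • fderiv ℝ ψ x (EuclideanSpace.single j 1) + (-(A x j : ℂ)) • ψ x := by
      rw [neg_smul, neg_smul, Complex.coe_smul, sub_eq_add_neg]
    have e2 : -(Complex.I • fderiv ℝ φ x (EuclideanSpace.single j 1)) - A x j • φ x
        = (-Complex.I) • fderiv ℝ φ x (EuclideanSpace.single j 1) + (-(A x j : ℂ)) • φ x := by
      rw [neg_smul, neg_smul, Complex.coe_smul, sub_eq_add_neg]
    rw [e1, e2, act_add, act_smul, act_smul, inner_add_right, inner_add_left, inner_smul_right,
      inner_smul_right, inner_smul_left, inner_smul_left]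
    simp only [map_neg, Complex.conj_I, Complex.conj_ofReal]
    linear_combination (-(inner ℂ (φ x) (act (W x) (fderiv ℝ ψ x (EuclideanSpace.single j 1))))
      - inner ℂ (fderiv ℝ φ x (EuclideanSpace.single j 1)) (act (W x) (ψ x))) * Complex.I_mul_I
  have hsum : ∀ F : Space → Spinor, ContDiff ℝ ∞ F →
      fderiv ℝ F x x = ∑ j : Fin 3, (x j : ℂ) • fderiv ℝ F x (EuclideanSpace.single j 1) :=
    fun F _ => by
      conv_lhs => rw [← sum_coord_smul_single x]
      rw [map_sum]
      refine Finset.sum_congr rfl fun j _ => ?_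
      rw [map_smul, Complex.coe_smul, sum_coord_smul_single]
  have hI : Complex.I * ∑ j : Fin 3, ((χ x * x j : ℝ) : ℂ) * (inner ℂ (φ x) (act (W x)
        (-(Complex.I • fderiv ℝ ψ x (EuclideanSpace.single j 1)) - A x j • ψ x))
      - inner ℂ (-(Complex.I • fderiv ℝ φ x (EuclideanSpace.single j 1)) - A x j • φ x)
        (act (W x) (ψ x)))
      = (χ x : ℂ) * (inner ℂ (φ x) (act (W x) (fderiv ℝ ψ x x))
        + inner ℂ (fderiv ℝ φ x x) (act (W x) (ψ x))) := by
    rw [Finset.mul_sum]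
    simp only [mul_left_comm Complex.I, hj]
    rw [hsum φ hφ, hsum ψ hψ]
    simp only [Fin.sum_univ_three, act_add, act_smul, inner_add_right, inner_add_left,
      inner_smul_left, inner_smul_right, Complex.conj_ofReal]
    push_cast
    ring
  rw [eulerDensity, hI]
  have hr : ∀ k l, radialDiv (fun y => χ y • (conj (φ y k) * ψ y l)) x
      = (radialDiv χ x : ℝ) • (conj (φ x k) * ψ x l) + χ x • (conj (fderiv ℝ φ x x k) * ψ x l
        + conj (φ x k) * fderiv ℝ ψ x x l) := fun k l => by
    rw [radialDiv_smul hχ (fderiv_conj_mul hφ hψ k l).1, (fderiv_conj_mul hφ hψ k l).2]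
  rw [Finset.sum_congr rfl fun k _ => Finset.sum_congr rfl fun l _ => by rw [hr k l]]
  simp only [inner_act_eq_sum, Complex.real_smul, Fin.sum_univ_two]
  ring

lemma eulerForm_test {A : Space → Space} (hA : LpLoc 2 A) {W : Space → Mat}
    (hW : LocallyIntegrable W) {χ : Space → ℝ} {H : Space → Mat} {D : ℝ}
    (hS : IsEulerSplitting W χ H D) {φ ψ : Space → Spinor} (hφ : ContDiff ℝ ∞ φ)
    (hφc : HasCompactSupport φ) (hψ : ContDiff ℝ ∞ ψ) (hψc : HasCompactSupport ψ) :
    eulerForm A W χ H φ ψ = eulerFormOnTest W φ ψ := by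
  have hHl : LocallyIntegrable H := (locallyIntegrable_const D).mono hS.meas (by
    filter_upwards [hS.bound] with x hx
    exact hx.trans (le_abs_self D))
  set f : Fin 2 → Fin 2 → Space → ℂ := fun k l y => conj (φ y k) * ψ y l with hf
  have hfs : ∀ k l, ContDiff ℝ ∞ (f k l) := fun k l => (fderiv_conj_mul hφ hψ k l).1
  have hfc : ∀ k l, HasCompactSupport (f k l) := fun k l => by
    refine hφc.mono fun x hx => ?_
    exact fun h0 : φ x = 0 => hx (by simp [hf, h0])
  have hχs : ∀ k l, ContDiff ℝ ∞ fun y => χ y • f k l y := fun k l => hS.smooth.smul (hfs k l)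
  have hχc : ∀ k l, HasCompactSupport fun y => χ y • f k l y := fun k l =>
    hasCompactSupport_real_smul χ (hfc k l)
  have i1 : ∀ k l, Integrable fun x => f k l x * H x k l := fun k l =>
    integrable_test_mul (hfs k l).continuous (hfc k l) (locallyIntegrable_entry hHl k l)
  have i2 : ∀ k l, Integrable fun x => radialDiv (fun y => χ y • f k l y) x * W x k l := fun k l =>
    integrable_test_mul (continuous_radialDiv (hχs k l)) (hasCompactSupport_radialDiv (hχc k l))
      (locallyIntegrable_entry hW k l)
  have i3 : ∀ k l, Integrable fun x => radialDiv (f k l) x * W x k l := fun k l =>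
    integrable_test_mul (continuous_radialDiv (hfs k l)) (hasCompactSupport_radialDiv (hfc k l))
      (locallyIntegrable_entry hW k l)
  rw [eulerForm_eq hA W χ H (isMagneticGradient_of_contDiff hA hφ hφc)
    (isMagneticGradient_of_contDiff hA hψ hψc), eulerFormOnTest]
  have i4 : ∀ k l, Integrable fun x => f k l x * H x k l
      - radialDiv (fun y => χ y • f k l y) x * W x k l := fun k l => (i1 k l).sub (i2 k l)
  rw [integral_congr_ae (g := fun x => ∑ k : Fin 2, ∑ l : Fin 2, (f k l x * H x k l
      - radialDiv (fun y => χ y • f k l y) x * W x k l))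
    (ae_of_all _ (eulerDensity_of_contDiff A W H hS.smooth hφ hψ))]
  have e : ∀ k l x, W x k l * (3 * (conj (φ x k) * ψ x l)
      + fderiv ℝ (fun y => conj (φ y k) * ψ y l) x x) = radialDiv (f k l) x * W x k l :=
    fun k l x => by
      rw [mul_comm, radialDiv, Complex.real_smul]
      norm_num [hf]
  simp only [e]
  rw [integral_finsetSum _ fun k _ => integrable_finsetSum _ fun l _ => i4 k l,
    integral_finsetSum _ fun k _ => integrable_finsetSum _ fun l _ => i3 k l,
    ← Finset.sum_neg_distrib]
  refine Finset.sum_congr rfl fun k _ => ?_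
  rw [integral_finsetSum _ fun l _ => i4 k l,
    integral_finsetSum _ fun l _ => i3 k l, ← Finset.sum_neg_distrib]
  refine Finset.sum_congr rfl fun l _ => ?_
  rw [hS.split k l (f k l) (hfs k l) (hfc k l)]
  exact integral_sub (i1 k l) (i2 k l)

/-- The extension of the distribution `x · ∇W` is a bounded sesquilinear form. -/
lemma isEulerForm_eulerForm {A : Space → Space} (hA : LpLoc 2 A) {W : Space → Mat}
    (hW : LpLoc 3 W) (hb : BoundedOutsideCompact W) {χ : Space → ℝ} {H : Space → Mat} {D : ℝ}
    (hS : IsEulerSplitting W χ H D) : IsEulerForm A W (eulerForm A W χ H) where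
  add_left := by
    rintro φ₁ φ₂ ψ ⟨η₁, h₁⟩ ⟨η₂, h₂⟩ ⟨ζ, h⟩
    rw [eulerForm_eq hA W χ H h₁ h, eulerForm_eq hA W χ H h₂ h,
      eulerForm_eq hA W χ H (h₁.add hA h₂) h, ← integral_add
        (integrable_eulerDensity hA hW hb hS h₁ h) (integrable_eulerDensity hA hW hb hS h₂ h)]
    refine integral_congr_ae (ae_of_all _ fun x => ?_)
    simp only [eulerDensity, Pi.add_apply, inner_add_left, Fin.sum_univ_three]
    ring
  add_right := by
    rintro φ ψ₁ ψ₂ ⟨η, h⟩ ⟨ζ₁, h₁⟩ ⟨ζ₂, h₂⟩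
    rw [eulerForm_eq hA W χ H h h₁, eulerForm_eq hA W χ H h h₂,
      eulerForm_eq hA W χ H h (h₁.add hA h₂), ← integral_add
        (integrable_eulerDensity hA hW hb hS h h₁) (integrable_eulerDensity hA hW hb hS h h₂)]
    refine integral_congr_ae (ae_of_all _ fun x => ?_)
    simp only [eulerDensity, Pi.add_apply, act_add, inner_add_right, Fin.sum_univ_three]
    ring
  smul_left := by
    rintro c φ ψ ⟨η, h⟩ ⟨ζ, h'⟩
    rw [eulerForm_eq hA W χ H h h', eulerForm_eq hA W χ H (h.smul hA c) h', ← integral_const_mul]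
    refine integral_congr_ae (ae_of_all _ fun x => ?_)
    simp only [eulerDensity, Pi.smul_apply, inner_smul_left, Fin.sum_univ_three]
    ring
  smul_right := by
    rintro c φ ψ ⟨η, h⟩ ⟨ζ, h'⟩
    rw [eulerForm_eq hA W χ H h h', eulerForm_eq hA W χ H h (h'.smul hA c), ← integral_const_mul]
    refine integral_congr_ae (ae_of_all _ fun x => ?_)
    simp only [eulerDensity, Pi.smul_apply, act_smul, inner_smul_right, Fin.sum_univ_three]
    ring
  bounded := exists_norm_eulerForm_sq_le hA hW hb hS
  test := fun _ _ hφ hφc hψ hψc =>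
    eulerForm_test hA (hW.locallyIntegrable (by norm_num)) hS hφ hφc hψ hψc

/-- Outside of a large ball the form of `x · ∇W` is given by the function `G`. -/
lemma re_eulerForm_le {A : Space → Space} (hA : LpLoc 2 A) {W : Space → Mat}
    (hW : LpLoc 3 W) (hb : BoundedOutsideCompact W) {χ : Space → ℝ} {G H : Space → Mat} {D ρ : ℝ}
    (hS : IsEulerSplitting W χ H D)
    (hρ : ∀ x : Space, ρ ≤ ‖x‖ → χ x = 0 ∧ radialDiv χ x = 0 ∧ H x = G x)
    {R : ℝ} (hR : ρ ≤ R) {c : ℝ}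
    (hc : ∀ᵐ x : Space, R ≤ ‖x‖ → ∀ v, (inner ℂ v (act (G x) v)).re ≤ c * ‖v‖ ^ 2)
    {φ : Space → Spinor} {η : Fin 3 → Space → Spinor} (h : IsMagneticGradient A φ η)
    (hs : SupportedOutside R φ) : (eulerForm A W χ H φ φ).re ≤ c * normSq φ := by
  have hi := integrable_eulerDensity hA hW hb hS h h
  have e : (∫ x, eulerDensity W χ H φ η φ η x).re = ∫ x, (eulerDensity W χ H φ η φ η x).re :=
    (Complex.reCLM.integral_comp_comm hi).symm
  rw [eulerForm_eq hA W χ H h h, e, normSq, ← integral_const_mul]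
  refine integral_mono_ae (Complex.reCLM.integrable_comp hi)
    (h.memLp.integrable_normSq.const_mul c) ?_
  filter_upwards [hc, hs] with x h1 h2
  rcases le_or_gt R ‖x‖ with hx | hx
  · obtain ⟨e1, e2, e3⟩ := hρ x (hR.trans hx)
    simpa [eulerDensity, e1, e2, e3] using h1 hx (φ x)
  · simp [eulerDensity, h2 hx, act_eq_toEuclideanLin]

/-! ### Relative and asymptotic bounds assembled -/

lemma LpLoc.add {F : Type*} [NormedAddCommGroup F] {p : ℝ≥0∞} {f g : Space → F} (hf : LpLoc p f)
    (hg : LpLoc p g) : LpLoc p (f + g) := fun K hK => (hf K hK).add (hg K hK)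

lemma LpLoc.norm_smul {p : ℝ≥0∞} {W : Space → Mat} (hW : LpLoc p W) :
    LpLoc p fun x => ‖x‖ • W x := fun K hK => by
  obtain ⟨C, hC⟩ := hK.isBounded.exists_norm_le
  refine (hW K hK).of_le_mul (c := C) (continuous_norm.aestronglyMeasurable.smul (hW K hK).1) ?_
  refine (ae_restrict_iff' hK.measurableSet).2 (ae_of_all _ fun x hx => ?_)
  rw [_root_.norm_smul, norm_norm]
  exact mul_le_mul_of_nonneg_right (hC x hx) (norm_nonneg _)

lemma memLp_and_normSq_le {φ ψ : Space → Spinor} (hφ : MemLp φ 2 volume)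
    (hψ : AEStronglyMeasurable ψ) {b : ℝ} (h : ∀ᵐ x, ‖ψ x‖ ≤ b * ‖φ x‖) :
    MemLp ψ 2 volume ∧ normSq ψ ≤ b ^ 2 * normSq φ := by
  refine ⟨hφ.of_le_mul hψ h, normSq_le_of_ae hφ ?_⟩
  filter_upwards [h] with x hx
  rw [← mul_pow]
  exact pow_le_pow_left₀ (norm_nonneg _) hx 2

lemma norm_smul_act_le (M : Mat) (r : ℝ) (v : Spinor) : ‖r • act M v‖ ≤ ‖r • M‖ * ‖v‖ := by
  rw [norm_smul, norm_smul, mul_assoc]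
  exact mul_le_mul_of_nonneg_left (norm_act_le M v) (norm_nonneg _)

lemma fieldFormBounded_of_bounded {B : Space → Space} (hA : LpLoc 2 (poincareGauge B))
    (hB : LpLoc 3 B) (hBb : BoundedOutsideCompact B) (hT : LpLoc 3 (tilde 0 B))
    (hTb : BoundedOutsideCompact (tilde 0 B)) : FieldFormBounded B := by
  obtain ⟨C₁, h₁, hC₁⟩ := relative_bound_zero hA hB hBb one_pos
  obtain ⟨C₂, h₂, hC₂⟩ := relative_bound_zero hA hT hTb one_pos
  refine ⟨2 + C₁ + C₂, fun φ η h => ⟨(hC₁ φ η h).1, (hC₂ φ η h).1, ?_⟩⟩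
  have b₁ := (hC₁ φ η h).2
  have b₂ := (hC₂ φ η h).2
  have := gradNormSq_nonneg η
  have := normSq_nonneg φ
  nlinarith [mul_nonneg h₁ this, mul_nonneg h₂ this]

lemma formBoundedWith_of_bounded {A : Space → Space} (hA : LpLoc 2 A) {W : Space → Mat}
    (hW : LpLoc 3 W) (hb : BoundedOutsideCompact W) {α : ℝ} (hα : 0 < α) :
    FormBoundedWith A W α := by
  obtain ⟨C, -, hC⟩ := relative_form_bound_zero hA hW hb hα
  exact ⟨C, fun φ η h => ⟨(hC φ η h).1, (norm_potForm_le (hC φ η h).1).trans (hC φ η h).2⟩⟩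

lemma quantitativeBounds_eulerForm {B : Space → Space} (hA : LpLoc 2 (poincareGauge B))
    (hT : LpLoc 3 (tilde 0 B)) (hTb : BoundedOutsideCompact (tilde 0 B)) {Vs Vl : Space → Mat}
    (hVs : LpLoc 3 Vs) (hVsb : BoundedOutsideCompact fun x => ‖x‖ • Vs x) (hVl : LpLoc 3 Vl)
    (hVlb : BoundedOutsideCompact Vl) {χ : Space → ℝ} {H : Space → Mat} {D : ℝ}
    (hS : IsEulerSplitting Vl χ H D) {α₁ α₂ α₃ : ℝ} (h₁ : 0 < α₁) (h₂ : 0 < α₂) (h₃ : 0 < α₃) :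
    QuantitativeBounds B Vs (eulerForm (poincareGauge B) Vl χ H) α₁ α₂ α₃ := by
  -- The allowed `α₁² / 4` is shared equally between the field and `xV^s`.
  obtain ⟨C₁, hC₁0, hC₁⟩ := relative_bound_zero hA hT hTb (ε := α₁ ^ 2 / 8) (by positivity)
  obtain ⟨C₂, hC₂0, hC₂⟩ := relative_bound_zero hA hVs.norm_smul hVsb (ε := α₁ ^ 2 / 8)
    (by positivity)
  obtain ⟨C₃, hC₃0, hC₃⟩ := eulerForm_relative_bound hA hVl hVlb hS h₂
  obtain ⟨C₄, hC₄0, hC₄⟩ := relative_form_bound_zero hA hVs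
    (boundedOutsideCompact_of_norm_smul hVsb) h₃
  have hVsm : AEStronglyMeasurable Vs := (hVs.locallyIntegrable (by norm_num)).aestronglyMeasurable
  refine ⟨C₁ + C₂ + C₃ + C₄ + 1, by positivity, fun φ η h => ?_⟩
  have hn := normSq_nonneg φ
  obtain ⟨m₁, b₁⟩ := hC₁ φ η h
  obtain ⟨m₂, b₂⟩ := hC₂ φ η h
  have b₃ := hC₃ φ η h
  obtain ⟨d₄, b₄⟩ := hC₄ φ η h
  have p₁ := mul_nonneg hC₁0 hn
  have p₂ := mul_nonneg hC₂0 hn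
  have p₃ := mul_nonneg hC₃0 hn
  have p₄ := mul_nonneg hC₄0 hn
  obtain ⟨m₅, b₅⟩ := memLp_and_normSq_le (b := 1) (ψ := fun x => ‖x‖ • act (Vs x) (φ x)) m₂
    (continuous_norm.aestronglyMeasurable.smul (aestronglyMeasurable_act hVsm h.memLp.1))
    (ae_of_all _ fun x => by
      rw [one_mul, norm_smul ‖‖x‖ • Vs x‖, norm_norm]
      exact norm_smul_act_le _ _ _)
  exact ⟨⟨m₁, m₅, by linarith⟩, by linarith, d₄, (norm_potForm_le d₄).trans (by linarith)⟩

/-- The limits may be taken equal to the limits superior, because beyond `ρ` the form of `x · ∇V^ℓ`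
is multiplication by `G` and all three estimates are pointwise. The gradient terms, with `ε_j = 1 /
(j + 1)`, are only added as nonnegative slack. -/
lemma asymptoticBounds_eulerForm {B : Space → Space} (hA : LpLoc 2 (poincareGauge B))
    (hT : AEStronglyMeasurable (tilde 0 B)) (hTb : BoundedOutsideCompact (tilde 0 B))
    {Vs Vl G : Space → Mat} (hVs : AEStronglyMeasurable Vs)
    (hVsb : BoundedOutsideCompact fun x => ‖x‖ • Vs x) (hVl : LpLoc 3 Vl)
    (hVlb : BoundedOutsideCompact Vl) (hGb : BoundedOutsideCompact G) {χ : Space → ℝ}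
    {H : Space → Mat} {D ρ : ℝ} (hS : IsEulerSplitting Vl χ H D)
    (hρ : ∀ x : Space, ρ ≤ ‖x‖ → χ x = 0 ∧ radialDiv χ x = 0 ∧ H x = G x)
    (hherm : ∀ᵐ x : Space, ρ ≤ ‖x‖ → (G x).IsHermitian) :
    AsymptoticBounds B Vs (eulerForm (poincareGauge B) Vl χ H)
      (essLimsup fun x => ‖tilde 0 B x‖ₑ).toReal (essLimsup fun x => ‖‖x‖ • Vs x‖ₑ).toReal
      (essLimsup fun x => ENNReal.ofReal (posPartNorm (G x))).toReal := by
  obtain ⟨R₁, C₁, hC₁⟩ := hTb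
  obtain ⟨R₂, C₂, hC₂⟩ := hVsb
  obtain ⟨R₃, C₃, hC₃⟩ := hGb
  set r : ℝ := max (max R₁ R₂) (max R₃ (max ρ 1)) with hr
  have r₁ : R₁ ≤ r := (le_max_left _ _).trans (le_max_left _ _)
  have r₂ : R₂ ≤ r := (le_max_right _ _).trans (le_max_left _ _)
  have r₃ : R₃ ≤ r := (le_max_left _ _).trans (le_max_right _ _)
  have r₄ : ρ ≤ r := ((le_max_left _ _).trans (le_max_right _ _)).trans (le_max_right _ _)
  have r₅ : 1 ≤ r := ((le_max_right _ _).trans (le_max_right _ _)).trans (le_max_right _ _)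
  obtain ⟨b, hb0, hba, hbt, hb⟩ := exists_antitone_bounds (f := fun x => ‖tilde 0 B x‖ₑ)
    (r := r) (C := C₁) (by
      filter_upwards [hC₁] with x hx h
      rw [← ofReal_norm]
      exact ENNReal.ofReal_le_ofReal (hx (r₁.trans h)))
  obtain ⟨w, hw0, hwa, hwt, hw⟩ := exists_antitone_bounds (f := fun x => ‖‖x‖ • Vs x‖ₑ)
    (r := r) (C := C₂) (by
      filter_upwards [hC₂] with x hx h
      rw [← ofReal_norm]
      exact ENNReal.ofReal_le_ofReal (hx (r₂.trans h)))
  obtain ⟨g, hg0, hga, hgt, hg⟩ := exists_antitone_bounds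
    (f := fun x => ENNReal.ofReal (posPartNorm (G x))) (r := r) (C := C₃) (by
      filter_upwards [hC₃] with x hx h
      exact ENNReal.ofReal_le_ofReal ((posPartNorm_le_norm _).trans (hx (r₃.trans h))))
  refine ⟨fun j => 1 / (j + 1), fun j => r + j, b, w, g,
    fun j => ⟨by positivity, by positivity, hb0 j, hw0 j, hg0 j⟩,
    tendsto_one_div_add_atTop_nhds_zero_nat,
    tendsto_atTop_add_const_left _ _ tendsto_natCast_atTop_atTop, hba, hwa, hga, hbt, hwt, hgt,
    fun j φ η h hs => ?_⟩
  have hε : 0 ≤ 1 / ((j : ℝ) + 1) * gradNormSq η :=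
    mul_nonneg (by positivity) (gradNormSq_nonneg η)
  have hrj : r ≤ r + j := by simp
  refine ⟨?_, ?_, ?_⟩
  · obtain ⟨m, hm⟩ := memLp_and_normSq_le (b := b j) (ψ := fun x => ‖tilde 0 B x‖ • φ x) h.memLp
      (hT.norm.smul h.memLp.1) (by
        filter_upwards [hb j, hs] with x hx1 hx2
        rcases le_or_gt (r + j) ‖x‖ with hx | hx
        · rw [norm_smul, norm_norm]
          refine mul_le_mul_of_nonneg_right ?_ (norm_nonneg _)
          have := hx1 hx
          rwa [← ofReal_norm, ENNReal.ofReal_le_ofReal_iff (hb0 j).le] at this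
        · simp [hx2 hx])
    exact ⟨m, hm.trans (le_add_of_nonneg_left hε)⟩
  · obtain ⟨m, hm⟩ := memLp_and_normSq_le (b := w j) (ψ := fun x => ‖x‖ • act (Vs x) (φ x)) h.memLp
      (continuous_norm.aestronglyMeasurable.smul (aestronglyMeasurable_act hVs h.memLp.1)) (by
        filter_upwards [hw j, hs] with x hx1 hx2
        rcases le_or_gt (r + j) ‖x‖ with hx | hx
        · refine (norm_smul_act_le _ _ _).trans (mul_le_mul_of_nonneg_right ?_ (norm_nonneg _))
          have := hx1 hx
          rwa [← ofReal_norm, ENNReal.ofReal_le_ofReal_iff (hw0 j).le] at this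
        · simp [hx2 hx, act_eq_toEuclideanLin])
    exact ⟨m, hm.trans (le_add_of_nonneg_left hε)⟩
  · refine (re_eulerForm_le hA hVl hVlb hS hρ (r₄.trans hrj) (c := g j) ?_ h hs).trans
      (le_add_of_nonneg_left hε)
    filter_upwards [hg j, hherm] with x hx1 hx2 hx v
    refine (re_inner_act_le (hx2 ((r₄.trans hrj).trans hx)) v).trans
      (mul_le_mul_of_nonneg_right ?_ (by positivity))
    have := hx1 hx
    rwa [ENNReal.ofReal_le_ofReal_iff (hg0 j).le] at this

end Pauli

theorem propositionA2
    (B : Pauli.Space → Pauli.Space) (V Vs Vl G : Pauli.Space → Pauli.Mat)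
    (hsplit : V = Vs + Vl)
    (hVs_herm : ∀ x, (Vs x).IsHermitian) (hVl_herm : ∀ x, (Vl x).IsHermitian)
    -- `|B ∧ x|`, `|V|` and `|x V^s|` are bounded outside of a compact set
    (hB_bdd : Pauli.BoundedOutsideCompact (Pauli.tilde 0 B))
    (hV_bdd : Pauli.BoundedOutsideCompact V)
    (hVs_bdd : Pauli.BoundedOutsideCompact (fun x => ‖x‖ • Vs x))
    -- outside of a compact set `x · ∇V^ℓ` is the bounded function `G`
    (hG : ∃ R : ℝ, Pauli.HasWeakEulerDerivOn Vl G {x | R < ‖x‖})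
    (hG_bdd : Pauli.BoundedOutsideCompact G)
    -- `|V_+|` tends to zero at infinity
    (hV_pos : Pauli.essLimsup (fun x => ENNReal.ofReal (Pauli.posPartNorm (V x))) = 0)
    -- local integrability
    (p : ℝ≥0∞) (hp : 3 < p)
    (hB_loc : Pauli.LpLoc p (Pauli.tilde 0 B))
    (hVs_loc : Pauli.LpLoc p Vs) (hVl_loc : Pauli.LpLoc p Vl) :
    -- the Poincare gauge potential is well defined almost everywhere and in `L²_loc`
    (∀ᵐ x : Pauli.Space,
      IntervalIntegrable (fun t : ℝ => Pauli.tilde 0 B (t • x)) volume 0 1) ∧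
    Pauli.LpLoc 2 (Pauli.poincareGauge B) ∧
    -- the potential is Hermitian
    (∀ x, (V x).IsHermitian) ∧
    -- mild integrability of the field
    Pauli.LogIntegrableAt 0 B ∧
    -- relative form boundedness of `|B|²` and `|B ∧ x|²`
    (Pauli.LpLoc p B → Pauli.BoundedOutsideCompact B → Pauli.FieldFormBounded B) ∧
    -- the potential is relatively form bounded with bound zero
    (∀ α₀ : ℝ, 0 < α₀ → Pauli.FormBoundedWith (Pauli.poincareGauge B) V α₀) ∧
    -- the positive parts of `V`, `V^s`, `V^ℓ` vanish at infinity
    (Pauli.PosPartVanishesAtInfinity (Pauli.poincareGauge B) V ∧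
      Pauli.PosPartVanishesAtInfinity (Pauli.poincareGauge B) Vs ∧
      Pauli.PosPartVanishesAtInfinity (Pauli.poincareGauge B) Vl) ∧
    -- `V` and `V^s` are bounded at infinity
    (Pauli.BoundedAtInfinity (Pauli.poincareGauge B) V ∧
      Pauli.BoundedAtInfinity (Pauli.poincareGauge B) Vs) ∧
    -- the distribution `x · ∇V^ℓ` extends to a form `q` on the domain of `P - A`, with
    -- the asymptotic bounds and, with relative bounds zero, the quantitative bounds
    (∃ q : (Pauli.Space → Pauli.Spinor) → (Pauli.Space → Pauli.Spinor) → ℂ,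
      Pauli.IsEulerForm (Pauli.poincareGauge B) Vl q ∧
      (∃ β ω₁ ω₂ : ℝ, Pauli.AsymptoticBounds B Vs q β ω₁ ω₂ ∧
        ENNReal.ofReal β ≤ Pauli.essLimsup (fun x => ‖Pauli.tilde 0 B x‖ₑ) ∧
        ENNReal.ofReal ω₁ ≤ Pauli.essLimsup (fun x => ‖‖x‖ • Vs x‖ₑ) ∧
        ENNReal.ofReal ω₂ ≤
          Pauli.essLimsup (fun x => ENNReal.ofReal (Pauli.posPartNorm (G x)))) ∧
      (∀ α₁ α₂ α₃ : ℝ, 0 < α₁ → 0 < α₂ → 0 < α₃ →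
        Pauli.QuantitativeBounds B Vs q α₁ α₂ α₃)) := by
  open Pauli in
  subst hsplit
  have h13 : (3 : ℝ≥0∞) ≤ p := hp.le
  have hT3 : LpLoc 3 (tilde 0 B) := hB_loc.mono h13
  have hVs3 : LpLoc 3 Vs := hVs_loc.mono h13
  have hVl3 : LpLoc 3 Vl := hVl_loc.mono h13
  have hTm := (hT3.locallyIntegrable (by norm_num)).aestronglyMeasurable
  have hVsm := (hVs3.locallyIntegrable (by norm_num)).aestronglyMeasurable
  have hVlm := (hVl3.locallyIntegrable (by norm_num)).aestronglyMeasurable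
  have hA := lpLoc_two_poincareGauge hp hB_loc
  have hVsb := boundedOutsideCompact_of_norm_smul hVs_bdd
  -- `V^ℓ = V - V^s`, and `V^s` is bounded far out because `|x| |V^s|` is.
  have hVlb : BoundedOutsideCompact Vl := by
    have := hV_bdd.sub hVsb
    rwa [add_sub_cancel_left] at this
  obtain ⟨R, hG⟩ := hG
  have hU : IsOpen {x : Space | R < ‖x‖} := isOpen_lt continuous_const continuous_norm
  obtain ⟨χ, H, D, ρ, hS, hρ0, hRρ, hρ⟩ := exists_isEulerSplitting
    (hVl3.locallyIntegrable (by norm_num)) hG hG_bdd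
  have hherm : ∀ᵐ x : Space, ρ ≤ ‖x‖ → (G x).IsHermitian := by
    filter_upwards [hG.ae_isHermitian hU hVl_herm] with x hx h
    exact hx (hRρ.trans_le h)
  refine ⟨ae_intervalIntegrable_tilde hp hB_loc, hA, fun x => (hVs_herm x).add (hVl_herm x),
    logIntegrableAt_zero hp hB_loc,
    fun hB hBb => fieldFormBounded_of_bounded hA (hB.mono h13) hBb hT3 hB_bdd,
    fun α₀ hα => formBoundedWith_of_bounded hA (hVs3.add hVl3) hV_bdd hα,
    posPartVanishesAtInfinity_components hVs_herm hVl_herm hVsm hVlm hV_bdd hVs_bdd hV_pos,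
    ⟨⟨boundedAboveAtInfinity_of_bounded (hVsm.add hVlm) hV_bdd,
      boundedAboveAtInfinity_of_bounded (hVsm.add hVlm).neg hV_bdd.neg⟩,
      boundedAboveAtInfinity_of_bounded hVsm hVsb,
      boundedAboveAtInfinity_of_bounded hVsm.neg hVsb.neg⟩,
    eulerForm (poincareGauge B) Vl χ H, isEulerForm_eulerForm hA hVl3 hVlb hS,
    ⟨_, _, _, asymptoticBounds_eulerForm hA hTm hB_bdd hVsm hVs_bdd hVl3 hVlb hG_bdd hS hρ hherm,
      ENNReal.ofReal_toReal_le, ENNReal.ofReal_toReal_le, ENNReal.ofReal_toReal_le⟩,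
    fun α₁ α₂ α₃ h₁ h₂ h₃ =>
      quantitativeBounds_eulerForm hA hT3 hB_bdd hVs3 hVs_bdd hVl3 hVlb hS h₁ h₂ h₃⟩
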